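/- Let $\rho_{AB}$ be a Gaussian state of $M+N$ bosonic modes, i.e. a density operator on $L^2(\mathbb R^{M}\times\mathbb R^{N})$ (positive, trace one, $\hbar=1$) whose Wigner function is Gaussian with mean $d$ and covariance $\gamma_{AB}/2$, where $\gamma_{AB}$ is a real symmetric positive definite $2(M+N)\times 2(M+N)$ matrix (the covariance matrix, equal to the identity for the vacuum; quadratures ordered $x_1,p_1,x_2,p_2,\dots$). Let $\Omega_A=\bigoplus_{i=1}^{M}\begin{pmatrix}0&1\\-1&0\end{pmatrix}$ and $\Omega_B=\bigoplus_{i=1}^{N}\begin{pmatrix}0&1\\-1&0\end{pmatrix}$. A Gaussian measurement on a system of modes is a positive-operator-valued measure $E$ on some $\mathbb R^k$ with $\int e^{i s\cdot a}\,E(da)=W(Ks)\,e^{i s\cdot c-\frac14 s^{T}Ls}$ for all $s\in\mathbb R^k$, for some real matrix $K$, some real symmetric $L\ge 0$ and some $c\in\mathbb R^k$, where $W(\xi)=\exp(i\,\xi\cdot R)$ are the Weyl operators and $R$ is the vector of quadratures; this includes homodyne and general-dyne detection. The state $\rho_{AB}$ is non-steerable from $A$ to $B$ by Gaussian measurements if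 there are a probability measure $\mu$ on hidden variables $\lambda$ and density operators $\sigma_\lambda$ of $B$ (measurable in $\lambda$) such that for every Gaussian measurement $E$ on $A$ there are response probabilities $P_E(\cdot\mid\lambda)$ with $$\operatorname{Tr}_A\big[(E(S)\otimes 1)\rho_{AB}\big]=\int P_E(S\mid\lambda)\,\sigma_\lambda\,d\mu(\lambda)$$ for all Borel sets $S$ of outcomes; otherwise it is steerable from $A$ to $B$. Steerability from $B$ to $A$ is defined with the parties exchanged. Theorem (Peres conjecture, Gaussian case). If $\rho_{AB}$ is steerable by Gaussian measurements from $A$ to $B$, or from $B$ to $A$, then the inequality $\gamma_{AB}+i(-\Omega_A\oplus\Omega_B)\ge 0$ is violated, and the partial transpose of $\rho_{AB}$ with respect to $A$ (in the position representation) is a bounded operator that has a negative eigenvalue; that is, $\rho_{AB}$ is NPT. -/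

import Mathlib

open MeasureTheory
open scoped Kronecker InnerProductSpace ComplexOrder

namespace GaussianSteering

noncomputable section

/-! ### Matrices -/

/-- The symplectic form `Ω = ⊕ [[0, 1], [-1, 0]]` of a system of modes labelled by `ι`. The
quadratures are ordered mode by mode: `(i, 0)` is the position and `(i, 1)` the momentum of
mode `i`. -/
def Omega (ι : Type) [DecidableEq ι] : Matrix (ι × Fin 2) (ι × Fin 2) ℝ :=
  (1 : Matrix ι ι ℝ) ⊗ₖ !![0, 1; -1, 0]

/-- The form `-Ω_A ⊕ Ω_B` on the quadratures of the modes `α` of `A` and `β` of `B`. -/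
def partialOmega (α β : Type) [DecidableEq α] [DecidableEq β] :
    Matrix ((α ⊕ β) × Fin 2) ((α ⊕ β) × Fin 2) ℝ :=
  (Matrix.fromBlocks (-Omega α) 0 0 (Omega β)).submatrix
    (Equiv.sumProdDistrib α β (Fin 2)) (Equiv.sumProdDistrib α β (Fin 2))

/-- The complex matrix `γ + i ω`. -/
def plusI {n : Type} (γ ω : Matrix n n ℝ) : Matrix n n ℂ :=
  γ.map Complex.ofReal + Complex.I • ω.map Complex.ofReal

/-! ### Hilbert spaces of modes -/

/-- The Hilbert space `L²(ℝ^ι)` of a system of modes labelled by `ι`. -/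
abbrev L2 (ι : Type) [Fintype ι] : Type := Lp ℂ 2 (volume : Measure (ι → ℝ))

section tensor

variable {α β : Type} [Fintype α] [Fintype β]

theorem memLp_tensor (f : L2 α) (g : L2 β) :
    MemLp (fun x : α ⊕ β → ℝ => f (fun i => x (Sum.inl i)) * g (fun j => x (Sum.inr j))) 2
      volume := by
  have h : MemLp (fun z : (α → ℝ) × (β → ℝ) => f z.1 * g z.2) 2
      ((volume : Measure (α → ℝ)).prod (volume : Measure (β → ℝ))) := by
    have hf := Lp.memLp f
    have hg := Lp.memLp g
    have hm : AEStronglyMeasurable (fun z : (α → ℝ) × (β → ℝ) => f z.1 * g z.2)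
        ((volume : Measure (α → ℝ)).prod (volume : Measure (β → ℝ))) :=
      (hf.1.comp_fst).mul (hg.1.comp_snd)
    rw [memLp_two_iff_integrable_sq_norm hm]
    have hf2 := (memLp_two_iff_integrable_sq_norm hf.1).1 hf
    have hg2 := (memLp_two_iff_integrable_sq_norm hg.1).1 hg
    refine (hf2.mul_prod hg2).congr (Filter.Eventually.of_forall fun z => ?_)
    simp only [norm_mul, mul_pow]
  exact h.comp_measurePreserving
    (volume_measurePreserving_sumPiEquivProdPi (fun _ : α ⊕ β => ℝ))

/-- The product vector `f ⊗ g`, that is `(x, y) ↦ f x * g y`, where the Hilbert space of the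
composite system is `L²(ℝ^α × ℝ^β) = L²(ℝ^(α ⊕ β))`. -/
def tensor (f : L2 α) (g : L2 β) : L2 (α ⊕ β) :=
  (memLp_tensor f g).toLp _

end tensor

/-! ### States -/

/-- The operator `T` has trace `t`, computed in any orthonormal basis. -/
def HasTrace {H : Type} [NormedAddCommGroup H] [InnerProductSpace ℂ H]
    (T : H →L[ℂ] H) (t : ℂ) : Prop :=
  ∀ (κ : Type) (b : HilbertBasis κ ℂ H), HasSum (fun j => ⟪b j, T (b j)⟫_ℂ) t

/-- Density operators: positive operators of trace one. -/
def IsDensityOperator {H : Type} [NormedAddCommGroup H] [InnerProductSpace ℂ H]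
    (ρ : H →L[ℂ] H) : Prop :=
  ρ.IsPositive ∧ HasTrace ρ 1

/-- The phase-space point with positions `r` and momenta `p`. -/
def phasePoint {ι : Type} (r p : ι → ℝ) : ι × Fin 2 → ℝ :=
  fun q => ![r q.1, p q.1] q.2

/-- The integral kernel of the operator with Wigner function `w` (inverse Wigner transform,
with `ħ = 1`): `k(x, y) = ∫ w((x + y) / 2, p) exp(i p·(x - y)) dp`. -/
def wignerKernel {ι : Type} [Fintype ι] (w : (ι × Fin 2 → ℝ) → ℝ) (x y : ι → ℝ) : ℂ :=
  ∫ p : ι → ℝ, (w (phasePoint ((2 : ℝ)⁻¹ • (x + y)) p) : ℂ) *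
    Complex.exp (Complex.I * ((p ⬝ᵥ (x - y) : ℝ) : ℂ))

/-- The Gaussian probability density on phase space with mean `d` and covariance `γ / 2`. The
vacuum has `γ = 1`. -/
def gaussianWigner {ι : Type} [Fintype ι] [DecidableEq ι] (d : ι × Fin 2 → ℝ)
    (γ : Matrix (ι × Fin 2) (ι × Fin 2) ℝ) (ξ : ι × Fin 2 → ℝ) : ℝ :=
  Real.exp (-((ξ - d) ⬝ᵥ (γ⁻¹.mulVec (ξ - d)))) / (Real.pi ^ Fintype.card ι * Real.sqrt γ.det)

/-- `ρ` is a Gaussian state with displacement `d` and covariance matrix `γ`: a density operator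
whose Wigner function is the Gaussian with these parameters. -/
def IsGaussianState {ι : Type} [Fintype ι] [DecidableEq ι] (ρ : L2 ι →L[ℂ] L2 ι)
    (d : ι × Fin 2 → ℝ) (γ : Matrix (ι × Fin 2) (ι × Fin 2) ℝ) : Prop :=
  IsDensityOperator ρ ∧ γ.PosDef ∧
    ∀ f : L2 ι, ρ f =ᵐ[volume]
      fun x => ∫ y : ι → ℝ, wignerKernel (gaussianWigner d γ) x y * f y

/-! ### Measurements -/

/-- A positive-operator-valued measure on `Ω`. Countable additivity is expressed by the outcome
distributions `S ↦ ⟪f, E(S) f⟫` being measures. -/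
structure POVM (Ω : Type) [MeasurableSpace Ω] (H : Type) [NormedAddCommGroup H]
    [InnerProductSpace ℂ H] where
  /-- The effect `E(S)`. -/
  effect : Set Ω → (H →L[ℂ] H)
  /-- The outcome distribution (unnormalized, unless `f` is a unit vector). -/
  law : H → Measure Ω
  isPositive_effect : ∀ S, MeasurableSet S → (effect S).IsPositive
  effect_univ : effect Set.univ = 1
  law_apply : ∀ f S, MeasurableSet S → law f S = ENNReal.ofReal (⟪f, effect S f⟫_ℂ).re

/-- The expectation `⟪f, W(ξ) f⟫` of the Weyl operator `W(ξ) = exp(i(u·X + v·P))`, which acts by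
`(W(ξ) f)(x) = exp(i(u·x + u·v/2)) f(x + v)`; here `u i = ξ (i, 0)` and `v i = ξ (i, 1)`. -/
def weylExpectation {ι : Type} [Fintype ι] (ξ : ι × Fin 2 → ℝ) (f : L2 ι) : ℂ :=
  ∫ x : ι → ℝ, (starRingEnd ℂ) (f x) *
    Complex.exp (Complex.I *
      (((fun i => ξ (i, 0)) ⬝ᵥ x + ((fun i => ξ (i, 0)) ⬝ᵥ fun i => ξ (i, 1)) / 2 : ℝ) : ℂ)) *
    f (x + fun i => ξ (i, 1))

/-- Gaussian measurements: POVMs `E` on `ℝ^k` whose operator-valued characteristic function is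
Gaussian, `∫ exp(i s·a) E(da) = W(K s) exp(i s·c - sᵀ L s / 4)`. The outcome is the tuple of linear
combinations of quadratures given by the columns of `K`, shifted by `c`, with Gaussian noise of
covariance `L / 2`. Homodyne (`L = 0`) and heterodyne or general-dyne detection are included. -/
def IsGaussianMeasurement {ι : Type} [Fintype ι] {k : ℕ} (E : POVM (Fin k → ℝ) (L2 ι)) : Prop :=
  ∃ (K : Matrix (ι × Fin 2) (Fin k) ℝ) (L : Matrix (Fin k) (Fin k) ℝ) (c : Fin k → ℝ),
    L.PosSemidef ∧ ∀ (f : L2 ι) (s : Fin k → ℝ),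
      ∫ a, Complex.exp (Complex.I * ((s ⬝ᵥ a : ℝ) : ℂ)) ∂(E.law f) =
        weylExpectation (K.mulVec s) f *
          Complex.exp (Complex.I * ((s ⬝ᵥ c : ℝ) : ℂ) - ((s ⬝ᵥ L.mulVec s : ℝ) : ℂ) / 4)

/-! ### Steering -/

/-- The joint state `ρ` of an untrusted party (modes `α`) and a trusted party (modes `β`) admits a
local-hidden-state model for all Gaussian measurements of the untrusted party. Here `τ f g` is the
product of a vector `f` of the untrusted and a vector `g` of the trusted party.

The left-hand sum is `Tr[ρ (E(S) ⊗ |φ⟩⟨φ|)]`, the expectation in `φ` of the (unnormalized) state of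
the trusted party conditional on an outcome in `S`. It has to be equal to
`∫ P_E(S | l) ⟪φ, σ_l φ⟫ dμ(l)`, where the distribution `μ` of the hidden variable and the
hidden states `σ_l` do not depend on the measurement. Effects `|φ⟩⟨φ|` determine the
conditional state, and hence the statistics of all measurements of the trusted party. -/
def HasLHSModel {α β ι : Type} [Fintype α] [Fintype β] [Fintype ι]
    (τ : L2 α → L2 β → L2 ι) (ρ : L2 ι →L[ℂ] L2 ι) : Prop :=
  ∃ (Λ : Type) (_ : MeasurableSpace Λ) (μ : Measure Λ) (σ : Λ → (L2 β →L[ℂ] L2 β)),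
    IsProbabilityMeasure μ ∧
    (∀ l, IsDensityOperator (σ l)) ∧
    (∀ φ, Measurable fun l => ⟪φ, σ l φ⟫_ℂ) ∧
    ∀ (k : ℕ) (E : POVM (Fin k → ℝ) (L2 α)), IsGaussianMeasurement E →
      ∃ P : ProbabilityTheory.Kernel Λ (Fin k → ℝ), ProbabilityTheory.IsMarkovKernel P ∧
        ∀ (S : Set (Fin k → ℝ)), MeasurableSet S → ∀ (φ : L2 β)
          (κ : Type) (b : HilbertBasis κ ℂ (L2 α)),
          HasSum (fun j => ⟪τ (b j) φ, ρ (τ (E.effect S (b j)) φ)⟫_ℂ)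
            (∫ l, ((P l).real S : ℂ) * ⟪φ, σ l φ⟫_ℂ ∂μ)

/-- `ρ` is steerable from `A` (modes `α`) to `B` (modes `β`) by Gaussian measurements. -/
def IsSteerableAB {α β : Type} [Fintype α] [Fintype β]
    (ρ : L2 (α ⊕ β) →L[ℂ] L2 (α ⊕ β)) : Prop :=
  ¬ HasLHSModel (α := α) (β := β) (fun f g => tensor f g) ρ

/-- `ρ` is steerable from `B` (modes `β`) to `A` (modes `α`) by Gaussian measurements. -/
def IsSteerableBA {α β : Type} [Fintype α] [Fintype β]
    (ρ : L2 (α ⊕ β) →L[ℂ] L2 (α ⊕ β)) : Prop :=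
  ¬ HasLHSModel (α := β) (β := α) (fun g f => tensor f g) ρ

/-! ### Partial transposition -/

/-- `T` is the partial transpose of `ρ` with respect to `A`, in the position representation. Since
product vectors are total, `T` is unique. The star is complex conjugation of functions. -/
def IsPartialTranspose {α β : Type} [Fintype α] [Fintype β]
    (ρ T : L2 (α ⊕ β) →L[ℂ] L2 (α ⊕ β)) : Prop :=
  ∀ (f f' : L2 α) (g g' : L2 β),
    ⟪tensor f g, T (tensor f' g')⟫_ℂ = ⟪tensor (star f') g, ρ (tensor (star f) g')⟫_ℂ

/-- `ρ` is NPT: its partial transpose has a negative eigenvalue. -/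
def IsNPT {α β : Type} [Fintype α] [Fintype β] (ρ : L2 (α ⊕ β) →L[ℂ] L2 (α ⊕ β)) : Prop :=
  ∃ T : L2 (α ⊕ β) →L[ℂ] L2 (α ⊕ β), IsPartialTranspose ρ T ∧
    ∃ t : ℝ, t < 0 ∧ Module.End.HasEigenvalue (T : L2 (α ⊕ β) →ₗ[ℂ] L2 (α ⊕ β)) (t : ℂ)

end

end GaussianSteering

namespace GaussianSteering

noncomputable section

set_option linter.unusedSectionVars false

/-! ### Compact self-adjoint operators -/

section hilbert

variable {H : Type*} [NormedAddCommGroup H] [InnerProductSpace ℂ H] [CompleteSpace H]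

/-! Both conclusions rest on when a Gaussian function is the Wigner function of a positive operator:
exactly when `γ + iΩ ≥ 0`. Integrating out the momentum turns the Wigner function into the kernel
`g(x) conj(g(y)) exp(½ xᵀQy)` (up to a shift of the origin), where `Q = S - P + i(G - Gᵀ)` collects
the inverse position covariance `P`, the covariance `S` of momentum given position and the
regression matrix `G` (`wignerKernel_gaussianWigner`, `gaussKernel_eq_factor`). By a Schur
complement, `γ + iΩ ≥ 0` if and only if `Q ≥ 0` (`plusI_Omega_posSemidef_iff`). If `Q ≥ 0`, the
exponential series writes the kernel as a sum of rank one kernels, so the operator is positive, with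
trace the integral of the diagonal. If the operator is positive, its continuous kernel is positive
definite, and differentiating `exp(½ s xᵀQy)` at `s = 0` on coefficients of sum zero yields `Q ≥ 0`.

For steering, argue by contraposition. If `γ + i(-Ω_A ⊕ Ω_B) ≥ 0`, average this with `γ + i(Ω_A ⊕
Ω_B) ≥ 0`, which holds because `ρ` is a state. The result `γ + i(0 ⊕ Ω_B) ≥ 0` has a Schur
complement saying that the covariance of `B` conditional on a phase-space point of `A` obeys the
uncertainty relation (`condCov_plusI_Omega_posSemidef`). The Wigner function of `ρ` is the product
of the marginal density of `ξ_A` and a conditional Gaussian in `ξ_B`, and the latter is now the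
Wigner function of a state `σ_ξ`. So `ξ_A` is a hidden variable and `σ_ξ` a hidden state; a Gaussian
measurement responds to `ξ_A` with the linear outcome `ξ_Aᵀ K + c` plus Gaussian noise
(`hasLHSModel_of_condCov_posSemidef`). The model is verified on characteristic functions: the Weyl
expectations of the part of `ρ` conditional on `φ` are the Fourier transform of marginal density
times `⟪φ, σ_ξ φ⟫`. Traces are handled through a rank one decomposition of `ρ`. Transposing the
matrix inequality exchanges the parties and settles the other direction.

For NPT, partial transposition reverses the momenta of `A`, so it yields the Gaussian operator of a
conjugated covariance matrix. Positivity of that operator would give `γ + i(-Ω_A ⊕ Ω_B) ≥ 0`. When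
this inequality fails, the operator is compact, self-adjoint and not positive, hence has a negative
eigenvalue. -/

theorem exists_neg_eigenvalue_of_isCompactOperator {T : H →L[ℂ] H} (hc : IsCompactOperator T)
    (hs : IsSelfAdjoint T) (hp : ¬ T.IsPositive) :
    ∃ t : ℝ, t < 0 ∧ Module.End.HasEigenvalue (T : H →ₗ[ℂ] H) (t : ℂ) := by
  by_contra hcon
  push Not at hcon
  apply hp
  -- A self-adjoint operator with spectrum in `[0, ∞)` is positive; a negative spectral point is
  -- nonzero, hence an eigenvalue by compactness.
  rw [← ContinuousLinearMap.nonneg_iff_isPositive]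
  rw [nonneg_iff_isSelfAdjoint_and_quasispectrumRestricts]
  refine ⟨hs, ?_⟩
  have h1 : SpectrumRestricts T ContinuousMap.realToNNReal := by
    rw [SpectrumRestricts.nnreal_iff]
    intro t ht
    by_contra hneg
    push Not at hneg
    refine hcon t hneg ?_
    have hne : (t : ℂ) ≠ 0 := by exact_mod_cast hneg.ne
    refine (hc.hasEigenvalue_iff_mem_spectrum hne).2 ?_
    exact (spectrum.algebraMap_mem_iff ℂ (a := T) (r := t)).2 ht
  exact h1

/-- Hilbert–Schmidt operators are norm limits of their finite rank truncations: Cauchy–Schwarz and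
Bessel bound the remainder by the square root of the tail of `∑ ‖T b_j‖²`. -/
theorem isCompactOperator_of_summable_norm_sq {κ : Type*} (b : HilbertBasis κ ℂ H)
    (T : H →L[ℂ] H) (hT : Summable fun j => ‖T (b j)‖ ^ 2) : IsCompactOperator T := by
  classical
  let P : Finset κ → H →L[ℂ] H := fun F =>
    ∑ j ∈ F, (innerSL ℂ (b j)).smulRight (T (b j))
  have hP : ∀ F, IsCompactOperator (P F) := by
    intro F
    have : ∀ j, IsCompactOperator ((innerSL ℂ (b j)).smulRight (T (b j)) : H →L[ℂ] H) := by
      intro j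
      have h0 : IsCompactOperator (innerSL ℂ (b j) : H →L[ℂ] ℂ) :=
        isCompactOperator_of_locallyCompactSpace_dom _
      exact h0.clm_comp (ContinuousLinearMap.toSpanSingleton ℂ (T (b j)))
    exact (Submodule.sum_mem (compactOperator (RingHom.id ℂ) H H) fun j _ => this j)
  refine isCompactOperator_of_tendsto (l := Filter.atTop) (F := P) ?_
    (Filter.Eventually.of_forall hP)
  rw [Metric.tendsto_atTop]
  intro ε hε
  have hε2 : 0 < (ε / 2) ^ 2 := by positivity
  obtain ⟨F₀, hF₀⟩ := summable_iff_vanishing_norm.1 hT _ hε2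
  refine ⟨F₀, fun F hF => ?_⟩
  rw [dist_eq_norm]
  refine lt_of_le_of_lt ?_ (half_lt_self hε)
  refine ContinuousLinearMap.opNorm_le_bound _ (half_pos hε).le fun f => ?_
  have hsum : HasSum (fun j => ⟪b j, f⟫_ℂ • T (b j)) (T f) := by
    have := T.hasSum (b.hasSum_repr f)
    simpa [b.repr_apply_apply] using this
  have hlim : Filter.Tendsto (fun G : Finset κ => ‖P F f - ∑ j ∈ G, ⟪b j, f⟫_ℂ • T (b j)‖)
      Filter.atTop (nhds ‖P F f - T f‖) :=
    (tendsto_const_nhds.sub hsum).norm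
  refine le_of_tendsto hlim ?_
  filter_upwards [Filter.eventually_ge_atTop F] with G hG
  have : P F f = ∑ j ∈ F, ⟪b j, f⟫_ℂ • T (b j) := by
    simp [P]
  rw [this, ← Finset.sum_sdiff hG, sub_add_cancel_right, norm_neg]
  calc ‖∑ j ∈ G \ F, ⟪b j, f⟫_ℂ • T (b j)‖
      ≤ ∑ j ∈ G \ F, ‖⟪b j, f⟫_ℂ‖ * ‖T (b j)‖ :=
        (norm_sum_le _ _).trans (le_of_eq (by simp [norm_smul]))
    _ ≤ √(∑ j ∈ G \ F, ‖⟪b j, f⟫_ℂ‖ ^ 2) * √(∑ j ∈ G \ F, ‖T (b j)‖ ^ 2) :=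
        Real.sum_mul_le_sqrt_mul_sqrt _ _ _
    _ ≤ ‖f‖ * (ε / 2) := by
        gcongr
        · refine (Real.sqrt_le_sqrt (b.orthonormal.sum_inner_products_le f)).trans ?_
          rw [Real.sqrt_sq (norm_nonneg _)]
        · refine (Real.sqrt_le_sqrt (le_of_lt ?_)).trans (Real.sqrt_sq (half_pos hε).le).le
          refine lt_of_le_of_lt (le_abs_self _) (hF₀ (G \ F) ?_)
          exact Finset.disjoint_of_subset_right hF Finset.sdiff_disjoint
    _ = ε / 2 * ‖f‖ := mul_comm _ _

/-! ### Traces of operators given by sums of rank one operators -/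

/-- This is `tr(T E) = ∑ ⟪ψ_s, E ψ_s⟫` for `T = ∑ |ψ_s⟩⟨ψ_s|`. Expanding in the basis gives each
row, and `|uv| ≤ (|u|² + |v|²) / 2` makes the double series absolutely summable, so the order may be
exchanged. A form `F` replaces `⟪f, T g⟫` so that the partial expectation of a bipartite state can
be inserted without constructing its operator. -/
theorem hasSum_basis_of_hasSum_rankOne {I κ : Type*} (b : HilbertBasis κ ℂ H) {ψ : I → H}
    (hψ : Summable fun s => ‖ψ s‖ ^ 2) (E : H →L[ℂ] H) {F : H → H → ℂ}
    (hF : ∀ f g, HasSum (fun s => ⟪f, ψ s⟫_ℂ * ⟪ψ s, g⟫_ℂ) (F f g)) :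
    HasSum (fun j => F (b j) (E (b j))) (∑' s, ⟪ψ s, E (ψ s)⟫_ℂ) := by
  set a : I × κ → ℂ := fun z => ⟪b z.2, ψ z.1⟫_ℂ * ⟪ψ z.1, E (b z.2)⟫_ℂ with ha
  have hrow : ∀ s, HasSum (fun j => a (s, j)) ⟪ψ s, E (ψ s)⟫_ℂ := by
    intro s
    have := b.hasSum_inner_mul_inner (E.adjoint (ψ s)) (ψ s)
    simp only [ContinuousLinearMap.adjoint_inner_left] at this
    refine this.congr_fun ?_
    intro j
    simp [ha, mul_comm]
  have hb : ∀ x : H, Summable (fun j => ‖⟪b j, x⟫_ℂ‖ ^ 2) := fun x =>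
    b.orthonormal.inner_products_summable x
  have hb' : ∀ x : H, ∑' j, ‖⟪b j, x⟫_ℂ‖ ^ 2 ≤ ‖x‖ ^ 2 := fun x =>
    b.orthonormal.tsum_inner_products_le x
  have hae : ∀ s j, ‖a (s, j)‖ = ‖⟪b j, ψ s⟫_ℂ‖ * ‖⟪b j, E.adjoint (ψ s)⟫_ℂ‖ := by
    intro s j
    rw [ha]
    simp only [norm_mul]
    rw [ContinuousLinearMap.adjoint_inner_right, norm_inner_symm (ψ s)]
  have hle : ∀ s j, ‖a (s, j)‖ ≤ (‖⟪b j, ψ s⟫_ℂ‖ ^ 2 + ‖⟪b j, E.adjoint (ψ s)⟫_ℂ‖ ^ 2) / 2 := by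
    intro s j
    rw [hae]
    nlinarith [sq_nonneg (‖⟪b j, ψ s⟫_ℂ‖ - ‖⟪b j, E.adjoint (ψ s)⟫_ℂ‖)]
  have hrs : ∀ s, Summable fun j => (‖⟪b j, ψ s⟫_ℂ‖ ^ 2 + ‖⟪b j, E.adjoint (ψ s)⟫_ℂ‖ ^ 2) / 2 :=
    fun s => ((hb _).add (hb _)).div_const 2
  have hsum : Summable a := by
    rw [← summable_norm_iff]
    refine (summable_prod_of_nonneg fun _ => norm_nonneg _).2 ⟨fun s => ?_, ?_⟩
    · exact Summable.of_nonneg_of_le (fun _ => norm_nonneg _) (hle s) (hrs s)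
    · refine Summable.of_nonneg_of_le (fun s => tsum_nonneg fun _ => norm_nonneg _) (fun s => ?_)
        (hψ.mul_left ((1 + ‖E.adjoint‖ ^ 2) / 2))
      calc ∑' j, ‖a (s, j)‖
          ≤ ∑' j, (‖⟪b j, ψ s⟫_ℂ‖ ^ 2 + ‖⟪b j, E.adjoint (ψ s)⟫_ℂ‖ ^ 2) / 2 :=
            (Summable.of_nonneg_of_le (fun _ => norm_nonneg _) (hle s) (hrs s)).tsum_le_tsum
              (hle s) (hrs s)
        _ = (∑' j, ‖⟪b j, ψ s⟫_ℂ‖ ^ 2 + ∑' j, ‖⟪b j, E.adjoint (ψ s)⟫_ℂ‖ ^ 2) / 2 := by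
            rw [tsum_div_const, (hb _).tsum_add (hb _)]
        _ ≤ (‖ψ s‖ ^ 2 + (‖E.adjoint‖ * ‖ψ s‖) ^ 2) / 2 := by
            have h3 : ‖E.adjoint (ψ s)‖ ^ 2 ≤ (‖E.adjoint‖ * ‖ψ s‖) ^ 2 := by
              gcongr
              exact E.adjoint.le_opNorm _
            have := hb' (ψ s)
            have := hb' (E.adjoint (ψ s))
            linarith
        _ = (1 + ‖E.adjoint‖ ^ 2) / 2 * ‖ψ s‖ ^ 2 := by ring
  have htot : HasSum a (∑' s, ⟪ψ s, E (ψ s)⟫_ℂ) := by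
    have := hsum.hasSum.prod_fiberwise hrow
    rw [this.tsum_eq]
    exact hsum.hasSum
  have hswap : HasSum (fun z : κ × I => a z.swap) (∑' s, ⟪ψ s, E (ψ s)⟫_ℂ) :=
    (Equiv.prodComm κ I).hasSum_iff.2 htot
  exact hswap.prod_fiberwise fun j => hF (b j) (E (b j))

theorem isPositive_of_hasSum_rankOne {H : Type*} [NormedAddCommGroup H]
    [InnerProductSpace ℂ H] {I : Type*} {ψ : I → H} {T : H →L[ℂ] H}
    (hT : ∀ f g, HasSum (fun s => ⟪f, ψ s⟫_ℂ * ⟪ψ s, g⟫_ℂ) ⟪f, T g⟫_ℂ) : T.IsPositive := by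
  refine ContinuousLinearMap.isPositive_iff_complex T |>.2 fun f => ?_
  have h0 : HasSum (fun s => ((‖⟪ψ s, f⟫_ℂ‖ ^ 2 : ℝ) : ℂ)) ⟪f, T f⟫_ℂ := by
    refine (hT f f).congr_fun ?_
    intro s
    rw [← inner_conj_symm f (ψ s), mul_comm, Complex.mul_conj, Complex.normSq_eq_norm_sq]
  have h1 : ((∑' s, ‖⟪ψ s, f⟫_ℂ‖ ^ 2 : ℝ) : ℂ) = ⟪f, T f⟫_ℂ := by
    rw [Complex.ofReal_tsum]
    exact h0.tsum_eq
  have h2 : ⟪T f, f⟫_ℂ = ((∑' s, ‖⟪ψ s, f⟫_ℂ‖ ^ 2 : ℝ) : ℂ) := by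
    rw [← inner_conj_symm, ← h1, Complex.conj_ofReal]
  rw [h2]
  refine ⟨by simp, ?_⟩
  simp only [Complex.ofReal_re, RCLike.re_eq_complex_re]
  exact tsum_nonneg fun _ => by positivity

theorem hasTrace_of_hasSum_rankOne {H : Type} [NormedAddCommGroup H] [InnerProductSpace ℂ H]
    [CompleteSpace H] {I : Type*} {ψ : I → H} {T : H →L[ℂ] H} {t : ℝ}
    (hψ : HasSum (fun s => ‖ψ s‖ ^ 2) t)
    (hT : ∀ f g, HasSum (fun s => ⟪f, ψ s⟫_ℂ * ⟪ψ s, g⟫_ℂ) ⟪f, T g⟫_ℂ) : HasTrace T t := by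
  intro κ b
  have h := hasSum_basis_of_hasSum_rankOne b hψ.summable (ContinuousLinearMap.id ℂ H) hT
  simp only [ContinuousLinearMap.coe_id', id_eq] at h
  convert h using 1
  rw [← hψ.tsum_eq, Complex.ofReal_tsum]
  refine tsum_congr fun s => ?_
  rw [inner_self_eq_norm_sq_to_K]
  simp

end hilbert

/-! ### Integral operators with dominated kernels -/

section kernel

variable {X : Type*} [MeasurableSpace X] {ν : Measure X}

/-- The kernel `K` is measurable and bounded by `h x * h y` with a square integrable `h`. -/
structure IsDominatedKernel (ν : Measure X) (K : X → X → ℂ) (h : X → ℝ) : Prop where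
  stronglyMeasurable : StronglyMeasurable (Function.uncurry K)
  memLp : MemLp h 2 ν
  nonneg : ∀ x, 0 ≤ h x
  norm_le : ∀ x y, ‖K x y‖ ≤ h x * h y

/-- `T` is the integral operator with kernel `K`. -/
def IsKernelOperator (K : X → X → ℂ) (T : Lp ℂ 2 ν →L[ℂ] Lp ℂ 2 ν) : Prop :=
  ∀ f : Lp ℂ 2 ν, T f =ᵐ[ν] fun x => ∫ y, K x y * f y ∂ν

theorem integrable_mul_norm {h : X → ℝ} (hh : MemLp h 2 ν) {E : Type*} [NormedAddCommGroup E]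
    {f : X → E} (hf : MemLp f 2 ν) :
    Integrable (fun y => h y * ‖f y‖) ν :=
  hh.integrable_mul hf.norm

theorem norm_sq_eq_integral (f : Lp ℂ 2 ν) : ‖f‖ ^ 2 = ∫ x, ‖f x‖ ^ 2 ∂ν := by
  have h1 : ⟪f, f⟫_ℂ = ((∫ x, ‖f x‖ ^ 2 ∂ν : ℝ) : ℂ) := by
    rw [L2.inner_def, ← integral_complex_ofReal]
    refine integral_congr_ae (Filter.Eventually.of_forall fun x => ?_)
    simp only
    rw [inner_self_eq_norm_sq_to_K]
    simp
  rw [inner_self_eq_norm_sq_to_K] at h1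
  apply_fun Complex.re at h1
  simpa [← Complex.ofReal_pow] using h1

theorem norm_sq_toLp {f : X → ℂ} (hf : MemLp f 2 ν) : ‖hf.toLp f‖ ^ 2 = ∫ x, ‖f x‖ ^ 2 ∂ν := by
  rw [norm_sq_eq_integral]
  refine integral_congr_ae ?_
  filter_upwards [hf.coeFn_toLp] with x hx
  rw [hx]

theorem inner_eq_integral (f g : Lp ℂ 2 ν) :
    ⟪f, g⟫_ℂ = ∫ x, (starRingEnd ℂ) (f x) * g x ∂ν := by
  rw [L2.inner_def]
  simp only [RCLike.inner_apply']

theorem integral_mul_norm_le {h : X → ℝ} (hh : MemLp h 2 ν) (f : Lp ℂ 2 ν) :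
    ∫ y, h y * ‖f y‖ ∂ν ≤ ‖hh.toLp h‖ * ‖f‖ := by
  have hF := (Lp.memLp f).norm
  have h1 : ⟪hF.toLp _, hh.toLp h⟫_ℝ = ∫ y, h y * ‖f y‖ ∂ν := by
    rw [L2.inner_def]
    refine integral_congr_ae ?_
    filter_upwards [hF.coeFn_toLp, hh.coeFn_toLp] with x h1 h2
    rw [h1, h2]
    simp
  have h2 : ‖hF.toLp _‖ = ‖f‖ := by
    rw [Lp.norm_toLp, eLpNorm_norm, Lp.norm_def]
  rw [← h1, mul_comm, ← h2]
  exact real_inner_le_norm _ _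

namespace IsDominatedKernel

variable {K : X → X → ℂ} {h : X → ℝ}

theorem stronglyMeasurable_right (hK : IsDominatedKernel ν K h) (x : X) :
    StronglyMeasurable (K x) :=
  hK.stronglyMeasurable.comp_measurable measurable_prodMk_left

theorem integrable_right (hK : IsDominatedKernel ν K h) (f : Lp ℂ 2 ν) (x : X) :
    Integrable (fun y => K x y * f y) ν := by
  refine ((integrable_mul_norm hK.memLp (Lp.memLp f)).const_mul (h x)).mono'
    ((hK.stronglyMeasurable_right x).mul (Lp.stronglyMeasurable f)).aestronglyMeasurable
    (Filter.Eventually.of_forall fun y => ?_)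
  rw [norm_mul, ← mul_assoc]
  gcongr
  exact hK.norm_le x y

theorem norm_integral_le (hK : IsDominatedKernel ν K h) (f : Lp ℂ 2 ν) (x : X) :
    ‖∫ y, K x y * f y ∂ν‖ ≤ (‖hK.memLp.toLp h‖ * ‖f‖) * h x := by
  calc ‖∫ y, K x y * f y ∂ν‖ ≤ ∫ y, h x * (h y * ‖f y‖) ∂ν := by
        refine norm_integral_le_of_norm_le
          ((integrable_mul_norm hK.memLp (Lp.memLp f)).const_mul (h x))
          (Filter.Eventually.of_forall fun y => ?_)
        rw [norm_mul, ← mul_assoc]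
        gcongr
        exact hK.norm_le x y
    _ = h x * ∫ y, h y * ‖f y‖ ∂ν := integral_const_mul _ _
    _ ≤ h x * (‖hK.memLp.toLp h‖ * ‖f‖) := by
        gcongr
        · exact hK.nonneg x
        · exact integral_mul_norm_le _ _
    _ = _ := mul_comm _ _

theorem memLp_integral [SFinite ν] (hK : IsDominatedKernel ν K h) (f : Lp ℂ 2 ν) :
    MemLp (fun x => ∫ y, K x y * f y ∂ν) 2 ν := by
  refine MemLp.of_le_mul (c := ‖hK.memLp.toLp h‖ * ‖f‖) hK.memLp ?_
    (Filter.Eventually.of_forall fun x => ?_)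
  · have : StronglyMeasurable (Function.uncurry fun x y => K x y * f y) :=
      hK.stronglyMeasurable.mul ((Lp.stronglyMeasurable f).comp_measurable measurable_snd)
    exact this.integral_prod_right.aestronglyMeasurable
  · refine (hK.norm_integral_le f x).trans ?_
    gcongr
    exact le_abs_self _

theorem exists_isKernelOperator [SFinite ν] (hK : IsDominatedKernel ν K h) :
    ∃ T : Lp ℂ 2 ν →L[ℂ] Lp ℂ 2 ν, IsKernelOperator K T := by
  let L : Lp ℂ 2 ν →ₗ[ℂ] Lp ℂ 2 ν :=
    { toFun := fun f => (hK.memLp_integral f).toLp _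
      map_add' := fun f g => by
        rw [← MemLp.toLp_add, MemLp.toLp_eq_toLp_iff]
        refine Filter.Eventually.of_forall fun x => ?_
        simp only [Pi.add_apply]
        rw [← integral_add (hK.integrable_right f x) (hK.integrable_right g x)]
        refine integral_congr_ae ?_
        filter_upwards [Lp.coeFn_add f g] with y hy
        rw [hy, Pi.add_apply, mul_add]
      map_smul' := fun c f => by
        rw [RingHom.id_apply, ← MemLp.toLp_const_smul, MemLp.toLp_eq_toLp_iff]
        refine Filter.Eventually.of_forall fun x => ?_
        simp only [Pi.smul_apply, smul_eq_mul]
        rw [← integral_const_mul]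
        refine integral_congr_ae ?_
        filter_upwards [Lp.coeFn_smul c f] with y hy
        rw [hy, Pi.smul_apply, smul_eq_mul]
        ring }
  refine ⟨L.mkContinuous (‖hK.memLp.toLp h‖ * ‖hK.memLp.toLp h‖) fun f => ?_, fun f => ?_⟩
  · have : ‖L f‖ ≤ (‖hK.memLp.toLp h‖ * ‖f‖) * ‖hK.memLp.toLp h‖ := by
      refine Lp.norm_le_mul_norm_of_ae_le_mul ?_
      filter_upwards [(hK.memLp_integral f).coeFn_toLp, hK.memLp.coeFn_toLp] with x h1 h2
      change ‖((hK.memLp_integral f).toLp _ : Lp ℂ 2 ν) x‖ ≤ _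
      rw [h1, h2]
      refine (hK.norm_integral_le f x).trans ?_
      gcongr
      exact le_abs_self _
    linarith
  · exact (hK.memLp_integral f).coeFn_toLp

theorem integrable_prod (hK : IsDominatedKernel ν K h) {f g : X → ℂ} (hf : MemLp f 2 ν)
    (hg : MemLp g 2 ν) :
    Integrable (fun z : X × X => (starRingEnd ℂ) (f z.1) * (K z.1 z.2 * g z.2)) (ν.prod ν) := by
  refine ((integrable_mul_norm hK.memLp hf).mul_prod (integrable_mul_norm hK.memLp hg)).mono' ?_
    (Filter.Eventually.of_forall fun z => ?_)
  · exact (Complex.continuous_conj.comp_aestronglyMeasurable hf.1.comp_fst).mul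
      (hK.stronglyMeasurable.aestronglyMeasurable.mul hg.1.comp_snd)
  · rw [norm_mul, norm_mul, RCLike.norm_conj]
    have := hK.norm_le z.1 z.2
    calc ‖f z.1‖ * (‖K z.1 z.2‖ * ‖g z.2‖) ≤ ‖f z.1‖ * ((h z.1 * h z.2) * ‖g z.2‖) := by gcongr
      _ = _ := by ring

theorem inner_eq [SFinite ν] (hK : IsDominatedKernel ν K h) {T : Lp ℂ 2 ν →L[ℂ] Lp ℂ 2 ν}
    (hT : IsKernelOperator K T) (f g : Lp ℂ 2 ν) :
    ⟪f, T g⟫_ℂ = ∫ z : X × X, (starRingEnd ℂ) (f z.1) * (K z.1 z.2 * g z.2) ∂(ν.prod ν) := by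
  rw [integral_prod _ (hK.integrable_prod (Lp.memLp f) (Lp.memLp g)), inner_eq_integral]
  refine integral_congr_ae ?_
  filter_upwards [hT g] with x hx
  rw [hx, ← integral_const_mul]

theorem isSelfAdjoint [SFinite ν] (hK : IsDominatedKernel ν K h) {T : Lp ℂ 2 ν →L[ℂ] Lp ℂ 2 ν}
    (hT : IsKernelOperator K T) (hsymm : ∀ x y, K y x = (starRingEnd ℂ) (K x y)) :
    IsSelfAdjoint T := by
  rw [ContinuousLinearMap.isSelfAdjoint_iff_isSymmetric]
  intro f g
  change ⟪T f, g⟫_ℂ = ⟪f, T g⟫_ℂ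
  rw [← inner_conj_symm, hK.inner_eq hT, hK.inner_eq hT, ← integral_conj,
    ← integral_prod_swap]
  refine integral_congr_ae (Filter.Eventually.of_forall fun z => ?_)
  simp only [Prod.fst_swap, Prod.snd_swap, map_mul, Complex.conj_conj]
  rw [hsymm z.1 z.2, Complex.conj_conj]
  ring

/-- Since `T f (x)` is the scalar product of `f` with the conjugate row `K(x, ·)`, Bessel's
inequality gives `∑ |T b_j (x)|² ≤ h(x)² ‖h‖²` pointwise; integration shows that `T` is
Hilbert–Schmidt. -/
theorem isCompactOperator (hK : IsDominatedKernel ν K h) {T : Lp ℂ 2 ν →L[ℂ] Lp ℂ 2 ν}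
    (hT : IsKernelOperator K T) : IsCompactOperator T := by
  obtain ⟨w, b, -⟩ := exists_hilbertBasis ℂ (Lp ℂ 2 ν)
  refine isCompactOperator_of_summable_norm_sq b T ?_
  have hrow : ∀ x, MemLp (fun y => (starRingEnd ℂ) (K x y)) 2 ν := fun x => by
    refine MemLp.of_le_mul (c := h x) hK.memLp ?_ (Filter.Eventually.of_forall fun y => ?_)
    · exact Complex.continuous_conj.comp_aestronglyMeasurable
        (hK.stronglyMeasurable_right x).aestronglyMeasurable
    · rw [RCLike.norm_conj]
      refine (hK.norm_le x y).trans ?_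
      have := hK.nonneg x
      gcongr
      exact le_abs_self _
  have hnorm : ∀ x, ‖(hrow x).toLp _‖ ≤ h x * ‖hK.memLp.toLp h‖ := fun x => by
    refine Lp.norm_le_mul_norm_of_ae_le_mul ?_
    filter_upwards [(hrow x).coeFn_toLp, hK.memLp.coeFn_toLp] with y h1 h2
    rw [h1, h2, RCLike.norm_conj]
    refine (hK.norm_le x y).trans ?_
    have := hK.nonneg x
    gcongr
    exact le_abs_self _
  have hinner : ∀ f : Lp ℂ 2 ν, T f =ᵐ[ν] fun x => ⟪(hrow x).toLp _, f⟫_ℂ := fun f => by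
    filter_upwards [hT f] with x hx
    rw [hx, inner_eq_integral]
    refine integral_congr_ae ?_
    filter_upwards [(hrow x).coeFn_toLp] with y hy
    rw [hy, Complex.conj_conj]
  have hint : ∀ f : Lp ℂ 2 ν, Integrable (fun x => ‖f x‖ ^ 2) ν := fun f =>
    (memLp_two_iff_integrable_sq_norm (Lp.memLp f).1).1 (Lp.memLp f)
  have hh2 : Integrable (fun x => (h x * ‖hK.memLp.toLp h‖) ^ 2) ν := by
    simp_rw [mul_pow]
    exact hK.memLp.integrable_sq.mul_const _
  refine summable_of_sum_le (c := ∫ x, (h x * ‖hK.memLp.toLp h‖) ^ 2 ∂ν)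
    (fun _ => by positivity) fun F => ?_
  simp_rw [norm_sq_eq_integral]
  rw [← integral_finsetSum _ fun j _ => hint _]
  refine integral_mono_ae (integrable_finsetSum _ fun j _ => hint _) hh2 ?_
  -- The basis is not known to be countable, so exceptional null sets are combined over a finite `F`
  -- only.
  have hall : ∀ᵐ x ∂ν, ∀ j ∈ F, T (b j) x = ⟪(hrow x).toLp _, b j⟫_ℂ := by
    rw [Filter.eventually_all_finset]
    exact fun j _ => hinner (b j)
  filter_upwards [hall] with x hx
  calc ∑ j ∈ F, ‖T (b j) x‖ ^ 2 = ∑ j ∈ F, ‖⟪b j, (hrow x).toLp _⟫_ℂ‖ ^ 2 := by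
        refine Finset.sum_congr rfl fun j hj => ?_
        rw [hx j hj, norm_inner_symm]
    _ ≤ ‖(hrow x).toLp _‖ ^ 2 := b.orthonormal.sum_inner_products_le _
    _ ≤ _ := by gcongr; exact hnorm x

end IsDominatedKernel

/-- Termwise integration of a nonnegative series. With `k` the diagonal of a kernel, it computes the
trace. -/
theorem hasSum_norm_sq_toLp {I : Type*} [Countable I] {ψ : I → X → ℂ}
    (hψ : ∀ s, MemLp (ψ s) 2 ν) {k : X → ℝ} (hk : Integrable k ν)
    (hsum : ∀ x, HasSum (fun s => ‖ψ s x‖ ^ 2) (k x)) :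
    HasSum (fun s => ‖(hψ s).toLp (ψ s)‖ ^ 2) (∫ x, k x ∂ν) := by
  simp_rw [norm_sq_toLp]
  refine hasSum_integral_of_dominated_convergence (fun s x => ‖ψ s x‖ ^ 2)
    (fun s => ((hψ s).1.norm.pow 2)) (fun s => Filter.Eventually.of_forall fun x => ?_)
    (Filter.Eventually.of_forall fun x => (hsum x).summable) ?_
    (Filter.Eventually.of_forall hsum)
  · simp
  · exact hk.congr (Filter.Eventually.of_forall fun x => (hsum x).tsum_eq.symm)

/-- Passes from a pointwise decomposition of the kernel to a weak decomposition of the operator. The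
`s`-th term of the double integral has `L¹` norm at most `‖ψ_s‖² ‖f‖ ‖g‖`, so sum and integral
commute. -/
theorem IsDominatedKernel.hasSum_rankOne [SFinite ν] {K : X → X → ℂ} {h : X → ℝ}
    (hK : IsDominatedKernel ν K h) {T : Lp ℂ 2 ν →L[ℂ] Lp ℂ 2 ν} (hT : IsKernelOperator K T)
    {I : Type*} [Countable I] {ψ : I → X → ℂ} (hψ : ∀ s, MemLp (ψ s) 2 ν)
    (hs : Summable fun s => ‖(hψ s).toLp (ψ s)‖ ^ 2)
    (hsum : ∀ x y, HasSum (fun s => ψ s x * (starRingEnd ℂ) (ψ s y)) (K x y))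
    (f g : Lp ℂ 2 ν) :
    HasSum (fun s => ⟪f, (hψ s).toLp (ψ s)⟫_ℂ * ⟪(hψ s).toLp (ψ s), g⟫_ℂ) ⟪f, T g⟫_ℂ := by
  rw [hK.inner_eq hT]
  have hi : ∀ f g : Lp ℂ 2 ν, Integrable (fun x => (starRingEnd ℂ) (f x) * g x) ν := fun f g =>
    (L2.integrable_inner f g).congr (Filter.Eventually.of_forall fun x => by
      simp only [RCLike.inner_apply'])
  have hψe : ∀ s (f : Lp ℂ 2 ν), ⟪f, (hψ s).toLp (ψ s)⟫_ℂ =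
      ∫ x, (starRingEnd ℂ) (f x) * ψ s x ∂ν := fun s f => by
    rw [inner_eq_integral]
    refine integral_congr_ae ?_
    filter_upwards [(hψ s).coeFn_toLp] with x hx
    rw [hx]
  have hψe' : ∀ s (f : Lp ℂ 2 ν), ⟪(hψ s).toLp (ψ s), f⟫_ℂ =
      ∫ x, (starRingEnd ℂ) (ψ s x) * f x ∂ν := fun s f => by
    rw [inner_eq_integral]
    refine integral_congr_ae ?_
    filter_upwards [(hψ s).coeFn_toLp] with x hx
    rw [hx]
  have hiψ : ∀ s (f : Lp ℂ 2 ν), Integrable (fun x => (starRingEnd ℂ) (f x) * ψ s x) ν :=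
    fun s f => by
      refine (hi f ((hψ s).toLp _)).congr ?_
      filter_upwards [(hψ s).coeFn_toLp] with x hx
      rw [hx]
  have hiψ' : ∀ s (f : Lp ℂ 2 ν), Integrable (fun x => (starRingEnd ℂ) (ψ s x) * f x) ν :=
    fun s f => by
      refine (hi ((hψ s).toLp _) f).congr ?_
      filter_upwards [(hψ s).coeFn_toLp] with x hx
      rw [hx]
  have hnb : ∀ s (f : Lp ℂ 2 ν), ∫ x, ‖ψ s x‖ * ‖f x‖ ∂ν ≤ ‖(hψ s).toLp (ψ s)‖ * ‖f‖ :=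
    fun s f => by
      refine (integral_mul_norm_le (hψ s).norm f).trans ?_
      rw [Lp.norm_toLp, eLpNorm_norm, Lp.norm_toLp]
  set G : I → X × X → ℂ := fun s z =>
    ((starRingEnd ℂ) (f z.1) * ψ s z.1) * ((starRingEnd ℂ) (ψ s z.2) * g z.2) with hG
  have hGi : ∀ s, Integrable (G s) (ν.prod ν) := fun s => (hiψ s f).mul_prod (hiψ' s g)
  have hGint : ∀ s, ∫ z, G s z ∂(ν.prod ν) =
      ⟪f, (hψ s).toLp (ψ s)⟫_ℂ * ⟪(hψ s).toLp (ψ s), g⟫_ℂ := fun s => by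
    rw [hψe, hψe']
    exact integral_prod_mul (fun x => (starRingEnd ℂ) (f x) * ψ s x)
      (fun x => (starRingEnd ℂ) (ψ s x) * g x)
  have hGn : ∀ s, ∫ z, ‖G s z‖ ∂(ν.prod ν) ≤ ‖(hψ s).toLp (ψ s)‖ ^ 2 * (‖f‖ * ‖g‖) := fun s => by
    have : ∫ z, ‖G s z‖ ∂(ν.prod ν) =
        (∫ x, ‖ψ s x‖ * ‖f x‖ ∂ν) * ∫ x, ‖ψ s x‖ * ‖g x‖ ∂ν := by
      rw [← integral_prod_mul]
      refine integral_congr_ae (Filter.Eventually.of_forall fun z => ?_)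
      simp only [hG, norm_mul, RCLike.norm_conj]
      ring
    rw [this]
    calc _ ≤ (‖(hψ s).toLp (ψ s)‖ * ‖f‖) * (‖(hψ s).toLp (ψ s)‖ * ‖g‖) := by
          refine mul_le_mul (hnb s f) (hnb s g) (integral_nonneg fun _ => ?_) ?_ <;> positivity
      _ = _ := by ring
  have hmain := hasSum_integral_of_summable_integral_norm hGi
    (Summable.of_nonneg_of_le (fun s => integral_nonneg fun _ => norm_nonneg _) hGn
      (hs.mul_right _))
  simp_rw [hGint] at hmain
  have he : ∀ z : X × X, (starRingEnd ℂ) (f z.1) * (K z.1 z.2 * g z.2) = ∑' s, G s z := ?_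
  · simp_rw [he]
    exact hmain
  intro z
  rw [← (hsum z.1 z.2).tsum_eq, ← tsum_mul_right, ← tsum_mul_left]
  refine tsum_congr fun s => ?_
  simp only [hG]
  ring

end kernel

/-! ### Splitting coordinates -/

section join

variable {a b κ : Type}

/-- The vector with the coordinates `x` and `y`, labelled through `e`. -/
def join (e : a ⊕ b ≃ κ) (x : a → ℝ) (y : b → ℝ) : κ → ℝ := fun k => Sum.elim x y (e.symm k)

theorem join_inl (e : a ⊕ b ≃ κ) (x : a → ℝ) (y : b → ℝ) (i : a) : join e x y (e (.inl i)) = x i := by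
  simp [join]

theorem join_inr (e : a ⊕ b ≃ κ) (x : a → ℝ) (y : b → ℝ) (i : b) : join e x y (e (.inr i)) = y i := by
  simp [join]

theorem join_comp (e : a ⊕ b ≃ κ) (z : κ → ℝ) :
    join e (fun i => z (e (.inl i))) (fun i => z (e (.inr i))) = z := by
  funext k
  obtain ⟨s, rfl⟩ := e.surjective k
  rcases s with i | i
  · rw [join_inl]
  · rw [join_inr]

theorem join_sub (e : a ⊕ b ≃ κ) (x x' : a → ℝ) (y y' : b → ℝ) :
    join e x y - join e x' y' = join e (x - x') (y - y') := by
  funext k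
  obtain ⟨s, rfl⟩ := e.surjective k
  rcases s with i | i <;> simp [join]

theorem join_add (e : a ⊕ b ≃ κ) (x x' : a → ℝ) (y y' : b → ℝ) :
    join e x y + join e x' y' = join e (x + x') (y + y') := by
  funext k
  obtain ⟨s, rfl⟩ := e.surjective k
  rcases s with i | i <;> simp [join]

theorem join_smul (e : a ⊕ b ≃ κ) (c : ℝ) (x : a → ℝ) (y : b → ℝ) :
    c • join e x y = join e (c • x) (c • y) := by
  funext k
  obtain ⟨s, rfl⟩ := e.surjective k
  rcases s with i | i <;> simp [join]

theorem join_dotProduct [Fintype a] [Fintype b] [Fintype κ] (e : a ⊕ b ≃ κ) (x x' : a → ℝ)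
    (y y' : b → ℝ) : join e x y ⬝ᵥ join e x' y' = x ⬝ᵥ x' + y ⬝ᵥ y' := by
  simp only [dotProduct]
  rw [← e.sum_comp, Fintype.sum_sum_type]
  simp [join]

/-- Joining coordinates as a measurable equivalence. -/
def joinEquiv (e : a ⊕ b ≃ κ) : (a → ℝ) × (b → ℝ) ≃ᵐ (κ → ℝ) :=
  (MeasurableEquiv.sumPiEquivProdPi (fun _ : a ⊕ b => ℝ)).symm.trans
    (MeasurableEquiv.piCongrLeft (fun _ : κ => ℝ) e)

theorem joinEquiv_apply (e : a ⊕ b ≃ κ) (z : (a → ℝ) × (b → ℝ)) :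
    joinEquiv e z = join e z.1 z.2 := by
  funext k
  obtain ⟨s, rfl⟩ := e.surjective k
  simp only [joinEquiv, MeasurableEquiv.trans_apply]
  rw [MeasurableEquiv.coe_piCongrLeft, Equiv.piCongrLeft_apply_apply]
  rcases s with i | i
  · rw [join_inl]; rfl
  · rw [join_inr]; rfl

theorem measurable_join (e : a ⊕ b ≃ κ) :
    Measurable fun z : (a → ℝ) × (b → ℝ) => join e z.1 z.2 := by
  simp_rw [← joinEquiv_apply]
  exact (joinEquiv e).measurable

variable [Fintype a] [Fintype b] [Fintype κ]

theorem measurePreserving_joinEquiv (e : a ⊕ b ≃ κ) :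
    MeasurePreserving (joinEquiv e) volume volume :=
  (volume_measurePreserving_sumPiEquivProdPi_symm _).trans
    (volume_measurePreserving_piCongrLeft _ _)

theorem measurePreserving_join (e : a ⊕ b ≃ κ) :
    MeasurePreserving (fun z : (a → ℝ) × (b → ℝ) => join e z.1 z.2)
      ((volume : Measure (a → ℝ)).prod volume) volume := by
  have := measurePreserving_joinEquiv e
  simp_rw [show (joinEquiv e : (a → ℝ) × (b → ℝ) → κ → ℝ) = fun z => join e z.1 z.2 from
    funext (joinEquiv_apply e)] at this
  exact this

theorem measurableEmbedding_join (e : a ⊕ b ≃ κ) :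
    MeasurableEmbedding (fun z : (a → ℝ) × (b → ℝ) => join e z.1 z.2) := by
  simp_rw [← joinEquiv_apply]
  exact (joinEquiv e).measurableEmbedding

theorem integral_join {E : Type*} [NormedAddCommGroup E] [NormedSpace ℝ E] (e : a ⊕ b ≃ κ)
    (f : (κ → ℝ) → E) :
    ∫ z : (a → ℝ) × (b → ℝ), f (join e z.1 z.2) ∂((volume : Measure (a → ℝ)).prod volume) =
      ∫ ξ, f ξ :=
  (measurePreserving_join e).integral_comp (measurableEmbedding_join e) f

theorem integrable_join_iff {E : Type*} [NormedAddCommGroup E] (e : a ⊕ b ≃ κ)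
    {f : (κ → ℝ) → E} :
    Integrable (fun z : (a → ℝ) × (b → ℝ) => f (join e z.1 z.2))
      ((volume : Measure (a → ℝ)).prod volume) ↔ Integrable f :=
  (measurePreserving_join e).integrable_comp_emb (measurableEmbedding_join e)

end join

/-- Positions and momenta as the two halves of phase space. -/
def phaseEquiv (ι : Type) : ι ⊕ ι ≃ ι × Fin 2 where
  toFun := Sum.elim (fun i => (i, 0)) (fun i => (i, 1))
  invFun q := if q.2 = 0 then .inl q.1 else .inr q.1
  left_inv s := by rcases s with i | i <;> simp
  right_inv q := by
    obtain ⟨i, j⟩ := q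
    fin_cases j <;> simp

theorem phasePoint_eq_join {ι : Type} (r p : ι → ℝ) : phasePoint r p = join (phaseEquiv ι) r p := by
  funext k
  obtain ⟨s, rfl⟩ := (phaseEquiv ι).surjective k
  rcases s with i | i
  · rw [join_inl]; rfl
  · rw [join_inr]; rfl

/-- The splitting of phase space induced by a splitting of the modes. -/
def modeEquiv {α β ι : Type} (e : α ⊕ β ≃ ι) : (α × Fin 2) ⊕ (β × Fin 2) ≃ ι × Fin 2 :=
  (Equiv.sumProdDistrib α β (Fin 2)).symm.trans (e.prodCongr (Equiv.refl _))

theorem modeEquiv_inl {α β ι : Type} (e : α ⊕ β ≃ ι) (q : α × Fin 2) :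
    modeEquiv e (.inl q) = (e (.inl q.1), q.2) := rfl

theorem modeEquiv_inr {α β ι : Type} (e : α ⊕ β ≃ ι) (q : β × Fin 2) :
    modeEquiv e (.inr q) = (e (.inr q.1), q.2) := rfl

theorem phasePoint_join {α β ι : Type} (e : α ⊕ β ≃ ι) (r p : α → ℝ) (r' p' : β → ℝ) :
    phasePoint (join e r r') (join e p p') =
      join (modeEquiv e) (phasePoint r p) (phasePoint r' p') := by
  funext k
  obtain ⟨s, rfl⟩ := (modeEquiv e).surjective k
  rcases s with ⟨i, j⟩ | ⟨i, j⟩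
  · rw [join_inl, modeEquiv_inl]
    fin_cases j <;> simp [phasePoint, join]
  · rw [join_inr, modeEquiv_inr]
    fin_cases j <;> simp [phasePoint, join]

/-! ### Conditional covariance matrices -/

section matrix

open Matrix

theorem exists_eq_transpose_mul_self {n : Type*} [Fintype n] [DecidableEq n] {S : Matrix n n ℝ}
    (hS : S.PosSemidef) : ∃ R : Matrix n n ℝ, S = Rᵀ * R := by
  open scoped MatrixOrder in
  obtain ⟨R, hR⟩ := CStarAlgebra.nonneg_iff_eq_star_mul_self.1 hS.nonneg
  exact ⟨R, by rw [hR, star_eq_conjTranspose, conjTranspose_eq_transpose_of_trivial]⟩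

theorem exists_eq_conjTranspose_mul_self {n : Type*} [Fintype n] [DecidableEq n]
    {S : Matrix n n ℂ} (hS : S.PosSemidef) : ∃ R : Matrix n n ℂ, S = Rᴴ * R := by
  open scoped MatrixOrder in
  obtain ⟨R, hR⟩ := CStarAlgebra.nonneg_iff_eq_star_mul_self.1 hS.nonneg
  exact ⟨R, by rw [hR, star_eq_conjTranspose]⟩

theorem map_ofReal_mul {l m n : Type*} [Fintype m] (A : Matrix l m ℝ) (B : Matrix m n ℝ) :
    (A * B).map Complex.ofReal = A.map Complex.ofReal * B.map Complex.ofReal :=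
  Matrix.map_mul (f := Complex.ofRealHom)

theorem conjTranspose_map_ofReal {m n : Type*} (A : Matrix m n ℝ) :
    (A.map Complex.ofReal)ᴴ = Aᵀ.map Complex.ofReal := by
  ext i j
  simp

theorem map_ofReal_inv {n : Type*} [Fintype n] [DecidableEq n] {A : Matrix n n ℝ}
    (hA : A.PosDef) : (A.map Complex.ofReal)⁻¹ = A⁻¹.map Complex.ofReal := by
  refine Matrix.inv_eq_right_inv ?_
  rw [← map_ofReal_mul, mul_nonsing_inv _ hA.det_pos.ne'.isUnit]
  ext i j
  simp [Matrix.one_apply, apply_ite]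

theorem posDef_map_ofReal {n : Type*} [Fintype n] [DecidableEq n] {A : Matrix n n ℝ}
    (hA : A.PosDef) : (A.map Complex.ofReal).PosDef := by
  obtain ⟨R, hR⟩ := exists_eq_transpose_mul_self hA.posSemidef
  have h1 : A.map Complex.ofReal = (R.map Complex.ofReal)ᴴ * R.map Complex.ofReal := by
    rw [conjTranspose_map_ofReal, ← map_ofReal_mul, ← hR]
  have h2 : (A.map Complex.ofReal).PosSemidef := by
    rw [h1]
    exact posSemidef_conjTranspose_mul_self _
  rw [h2.posDef_iff_det_ne_zero]
  have := hA.det_pos.ne'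
  have hdet : (A.map Complex.ofReal).det = (A.det : ℂ) := (RingHom.map_det Complex.ofRealHom A).symm
  rw [hdet]
  exact_mod_cast this

variable {a b κ : Type} [Fintype a] [Fintype b] [Fintype κ]

/-- The covariance matrix of the first marginal. -/
def margCov (e : a ⊕ b ≃ κ) (γ : Matrix κ κ ℝ) : Matrix a a ℝ :=
  γ.submatrix (fun i => e (.inl i)) (fun i => e (.inl i))

/-- The covariances of the two marginals. -/
def crossCov (e : a ⊕ b ≃ κ) (γ : Matrix κ κ ℝ) : Matrix a b ℝ :=
  γ.submatrix (fun i => e (.inl i)) (fun i => e (.inr i))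

/-- The matrix of the linear regression of the second on the first coordinates. -/
def regr [DecidableEq a] (e : a ⊕ b ≃ κ) (γ : Matrix κ κ ℝ) : Matrix b a ℝ :=
  (crossCov e γ)ᵀ * (margCov e γ)⁻¹

/-- The conditional covariance matrix (a Schur complement). -/
def condCov [DecidableEq a] (e : a ⊕ b ≃ κ) (γ : Matrix κ κ ℝ) : Matrix b b ℝ :=
  γ.submatrix (fun i => e (.inr i)) (fun i => e (.inr i)) -
    (crossCov e γ)ᵀ * (margCov e γ)⁻¹ * crossCov e γ

variable [DecidableEq a] [DecidableEq b] [DecidableEq κ] (e : a ⊕ b ≃ κ) {γ : Matrix κ κ ℝ}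

theorem submatrix_eq_fromBlocks (hγ : γ.IsSymm) : γ.submatrix e e =
    fromBlocks (margCov e γ) (crossCov e γ) (crossCov e γ)ᵀ
      (γ.submatrix (fun i => e (.inr i)) (fun i => e (.inr i))) := by
  ext i j
  rcases i with i | i <;> rcases j with j | j <;> simp [margCov, crossCov, hγ.apply]

theorem isSymm_of_posDef {n : Type*} {γ : Matrix n n ℝ} (hγ : γ.PosDef) : γ.IsSymm := by
  have := hγ.isHermitian
  rwa [IsHermitian, conjTranspose_eq_transpose_of_trivial] at this

theorem posDef_margCov (hγ : γ.PosDef) : (margCov e γ).PosDef :=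
  hγ.submatrix fun i j h => by simpa using e.injective h

theorem det_eq_margCov_mul_condCov (hγ : γ.PosDef) :
    γ.det = (margCov e γ).det * (condCov e γ).det := by
  rw [← det_submatrix_equiv_self e γ, submatrix_eq_fromBlocks e (isSymm_of_posDef hγ)]
  let := invertibleOfIsUnitDet _ (posDef_margCov e hγ).det_pos.ne'.isUnit
  rw [det_fromBlocks₁₁, invOf_eq_nonsing_inv, condCov]

theorem posDef_condCov (hγ : γ.PosDef) : (condCov e γ).PosDef := by
  have h1 : (condCov e γ).PosSemidef := by
    have h2 : (γ.submatrix e e).PosSemidef := hγ.posSemidef.submatrix e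
    let := invertibleOfIsUnitDet _ (posDef_margCov e hγ).det_pos.ne'.isUnit
    rw [submatrix_eq_fromBlocks e (isSymm_of_posDef hγ),
      ← conjTranspose_eq_transpose_of_trivial, PosDef.fromBlocks₁₁ _ _ (posDef_margCov e hγ)] at h2
    rwa [conjTranspose_eq_transpose_of_trivial] at h2
  rw [h1.posDef_iff_det_ne_zero]
  have := hγ.det_pos.ne'
  rw [det_eq_margCov_mul_condCov e hγ] at this
  exact right_ne_zero_of_mul this

/-- Completing the square: block elimination solves `γ (w_a, w_b) = (x, y)`, and the quadratic form
is the product of `(x, y)` with the solution. It serves both for positions against momenta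
(`phaseEquiv`) and for one party against the other (`modeEquiv`). -/
theorem join_inv_quadratic (hγ : γ.PosDef) (x : a → ℝ) (y : b → ℝ) :
    join e x y ⬝ᵥ γ⁻¹ *ᵥ join e x y = x ⬝ᵥ (margCov e γ)⁻¹ *ᵥ x +
      (y - regr e γ *ᵥ x) ⬝ᵥ (condCov e γ)⁻¹ *ᵥ (y - regr e γ *ᵥ x) := by
  set A := margCov e γ with hA
  set B := crossCov e γ with hB
  set S := condCov e γ with hS
  set D := γ.submatrix (fun i => e (.inr i)) (fun i => e (.inr i)) with hD
  have hAd : IsUnit A.det := (posDef_margCov e hγ).det_pos.ne'.isUnit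
  have hSd : IsUnit S.det := (posDef_condCov e hγ).det_pos.ne'.isUnit
  set wb := S⁻¹ *ᵥ (y - regr e γ *ᵥ x) with hwb
  set wa := A⁻¹ *ᵥ (x - B *ᵥ wb) with hwa
  have h1 : A *ᵥ wa + B *ᵥ wb = x := by
    rw [hwa, mulVec_mulVec, mul_nonsing_inv _ hAd, one_mulVec, sub_add_cancel]
  have h2 : Bᵀ *ᵥ wa + D *ᵥ wb = y := by
    have h3 : S *ᵥ wb = y - regr e γ *ᵥ x := by
      rw [hwb, mulVec_mulVec, mul_nonsing_inv _ hSd, one_mulVec]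
    have h4 : D = S + Bᵀ * A⁻¹ * B := by rw [hS, condCov]; simp [hD, hA, hB]
    rw [h4, add_mulVec, h3, hwa, mulVec_mulVec, mulVec_sub, regr, ← mulVec_mulVec (M := _ * _)]
    abel
  have h3 : γ *ᵥ join e wa wb = join e x y := by
    funext k
    obtain ⟨s, rfl⟩ := e.surjective k
    have hs : ∀ k, (γ *ᵥ join e wa wb) k =
        ∑ i, γ k (e (.inl i)) * wa i + ∑ i, γ k (e (.inr i)) * wb i := by
      intro k
      simp only [mulVec, dotProduct]
      rw [← e.sum_comp, Fintype.sum_sum_type]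
      simp [join]
    rw [hs]
    rcases s with i | i
    · rw [join_inl, ← h1]
      rfl
    · rw [join_inr, ← h2]
      simp only [Pi.add_apply, mulVec, dotProduct, hB, hD, crossCov, transpose_apply,
        submatrix_apply]
      congr 1
      refine Finset.sum_congr rfl fun j _ => ?_
      rw [(isSymm_of_posDef hγ).apply]
  have h4 : γ⁻¹ *ᵥ join e x y = join e wa wb := by
    rw [← h3, mulVec_mulVec, nonsing_inv_mul _ hγ.det_pos.ne'.isUnit, one_mulVec]
  rw [h4, join_dotProduct, hwa, mulVec_sub, dotProduct_sub, sub_dotProduct]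
  have h5 : x ⬝ᵥ A⁻¹ *ᵥ B *ᵥ wb = (regr e γ *ᵥ x) ⬝ᵥ wb := by
    have hAs : A⁻¹ᵀ = A⁻¹ := isSymm_of_posDef (posDef_margCov e hγ).inv
    have hadj : ∀ u : a → ℝ, (A⁻¹ *ᵥ x) ⬝ᵥ u = x ⬝ᵥ A⁻¹ *ᵥ u := fun u => by
      rw [dotProduct_mulVec, ← mulVec_transpose, hAs]
    rw [regr, ← hA, ← hB, ← mulVec_mulVec, mulVec_transpose, ← dotProduct_mulVec, hadj]
  rw [h5]
  ring

/-! ### Uncertainty relations and Schur complements -/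

theorem plusI_transpose {n : Type} {γ ω : Matrix n n ℝ} (hγ : γ.IsSymm) (hω : ωᵀ = -ω) :
    (plusI γ ω)ᵀ = plusI γ (-ω) := by
  ext i j
  have h1 := hγ.apply i j
  have h2 : ω j i = - ω i j := by
    rw [← Matrix.transpose_apply ω, hω, Matrix.neg_apply]
  simp [plusI, h1, h2]

/-- The Schur complement of a real corner, separated into real and imaginary parts. It is used with
`B' = 1`, where `Ω` couples positions to momenta, and with `B' = 0`, where the two parties are not
coupled by the form. -/
theorem fromBlocks_plusI_posSemidef_iff {A : Matrix a a ℝ} (hA : A.PosDef) (B B' : Matrix a b ℝ)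
    (D W : Matrix b b ℝ) :
    (fromBlocks (A.map Complex.ofReal) (B.map Complex.ofReal + Complex.I • B'.map Complex.ofReal)
      (Bᵀ.map Complex.ofReal - Complex.I • B'ᵀ.map Complex.ofReal) (plusI D W)).PosSemidef ↔
    (plusI (D - Bᵀ * A⁻¹ * B - B'ᵀ * A⁻¹ * B')
      (W - Bᵀ * A⁻¹ * B' + B'ᵀ * A⁻¹ * B)).PosSemidef := by
  have hc : (Bᵀ.map Complex.ofReal - Complex.I • B'ᵀ.map Complex.ofReal) =
      (B.map Complex.ofReal + Complex.I • B'.map Complex.ofReal)ᴴ := by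
    ext i j
    simp [sub_eq_add_neg]
  let := invertibleOfIsUnitDet _ (posDef_map_ofReal hA).det_pos.ne'.isUnit
  rw [hc, PosDef.fromBlocks₁₁ _ _ (posDef_map_ofReal hA), ← hc, map_ofReal_inv hA]
  have hI : Complex.I * Complex.I = -1 := Complex.I_mul_I
  have key : plusI D W - (Bᵀ.map Complex.ofReal - Complex.I • B'ᵀ.map Complex.ofReal) *
      A⁻¹.map Complex.ofReal * (B.map Complex.ofReal + Complex.I • B'.map Complex.ofReal) =
      plusI (D - Bᵀ * A⁻¹ * B - B'ᵀ * A⁻¹ * B') (W - Bᵀ * A⁻¹ * B' + B'ᵀ * A⁻¹ * B) := by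
    have hsub : ∀ M N : Matrix b b ℝ, (M - N).map Complex.ofReal =
        M.map Complex.ofReal - N.map Complex.ofReal := fun M N => by ext; simp
    have hadd : ∀ M N : Matrix b b ℝ, (M + N).map Complex.ofReal =
        M.map Complex.ofReal + N.map Complex.ofReal := fun M N => by ext; simp
    simp only [plusI, hsub, hadd, map_ofReal_mul]
    simp only [Matrix.sub_mul, Matrix.mul_add, Matrix.smul_mul, Matrix.mul_smul, smul_smul, hI,
      smul_add, smul_sub]
    module
  rw [key]

theorem Omega_transpose (ι : Type) [DecidableEq ι] : (Omega ι)ᵀ = -Omega ι := by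
  ext ⟨i, j⟩ ⟨i', j'⟩
  simp only [Omega, transpose_apply, kroneckerMap_apply, one_apply]
  by_cases h : i = i'
  · subst h
    fin_cases j <;> fin_cases j' <;> simp
  · simp [h, Ne.symm h]

theorem plusI_Omega_submatrix {ι : Type} [DecidableEq ι] {γ : Matrix (ι × Fin 2) (ι × Fin 2) ℝ}
    (hγ : γ.IsSymm) :
    (plusI γ (Omega ι)).submatrix (phaseEquiv ι) (phaseEquiv ι) =
      fromBlocks ((margCov (phaseEquiv ι) γ).map Complex.ofReal)
        ((crossCov (phaseEquiv ι) γ).map Complex.ofReal +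
          Complex.I • (1 : Matrix ι ι ℝ).map Complex.ofReal)
        ((crossCov (phaseEquiv ι) γ)ᵀ.map Complex.ofReal -
          Complex.I • (1 : Matrix ι ι ℝ)ᵀ.map Complex.ofReal)
        (plusI (γ.submatrix (fun i => phaseEquiv ι (.inr i)) (fun i => phaseEquiv ι (.inr i))) 0) := by
  ext i j
  rcases i with i | i <;> rcases j with j | j <;>
    simp [plusI, Omega, margCov, crossCov, phaseEquiv, one_apply, hγ.apply, apply_ite,
      sub_eq_add_neg]

/-- The uncertainty relation in terms of the parameters of the integral kernel. -/
theorem plusI_Omega_posSemidef_iff {ι : Type} [Fintype ι] [DecidableEq ι]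
    {γ : Matrix (ι × Fin 2) (ι × Fin 2) ℝ} (hγ : γ.PosDef) :
    (plusI γ (Omega ι)).PosSemidef ↔
      (plusI (condCov (phaseEquiv ι) γ - (margCov (phaseEquiv ι) γ)⁻¹)
        (regr (phaseEquiv ι) γ - (regr (phaseEquiv ι) γ)ᵀ)).PosSemidef := by
  have hs := isSymm_of_posDef hγ
  have hA := posDef_margCov (phaseEquiv ι) hγ
  -- The Schur complement has imaginary part `regrᵀ - regr`; transposition preserves positivity and
  -- reverses this sign.
  rw [← posSemidef_submatrix_equiv (phaseEquiv ι), plusI_Omega_submatrix hs,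
    fromBlocks_plusI_posSemidef_iff hA, ← posSemidef_transpose_iff]
  have h1 : (margCov (phaseEquiv ι) γ)⁻¹ᵀ = (margCov (phaseEquiv ι) γ)⁻¹ :=
    isSymm_of_posDef hA.inv
  have h2 : (condCov (phaseEquiv ι) γ).IsSymm := isSymm_of_posDef (posDef_condCov _ hγ)
  rw [plusI_transpose]
  · simp only [transpose_one, Matrix.mul_one, Matrix.one_mul, condCov, regr, transpose_mul,
      transpose_transpose, h1]
    have h3 : ∀ X Y : Matrix ι ι ℝ, -(0 - X + Y) = X - Y := fun X Y => by abel
    rw [h3]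
  · simp only [transpose_one, Matrix.mul_one, Matrix.one_mul]
    rw [IsSymm, transpose_sub, h1]
    exact congrArg (· - _) h2
  · simp only [transpose_one, Matrix.mul_one, Matrix.one_mul, transpose_add, transpose_sub,
      transpose_mul, transpose_transpose, h1, transpose_zero]
    abel

/-- If a covariance matrix satisfies the uncertainty relation and has a positive partial
transpose, then the conditional covariance matrix satisfies the uncertainty relation. -/
theorem condCov_plusI_Omega_posSemidef {α β ι : Type} [Fintype α] [Fintype β] [Fintype ι]
    [DecidableEq α] [DecidableEq β] [DecidableEq ι] (e : α ⊕ β ≃ ι)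
    {γ ω : Matrix (ι × Fin 2) (ι × Fin 2) ℝ} (hγ : γ.PosDef)
    (hω : ω.submatrix (modeEquiv e) (modeEquiv e) = fromBlocks (-Omega α) 0 0 (Omega β))
    (h1 : (plusI γ (Omega ι)).PosSemidef) (h2 : (plusI γ ω).PosSemidef) :
    (plusI (condCov (modeEquiv e) γ) (Omega β)).PosSemidef := by
  have hs := isSymm_of_posDef hγ
  have hA := posDef_margCov (modeEquiv e) hγ
  have hΩ : (Omega ι).submatrix (modeEquiv e) (modeEquiv e) =
      fromBlocks (Omega α) 0 0 (Omega β) := by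
    ext i j
    rcases i with ⟨i, i'⟩ | ⟨i, i'⟩ <;> rcases j with ⟨j, j'⟩ | ⟨j, j'⟩ <;>
      simp [Omega, modeEquiv_inl, modeEquiv_inr, one_apply]
  -- In the mean of the two relations the forms on the first party cancel, leaving `γ + i(0 ⊕ Ω_B) ≥
  -- 0`. The first diagonal block is then real, so its Schur complement is `condCov + iΩ_B`.
  have h3 := ((h1.submatrix (modeEquiv e)).add (h2.submatrix (modeEquiv e))).smul
    (show (0 : ℝ) ≤ 2⁻¹ by norm_num)
  have h4 : (2⁻¹ : ℝ) • ((plusI γ (Omega ι)).submatrix (modeEquiv e) (modeEquiv e) +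
      (plusI γ ω).submatrix (modeEquiv e) (modeEquiv e)) =
      fromBlocks ((margCov (modeEquiv e) γ).map Complex.ofReal)
        ((crossCov (modeEquiv e) γ).map Complex.ofReal +
          Complex.I • (0 : Matrix (α × Fin 2) (β × Fin 2) ℝ).map Complex.ofReal)
        ((crossCov (modeEquiv e) γ)ᵀ.map Complex.ofReal -
          Complex.I • (0 : Matrix (α × Fin 2) (β × Fin 2) ℝ)ᵀ.map Complex.ofReal)
        (plusI (γ.submatrix (fun i => modeEquiv e (.inr i)) (fun i => modeEquiv e (.inr i)))
          (Omega β)) := by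
    ext i j
    have e1 := congrFun (congrFun hΩ i) j
    have e2 := congrFun (congrFun hω i) j
    have e3 := congrFun (congrFun (submatrix_eq_fromBlocks (modeEquiv e) hs) i) j
    simp only [submatrix_apply] at e1 e2 e3
    simp only [plusI, Matrix.smul_apply, Matrix.add_apply, submatrix_apply, map_apply, e1, e2, e3]
    rcases i with i | i <;> rcases j with j | j <;> simp <;> ring
  rw [h4, fromBlocks_plusI_posSemidef_iff hA] at h3
  simpa [condCov] using h3

end matrix

/-! ### Gaussian integrals -/

section gaussianIntegral

open Matrix

variable {κ : Type} [Fintype κ]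

/-- With `P = RᵀR`, the bound `|x|² = |R⁻¹ R x|² ≤ c |R x|²` holds for the squared Frobenius norm
`c` of `R⁻¹`. -/
theorem exists_mul_dotProduct_self_le [DecidableEq κ] {P : Matrix κ κ ℝ} (hP : P.PosDef) :
    ∃ ε > 0, ∀ x : κ → ℝ, ε * (x ⬝ᵥ x) ≤ x ⬝ᵥ P *ᵥ x := by
  obtain ⟨R, hR⟩ := exists_eq_transpose_mul_self hP.posSemidef
  have hdet : IsUnit R.det := by
    have := hP.det_pos.ne'
    rw [hR, det_mul] at this
    exact (right_ne_zero_of_mul this).isUnit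
  set c : ℝ := ∑ i, ∑ j, R⁻¹ i j ^ 2 with hc
  have hc0 : 0 ≤ c := Finset.sum_nonneg fun i _ => Finset.sum_nonneg fun j _ => sq_nonneg _
  have hself : ∀ x : κ → ℝ, x ⬝ᵥ x = ∑ i, x i ^ 2 := fun x => by simp [dotProduct, sq]
  have key : ∀ y : κ → ℝ, (R⁻¹ *ᵥ y) ⬝ᵥ (R⁻¹ *ᵥ y) ≤ c * (y ⬝ᵥ y) := fun y => by
    rw [hself, hself, hc, Finset.sum_mul]
    exact Finset.sum_le_sum fun i _ => Finset.sum_mul_sq_le_sq_mul_sq _ _ _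
  -- `c` vanishes when there are no coordinates; adding `1` keeps the constant positive.
  refine ⟨(c + 1)⁻¹, by positivity, fun x => ?_⟩
  have h1 : x ⬝ᵥ P *ᵥ x = (R *ᵥ x) ⬝ᵥ (R *ᵥ x) := by
    rw [hR, ← mulVec_mulVec, dotProduct_mulVec x, vecMul_transpose]
  have h2 := key (R *ᵥ x)
  rw [mulVec_mulVec, nonsing_inv_mul _ hdet, one_mulVec, ← h1] at h2
  have h3 : 0 ≤ x ⬝ᵥ P *ᵥ x := by
    rw [h1, hself]
    exact Finset.sum_nonneg fun i _ => sq_nonneg _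
  rw [inv_mul_le_iff₀ (by positivity)]
  linarith

theorem integrable_exp_neg_mul_dotProduct {b : ℝ} (hb : 0 < b) :
    Integrable fun x : κ → ℝ => Real.exp (-(b * (x ⬝ᵥ x))) := by
  have h := (GaussianFourier.integrable_cexp_neg_mul_sum_add (ι := κ) (b := (b : ℂ))
    (by simpa using hb) 0).norm
  refine h.congr (Filter.Eventually.of_forall fun x => ?_)
  simp only
  rw [Complex.norm_exp]
  congr 1
  simp [dotProduct, sq, ← Complex.ofReal_mul, ← Complex.ofReal_sum]

theorem memLp_exp_neg_mul_dotProduct {b : ℝ} (hb : 0 < b) :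
    MemLp (fun x : κ → ℝ => Real.exp (-(b * (x ⬝ᵥ x)))) 2 := by
  have hcont : Continuous fun x : κ → ℝ => Real.exp (-(b * (x ⬝ᵥ x))) := by
    unfold dotProduct
    fun_prop
  rw [memLp_two_iff_integrable_sq hcont.aestronglyMeasurable]
  refine (integrable_exp_neg_mul_dotProduct (κ := κ) (b := 2 * b) (by positivity)).congr
    (Filter.Eventually.of_forall fun x => ?_)
  simp only
  rw [← Real.exp_nat_mul]
  congr 1
  push_cast
  ring

theorem continuous_quadratic (P : Matrix κ κ ℝ) : Continuous fun x : κ → ℝ => x ⬝ᵥ P *ᵥ x := by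
  unfold dotProduct mulVec dotProduct
  fun_prop

variable [DecidableEq κ]

theorem integrable_exp_neg_quadratic {P : Matrix κ κ ℝ} (hP : P.PosDef) :
    Integrable fun x : κ → ℝ => Real.exp (-(x ⬝ᵥ P *ᵥ x)) := by
  obtain ⟨ε, hε, h⟩ := exists_mul_dotProduct_self_le hP
  refine (integrable_exp_neg_mul_dotProduct hε).mono'
    (Real.continuous_exp.comp (continuous_quadratic P).neg).aestronglyMeasurable
    (Filter.Eventually.of_forall fun x => ?_)
  rw [Real.norm_eq_abs, Real.abs_exp]
  exact Real.exp_le_exp.2 (neg_le_neg (h x))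

theorem integral_comp_mulVec {M : Matrix κ κ ℝ} (hM : M.det ≠ 0) {f : (κ → ℝ) → ℂ}
    (hf : Continuous f) : ∫ q, f q = |M.det| * ∫ q, f (M *ᵥ q) := by
  have h1 := Real.map_matrix_volume_pi_eq_smul_volume_pi hM
  have h2 : ∫ q, f (toLin' M q) = ∫ q, f q ∂(Measure.map (toLin' M) volume) :=
    (integral_map (LinearMap.continuous_of_finiteDimensional _).measurable.aemeasurable
      hf.aestronglyMeasurable).symm
  rw [h1, integral_smul_measure, ENNReal.toReal_ofReal (abs_nonneg _)] at h2
  simp only [toLin'_apply] at h2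
  rw [h2, abs_inv, Complex.real_smul, ← mul_assoc, ← Complex.ofReal_mul,
    mul_inv_cancel₀ (abs_pos.2 hM).ne', Complex.ofReal_one, one_mul]

/-- The substitution `p = Rᵀ q` with `S = RᵀR` reduces to a product of standard Gaussians, and its
Jacobian is `|det R| = √(det S)`. -/
theorem integral_gaussian_fourier {S : Matrix κ κ ℝ} (hS : S.PosDef) (δ : κ → ℝ) :
    ∫ p : κ → ℝ, Complex.exp (((-(p ⬝ᵥ S⁻¹ *ᵥ p) : ℝ) : ℂ) + Complex.I * ((p ⬝ᵥ δ : ℝ) : ℂ)) =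
      (√(Real.pi ^ Fintype.card κ * S.det) : ℝ) *
        Complex.exp ((-(δ ⬝ᵥ S *ᵥ δ) / 4 : ℝ) : ℂ) := by
  obtain ⟨R, hR⟩ := exists_eq_transpose_mul_self hS.posSemidef
  have hdet0 : R.det ≠ 0 := by
    have := hS.det_pos.ne'
    rw [hR, det_mul] at this
    exact right_ne_zero_of_mul this
  have hdet : IsUnit R.det := hdet0.isUnit
  have hcont : Continuous fun p : κ → ℝ =>
      Complex.exp (((-(p ⬝ᵥ S⁻¹ *ᵥ p) : ℝ) : ℂ) + Complex.I * ((p ⬝ᵥ δ : ℝ) : ℂ)) := by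
    have h1 := continuous_quadratic S⁻¹
    have h2 : Continuous fun p : κ → ℝ => p ⬝ᵥ δ := by
      unfold dotProduct
      fun_prop
    fun_prop
  rw [integral_comp_mulVec (M := Rᵀ) (by rwa [det_transpose]) hcont]
  have hq : ∀ q : κ → ℝ, (Rᵀ *ᵥ q) ⬝ᵥ S⁻¹ *ᵥ (Rᵀ *ᵥ q) = ∑ i, q i ^ 2 := fun q => by
    have h1 : S⁻¹ *ᵥ (Rᵀ *ᵥ q) = R⁻¹ *ᵥ q := by
      rw [hR, Matrix.mul_inv_rev, mulVec_mulVec, Matrix.mul_assoc, nonsing_inv_mul _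
        (by rwa [det_transpose]), Matrix.mul_one]
    rw [h1, mulVec_transpose, ← dotProduct_mulVec, mulVec_mulVec, mul_nonsing_inv _ hdet,
      one_mulVec]
    simp [dotProduct, sq]
  have hl : ∀ q : κ → ℝ, (Rᵀ *ᵥ q) ⬝ᵥ δ = ∑ i, (R *ᵥ δ) i * q i := fun q => by
    rw [mulVec_transpose, ← dotProduct_mulVec, dotProduct_comm]
    rfl
  have hint := GaussianFourier.integral_cexp_neg_mul_sum_add (ι := κ) (b := 1) (by simp)
    (fun i => Complex.I * ((R *ᵥ δ) i : ℂ))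
  have hcong : ∀ q : κ → ℝ, Complex.exp (((-((Rᵀ *ᵥ q) ⬝ᵥ S⁻¹ *ᵥ (Rᵀ *ᵥ q)) : ℝ) : ℂ) +
      Complex.I * (((Rᵀ *ᵥ q) ⬝ᵥ δ : ℝ) : ℂ)) =
      Complex.exp (-1 * ∑ i, (q i : ℂ) ^ 2 + ∑ i, Complex.I * ((R *ᵥ δ) i : ℂ) * q i) := fun q => by
    rw [hq, hl]
    congr 1
    push_cast
    rw [Finset.mul_sum, neg_one_mul]
    simp only [mul_assoc]
  simp_rw [hcong]
  rw [hint, ← mul_assoc]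
  congr 1
  · have h1 : (Real.pi / 1 : ℂ) ^ (Fintype.card κ / 2 : ℂ) =
        ((√(Real.pi ^ Fintype.card κ) : ℝ) : ℂ) := by
      rw [div_one, Real.sqrt_eq_rpow, ← Real.rpow_natCast, ← Real.rpow_mul Real.pi_pos.le,
        Complex.ofReal_cpow Real.pi_pos.le]
      congr 1
      push_cast
      ring
    rw [h1, Real.sqrt_mul (by positivity), hR, det_mul, det_transpose, ← sq, Real.sqrt_sq_eq_abs]
    push_cast
    ring
  · congr 1
    have h2 : δ ⬝ᵥ S *ᵥ δ = ∑ i, (R *ᵥ δ) i ^ 2 := by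
      rw [hR, ← mulVec_mulVec, dotProduct_mulVec δ, vecMul_transpose]
      simp [dotProduct, sq]
    rw [h2]
    push_cast
    simp only [mul_pow, Complex.I_sq, mul_one, ← Finset.mul_sum]
    ring

theorem integral_exp_neg_quadratic {S : Matrix κ κ ℝ} (hS : S.PosDef) (x₀ : κ → ℝ) :
    ∫ p : κ → ℝ, Real.exp (-((p - x₀) ⬝ᵥ S⁻¹ *ᵥ (p - x₀))) =
      √(Real.pi ^ Fintype.card κ * S.det) := by
  rw [integral_sub_right_eq_self (fun p : κ → ℝ => Real.exp (-(p ⬝ᵥ S⁻¹ *ᵥ p))) x₀]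
  have h := integral_gaussian_fourier hS 0
  simp only [dotProduct_zero, zero_dotProduct, Complex.ofReal_zero, mul_zero, add_zero, neg_zero,
    zero_div, Complex.exp_zero, mul_one] at h
  have h2 : ∀ p : κ → ℝ, Complex.exp ((-(p ⬝ᵥ S⁻¹ *ᵥ p) : ℝ) : ℂ) =
      ((Real.exp (-(p ⬝ᵥ S⁻¹ *ᵥ p)) : ℝ) : ℂ) := fun p => by push_cast; rfl
  simp_rw [h2] at h
  rw [integral_complex_ofReal] at h
  exact_mod_cast h

end gaussianIntegral

/-! ### Gaussian Wigner functions -/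

section wigner

open Matrix

variable {ι : Type} [Fintype ι] [DecidableEq ι]

theorem continuous_gaussianWigner (d : ι × Fin 2 → ℝ)
    (γ : Matrix (ι × Fin 2) (ι × Fin 2) ℝ) : Continuous (gaussianWigner d γ) := by
  have h := (continuous_quadratic γ⁻¹).comp (continuous_id.sub (continuous_const (y := d)))
  unfold gaussianWigner
  exact (Real.continuous_exp.comp h.neg).div_const _

theorem gaussianWigner_pos {γ : Matrix (ι × Fin 2) (ι × Fin 2) ℝ} (hγ : γ.PosDef)
    (d ξ : ι × Fin 2 → ℝ) : 0 < gaussianWigner d γ ξ := by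
  have := Real.sqrt_pos.2 hγ.det_pos
  unfold gaussianWigner
  positivity

theorem integrable_gaussianWigner {γ : Matrix (ι × Fin 2) (ι × Fin 2) ℝ} (hγ : γ.PosDef)
    (d : ι × Fin 2 → ℝ) : Integrable (gaussianWigner d γ) :=
  ((integrable_exp_neg_quadratic hγ.inv).comp_sub_right d).div_const _

theorem sqrt_pi_pow_card_mul {γ : Matrix (ι × Fin 2) (ι × Fin 2) ℝ} :
    √(Real.pi ^ Fintype.card (ι × Fin 2) * γ.det) = Real.pi ^ Fintype.card ι * √γ.det := by
  rw [Real.sqrt_mul (by positivity), Fintype.card_prod, Fintype.card_fin, pow_mul,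
    Real.sqrt_sq (by positivity)]

theorem integral_gaussianWigner {γ : Matrix (ι × Fin 2) (ι × Fin 2) ℝ} (hγ : γ.PosDef)
    (d : ι × Fin 2 → ℝ) : ∫ ξ, gaussianWigner d γ ξ = 1 := by
  have := Real.sqrt_pos.2 hγ.det_pos
  unfold gaussianWigner
  rw [integral_div, integral_exp_neg_quadratic hγ d, sqrt_pi_pow_card_mul, div_self]
  positivity

/-- A Gaussian density is the product of a marginal and a conditional Gaussian density. -/
theorem gaussianWigner_join {α β : Type} [Fintype α] [Fintype β] [DecidableEq α] [DecidableEq β]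
    (e : α ⊕ β ≃ ι) {γ : Matrix (ι × Fin 2) (ι × Fin 2) ℝ} (hγ : γ.PosDef)
    (dA ξA : α × Fin 2 → ℝ) (dB ξB : β × Fin 2 → ℝ) :
    gaussianWigner (join (modeEquiv e) dA dB) γ (join (modeEquiv e) ξA ξB) =
      gaussianWigner dA (margCov (modeEquiv e) γ) ξA *
        gaussianWigner (dB + regr (modeEquiv e) γ *ᵥ (ξA - dA)) (condCov (modeEquiv e) γ) ξB := by
  unfold gaussianWigner
  have hcard : Fintype.card ι = Fintype.card α + Fintype.card β := by
    rw [← Fintype.card_congr e, Fintype.card_sum]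
  rw [join_sub, join_inv_quadratic _ hγ, det_eq_margCov_mul_condCov (modeEquiv e) hγ, hcard,
    Real.sqrt_mul (posDef_margCov _ hγ).det_pos.le, pow_add, neg_add, Real.exp_add,
    sub_sub ξB dB]
  rw [div_mul_div_comm]
  congr 1
  ring

end wigner

/-! ### Gaussian kernels -/

section gaussKernel

open Matrix

variable {ι : Type} [Fintype ι]

/-- The Gaussian kernel with parameters `P`, `S`, `G`, centre `(x₀, p₀)` and normalization `C`. -/
def gaussKernel (P S G : Matrix ι ι ℝ) (x₀ p₀ : ι → ℝ) (C : ℝ) (x y : ι → ℝ) : ℂ :=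
  C * Complex.exp (((-(((2 : ℝ)⁻¹ • (x + y) - x₀) ⬝ᵥ P *ᵥ ((2 : ℝ)⁻¹ • (x + y) - x₀)) -
      (x - y) ⬝ᵥ S *ᵥ (x - y) / 4 : ℝ) : ℂ) +
    Complex.I * (((p₀ + G *ᵥ ((2 : ℝ)⁻¹ • (x + y) - x₀)) ⬝ᵥ (x - y) : ℝ) : ℂ))

theorem continuous_dotProduct : Continuous fun z : (ι → ℝ) × (ι → ℝ) => z.1 ⬝ᵥ z.2 := by
  unfold dotProduct
  fun_prop

theorem continuous_mulVec {κ : Type} (P : Matrix κ ι ℝ) : Continuous fun x : ι → ℝ => P *ᵥ x := by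
  unfold mulVec dotProduct
  fun_prop

theorem continuous_gaussKernel (P S G : Matrix ι ι ℝ) (C : ℝ) :
    Continuous fun z : (ι → ℝ) × (ι → ℝ) × (ι → ℝ) × (ι → ℝ) =>
      gaussKernel P S G z.1 z.2.1 C z.2.2.1 z.2.2.2 := by
  have hr : Continuous fun z : (ι → ℝ) × (ι → ℝ) × (ι → ℝ) × (ι → ℝ) =>
      (2 : ℝ)⁻¹ • (z.2.2.1 + z.2.2.2) - z.1 := by fun_prop
  have hp : Continuous fun z : (ι → ℝ) × (ι → ℝ) × (ι → ℝ) × (ι → ℝ) => z.2.1 := by fun_prop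
  have hd : Continuous fun z : (ι → ℝ) × (ι → ℝ) × (ι → ℝ) × (ι → ℝ) => z.2.2.1 - z.2.2.2 := by
    fun_prop
  have h1 := (continuous_quadratic P).comp hr
  have h2 := (continuous_quadratic S).comp hd
  have h3 := continuous_dotProduct.comp
    (hp.add ((continuous_mulVec G).comp hr) |>.prodMk hd)
  unfold gaussKernel
  simp only [Function.comp_def] at h1 h2 h3
  fun_prop

theorem gaussKernel_conj (P S G : Matrix ι ι ℝ) (x₀ p₀ : ι → ℝ) (C : ℝ) (x y : ι → ℝ) :
    gaussKernel P S G x₀ p₀ C y x = (starRingEnd ℂ) (gaussKernel P S G x₀ p₀ C x y) := by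
  unfold gaussKernel
  rw [map_mul, Complex.conj_ofReal, ← Complex.exp_conj, map_add, map_mul, Complex.conj_ofReal,
    Complex.conj_ofReal, Complex.conj_I, add_comm y x, ← neg_sub x y, mulVec_neg, neg_dotProduct_neg,
    dotProduct_neg]
  push_cast
  simp only [neg_mul, mul_neg]

theorem gaussKernel_self (P S G : Matrix ι ι ℝ) (x₀ p₀ : ι → ℝ) (C : ℝ) (x : ι → ℝ) :
    gaussKernel P S G x₀ p₀ C x x = ((C * Real.exp (-((x - x₀) ⬝ᵥ P *ᵥ (x - x₀))) : ℝ) : ℂ) := by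
  have : (2 : ℝ)⁻¹ • (x + x) = x := by
    rw [← two_smul ℝ x, smul_smul]
    norm_num
  unfold gaussKernel
  simp [this]

theorem norm_gaussKernel (P S G : Matrix ι ι ℝ) (x₀ p₀ : ι → ℝ) {C : ℝ} (hC : 0 ≤ C)
    (x y : ι → ℝ) : ‖gaussKernel P S G x₀ p₀ C x y‖ =
      C * Real.exp (-(((2 : ℝ)⁻¹ • (x + y) - x₀) ⬝ᵥ P *ᵥ ((2 : ℝ)⁻¹ • (x + y) - x₀)) -
      (x - y) ⬝ᵥ S *ᵥ (x - y) / 4) := by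
  unfold gaussKernel
  rw [norm_mul, Complex.norm_exp, Complex.norm_real, Real.norm_of_nonneg hC]
  congr 2
  simp only [Complex.add_re, Complex.ofReal_re, Complex.mul_re, Complex.I_re, Complex.I_im,
    Complex.ofReal_im]
  ring

/-- The bound `h` of a dominated Gaussian kernel. -/
def gaussBound (ε C : ℝ) (x₀ x : ι → ℝ) : ℝ :=
  √C * Real.exp (-(ε * ((x - x₀) ⬝ᵥ (x - x₀))))

theorem memLp_gaussBound {ε : ℝ} (hε : 0 < ε) (C : ℝ) (x₀ : ι → ℝ) :
    MemLp (gaussBound ε C x₀) 2 :=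
  ((memLp_exp_neg_mul_dotProduct hε).comp_measurePreserving
    (measurePreserving_sub_right volume x₀)).const_mul _

/-! ### Factorization of Gaussian kernels -/

/-- The factor in `k(x, y) = g(x) * conj (g y) * exp(xᵀ Q y)`. -/
def gaussFactor (P S G : Matrix ι ι ℝ) (x₀ p₀ : ι → ℝ) (C : ℝ) (x : ι → ℝ) : ℂ :=
  √C * Complex.exp (((-((x - x₀) ⬝ᵥ P *ᵥ (x - x₀)) / 4 - (x - x₀) ⬝ᵥ S *ᵥ (x - x₀) / 4 : ℝ) : ℂ) +
    Complex.I * (((x - x₀) ⬝ᵥ G *ᵥ (x - x₀) / 2 + p₀ ⬝ᵥ x : ℝ) : ℂ))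

theorem continuous_gaussFactor (P S G : Matrix ι ι ℝ) (x₀ p₀ : ι → ℝ) (C : ℝ) :
    Continuous (gaussFactor P S G x₀ p₀ C) := by
  have hr : Continuous fun z : ι → ℝ => z - x₀ := by fun_prop
  have h1 := (continuous_quadratic P).comp hr
  have h2 := (continuous_quadratic S).comp hr
  have h3 := (continuous_quadratic G).comp hr
  have h4 := continuous_dotProduct.comp ((continuous_const (y := p₀)).prodMk continuous_id)
  unfold gaussFactor
  simp only [Function.comp_def, id] at h1 h2 h3 h4
  fun_prop

theorem gaussFactor_ne_zero (P S G : Matrix ι ι ℝ) (x₀ p₀ : ι → ℝ) {C : ℝ} (hC : 0 < C)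
    (x : ι → ℝ) : gaussFactor P S G x₀ p₀ C x ≠ 0 := by
  unfold gaussFactor
  refine mul_ne_zero ?_ (Complex.exp_ne_zero _)
  exact_mod_cast (Real.sqrt_pos.2 hC).ne'

theorem dotProduct_plusI_mulVec (M W : Matrix ι ι ℝ) (x y : ι → ℝ) :
    (fun i => (x i : ℂ)) ⬝ᵥ plusI M W *ᵥ (fun i => (y i : ℂ)) =
      ((x ⬝ᵥ M *ᵥ y : ℝ) : ℂ) + Complex.I * ((x ⬝ᵥ W *ᵥ y : ℝ) : ℂ) := by
  simp only [plusI, dotProduct, mulVec, Complex.ofReal_sum, Complex.ofReal_mul, Finset.mul_sum,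
    Matrix.add_apply, Matrix.smul_apply, map_apply, smul_eq_mul, ← Finset.sum_add_distrib]
  refine Finset.sum_congr rfl fun i _ => Finset.sum_congr rfl fun j _ => ?_
  ring

theorem dotProduct_mulVec_comm (M : Matrix ι ι ℝ) (x y : ι → ℝ) :
    x ⬝ᵥ Mᵀ *ᵥ y = y ⬝ᵥ M *ᵥ x := by
  rw [mulVec_transpose, dotProduct_comm, dotProduct_mulVec]

/-- With `u = x - x₀` and `v = y - x₀`, the forms in `(u + v) / 2` and `u - v` split into a part in
`u`, a part in `v` and the cross term `½ uᵀ(S - P + i(G - Gᵀ))v`. Positivity of the kernel thus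
depends only on the matrix of the cross term. -/
theorem gaussKernel_eq_factor {P S : Matrix ι ι ℝ} (hP : P.IsSymm) (hS : S.IsSymm)
    (G : Matrix ι ι ℝ) (x₀ p₀ : ι → ℝ) {C : ℝ} (hC : 0 ≤ C) (x y : ι → ℝ) :
    gaussKernel P S G x₀ p₀ C x y = gaussFactor P S G x₀ p₀ C x *
      (starRingEnd ℂ) (gaussFactor P S G x₀ p₀ C y) *
        Complex.exp (2⁻¹ * ((fun i => ((x - x₀) i : ℂ)) ⬝ᵥ
          plusI (S - P) (G - Gᵀ) *ᵥ (fun i => ((y - x₀) i : ℂ)))) := by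
  rw [dotProduct_plusI_mulVec]
  unfold gaussKernel gaussFactor
  rw [map_mul, Complex.conj_ofReal, ← Complex.exp_conj, map_add, map_mul, Complex.conj_ofReal,
    Complex.conj_ofReal, Complex.conj_I]
  have h1 : (C : ℂ) = (√C : ℂ) * (√C : ℂ) := by
    rw [← Complex.ofReal_mul, Real.mul_self_sqrt hC]
  rw [h1, mul_mul_mul_comm, ← Complex.exp_add,
    mul_assoc ((√C : ℂ) * (√C : ℂ)) (Complex.exp _) (Complex.exp _), ← Complex.exp_add]
  congr 2
  have h2 : (2 : ℝ)⁻¹ • (x + y) - x₀ = (2 : ℝ)⁻¹ • ((x - x₀) + (y - x₀)) := by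
    funext i
    simp
    ring
  have h3 : x - y = (x - x₀) - (y - x₀) := by abel
  have h4 : p₀ ⬝ᵥ (x - y) = p₀ ⬝ᵥ x - p₀ ⬝ᵥ y := dotProduct_sub _ _ _
  rw [h2, add_dotProduct, h4, h3]
  set u := x - x₀
  set v := y - x₀
  have hPc : v ⬝ᵥ P *ᵥ u = u ⬝ᵥ P *ᵥ v := by
    conv_lhs => rw [← hP.eq]
    exact dotProduct_mulVec_comm P v u
  have hSc : v ⬝ᵥ S *ᵥ u = u ⬝ᵥ S *ᵥ v := by
    conv_lhs => rw [← hS.eq]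
    exact dotProduct_mulVec_comm S v u
  have hG : ∀ a b : ι → ℝ, (G *ᵥ a) ⬝ᵥ b = b ⬝ᵥ G *ᵥ a := fun a b => dotProduct_comm _ _
  simp only [mulVec_add, mulVec_sub, mulVec_smul, dotProduct_add, dotProduct_sub, add_dotProduct,
    sub_dotProduct, smul_dotProduct, dotProduct_smul, smul_eq_mul, sub_mulVec,
    dotProduct_mulVec_comm G, hPc, hSc, hG]
  push_cast
  ring

/-- The exponential series with each power of the sum multiplied out into words `Fin n → ι`, without
collecting equal monomials. Each word will label one rank one term. -/
theorem hasSum_exp_sum (c : ι → ℂ) :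
    HasSum (fun s : Σ n : ℕ, Fin n → ι => (∏ i, c (s.2 i)) / (s.1.factorial : ℂ))
      (Complex.exp (∑ k, c k)) := by
  have hfib : ∀ (c : ι → ℂ) (n : ℕ), HasSum (fun f : Fin n → ι => (∏ i, c (f i)) / (n.factorial : ℂ))
      ((∑ k, c k) ^ n / (n.factorial : ℂ)) := fun c n => by
    rw [Fintype.sum_pow, Finset.sum_div]
    exact hasSum_fintype _
  have hexp : ∀ z : ℂ, HasSum (fun n : ℕ => z ^ n / (n.factorial : ℂ)) (Complex.exp z) := fun z => by
    rw [Complex.exp_eq_exp_ℂ]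
    exact NormedSpace.expSeries_div_hasSum_exp z
  refine HasSum.sigma_of_hasSum (hexp _) (hfib c) ?_
  rw [← summable_norm_iff]
  refine (summable_sigma_of_nonneg fun _ => norm_nonneg _).2 ⟨fun n => Summable.of_finite, ?_⟩
  refine (Real.summable_pow_div_factorial (∑ k, ‖c k‖)).congr fun n => ?_
  rw [tsum_fintype, Fintype.sum_pow, Finset.sum_div]
  refine Finset.sum_congr rfl fun f _ => ?_
  simp

variable [DecidableEq ι]

/-- The bound is uniform in the centre of the kernel. -/
theorem exists_norm_gaussKernel_le {P S : Matrix ι ι ℝ} (hP : P.PosDef) (hS : S.PosDef)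
    (G : Matrix ι ι ℝ) {C : ℝ} (hC : 0 ≤ C) :
    ∃ ε > 0, ∀ x₀ p₀ x y : ι → ℝ,
      ‖gaussKernel P S G x₀ p₀ C x y‖ ≤ gaussBound ε C x₀ x * gaussBound ε C x₀ y := by
  obtain ⟨ε₁, h₁, hP'⟩ := exists_mul_dotProduct_self_le hP
  obtain ⟨ε₂, h₂, hS'⟩ := exists_mul_dotProduct_self_le hS
  -- By the parallelogram law `|x - x₀|² + |y - x₀|² = 2|r|² + |δ|² / 2`, with `r` the centred
  -- midpoint and `δ = x - y`. The factor `1/2` turns this into `ε|r|² + ε|δ|² / 4`, matching the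
  -- two forms in the exponent.
  refine ⟨min ε₁ ε₂ / 2, by positivity, fun x₀ p₀ x y => ?_⟩
  set ε := min ε₁ ε₂
  have hnn : ∀ v : ι → ℝ, 0 ≤ v ⬝ᵥ v := fun v => by
    simp only [dotProduct]
    exact Finset.sum_nonneg fun i _ => mul_self_nonneg _
  rw [norm_gaussKernel _ _ _ _ _ hC, gaussBound, gaussBound]
  have h3 : √C * Real.exp (-(ε / 2 * ((x - x₀) ⬝ᵥ (x - x₀)))) *
      (√C * Real.exp (-(ε / 2 * ((y - x₀) ⬝ᵥ (y - x₀))))) =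
      C * Real.exp (-(ε / 2 * ((x - x₀) ⬝ᵥ (x - x₀))) + -(ε / 2 * ((y - x₀) ⬝ᵥ (y - x₀)))) := by
    rw [Real.exp_add, mul_mul_mul_comm, Real.mul_self_sqrt hC]
  rw [h3]
  gcongr
  set r := (2 : ℝ)⁻¹ • (x + y) - x₀ with hr
  have h4 : x - x₀ = r + (2 : ℝ)⁻¹ • (x - y) := by
    funext i
    simp [hr]
    ring
  have h5 : y - x₀ = r - (2 : ℝ)⁻¹ • (x - y) := by
    funext i
    simp [hr]
    ring
  set δ := x - y
  have h6 : ε * (r ⬝ᵥ r) ≤ r ⬝ᵥ P *ᵥ r :=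
    (mul_le_mul_of_nonneg_right (min_le_left _ _) (hnn r)).trans (hP' r)
  have h7 : ε * (δ ⬝ᵥ δ) ≤ δ ⬝ᵥ S *ᵥ δ :=
    (mul_le_mul_of_nonneg_right (min_le_right _ _) (hnn δ)).trans (hS' δ)
  rw [h4, h5]
  simp only [add_dotProduct, dotProduct_add, sub_dotProduct, dotProduct_sub, smul_dotProduct,
    dotProduct_smul, smul_eq_mul, dotProduct_comm δ r]
  linarith

/-- A Gaussian kernel satisfying the uncertainty relation is a sum of rank one kernels. -/
theorem exists_hasSum_gaussKernel {P S : Matrix ι ι ℝ} (hP : P.IsSymm) (hS : S.IsSymm)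
    (G : Matrix ι ι ℝ) (x₀ p₀ : ι → ℝ) {C : ℝ} (hC : 0 ≤ C)
    (hQ : (plusI (S - P) (G - Gᵀ)).PosSemidef) :
    ∃ ψ : (Σ n : ℕ, Fin n → ι) → (ι → ℝ) → ℂ, (∀ s, Continuous (ψ s)) ∧
      ∀ x y, HasSum (fun s => ψ s x * (starRingEnd ℂ) (ψ s y)) (gaussKernel P S G x₀ p₀ C x y) := by
  obtain ⟨R, hR⟩ := exists_eq_conjTranspose_mul_self
    (hQ.smul (show (0 : ℝ) ≤ 2⁻¹ by norm_num))
  set a : (ι → ℝ) → ι → ℂ := fun x => R *ᵥ (fun i => ((x - x₀) i : ℂ)) with ha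
  have hac : ∀ k, Continuous fun x => a x k := fun k => by
    simp only [ha, mulVec, dotProduct]
    fun_prop
  have hexp : ∀ x y, 2⁻¹ * ((fun i => ((x - x₀) i : ℂ)) ⬝ᵥ
      plusI (S - P) (G - Gᵀ) *ᵥ (fun i => ((y - x₀) i : ℂ))) =
      ∑ k, (starRingEnd ℂ) (a x k) * a y k := fun x y => by
    have h1 : (2⁻¹ : ℂ) * ((fun i => ((x - x₀) i : ℂ)) ⬝ᵥ
      plusI (S - P) (G - Gᵀ) *ᵥ (fun i => ((y - x₀) i : ℂ))) = (fun i => ((x - x₀) i : ℂ)) ⬝ᵥ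
      ((2⁻¹ : ℝ) • plusI (S - P) (G - Gᵀ)) *ᵥ (fun i => ((y - x₀) i : ℂ)) := by
      rw [smul_mulVec, dotProduct_smul, Complex.real_smul]
      push_cast
      rfl
    have h2 : (fun i => ((x - x₀) i : ℂ)) = star (fun i => ((x - x₀) i : ℂ)) := by
      funext i
      simp
    rw [h1, hR, ← mulVec_mulVec, dotProduct_mulVec]
    conv_lhs => rw [h2]
    rw [← star_mulVec]
    rfl
  -- With `½ Q = RᴴR` the cross term is `∑ conj(a x k) a y k`. Every word contributes a product of a
  -- function of `x` and one of `y`, and `1 / n!` is shared between them as two factors `1 / √n!`.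
  refine ⟨fun s x => gaussFactor P S G x₀ p₀ C x *
    ((∏ i, (starRingEnd ℂ) (a x (s.2 i))) / (√(s.1.factorial : ℝ) : ℂ)), fun s => ?_, fun x y => ?_⟩
  · refine (continuous_gaussFactor P S G x₀ p₀ C).mul (Continuous.div_const ?_ _)
    exact continuous_finsetProd _ fun i _ => Complex.continuous_conj.comp (hac _)
  · rw [gaussKernel_eq_factor hP hS G x₀ p₀ hC, hexp]
    refine ((hasSum_exp_sum fun k => (starRingEnd ℂ) (a x k) * a y k).mul_left _).congr_fun
      fun s => ?_
    have h1 : ((s.1.factorial : ℕ) : ℂ) =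
        (√(s.1.factorial : ℝ) : ℂ) * (√(s.1.factorial : ℝ) : ℂ) := by
      rw [← Complex.ofReal_mul, Real.mul_self_sqrt (by positivity)]
      simp
    rw [h1, Finset.prod_mul_distrib]
    simp only [map_mul, map_div₀, map_prod, Complex.conj_conj, Complex.conj_ofReal]
    rw [← div_mul_div_comm]
    ring

end gaussKernel

/-! ### Operators with Gaussian Wigner functions -/

section gaussianOperator

open Matrix

variable {ι : Type} [Fintype ι] [DecidableEq ι]

/-- The normalization of the integral kernel of a Gaussian operator. -/
def gaussConst (γ : Matrix (ι × Fin 2) (ι × Fin 2) ℝ) : ℝ :=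
  √(Real.pi ^ Fintype.card ι * (condCov (phaseEquiv ι) γ).det) /
    (Real.pi ^ Fintype.card ι * √γ.det)

theorem gaussConst_pos {γ : Matrix (ι × Fin 2) (ι × Fin 2) ℝ} (hγ : γ.PosDef) :
    0 < gaussConst γ := by
  have h1 := hγ.det_pos
  have h2 := (posDef_condCov (phaseEquiv ι) hγ).det_pos
  unfold gaussConst
  positivity

theorem phasePoint_self (d : ι × Fin 2 → ℝ) :
    phasePoint (fun i => d (i, 0)) (fun i => d (i, 1)) = d := by
  funext q
  obtain ⟨i, j⟩ := q
  fin_cases j <;> rfl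

/-- At the midpoint `r` the momentum is Gaussian with mean `q = p₀ + G(r - x₀)` and covariance
matrix `S`. Its Fourier transform at `x - y` gives the phase and the factor in `S`; the marginal in
`r` gives the factor in `P`. -/
theorem wignerKernel_gaussianWigner {γ : Matrix (ι × Fin 2) (ι × Fin 2) ℝ} (hγ : γ.PosDef)
    (d : ι × Fin 2 → ℝ) (x y : ι → ℝ) :
    wignerKernel (gaussianWigner d γ) x y =
      gaussKernel (margCov (phaseEquiv ι) γ)⁻¹ (condCov (phaseEquiv ι) γ) (regr (phaseEquiv ι) γ)
        (fun i => d (i, 0)) (fun i => d (i, 1)) (gaussConst γ) x y := by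
  set A := margCov (phaseEquiv ι) γ
  set S := condCov (phaseEquiv ι) γ with hS
  set G := regr (phaseEquiv ι) γ
  set x₀ : ι → ℝ := fun i => d (i, 0) with hx₀
  set p₀ : ι → ℝ := fun i => d (i, 1) with hp₀
  set r := (2 : ℝ)⁻¹ • (x + y) with hr
  set q := p₀ + G *ᵥ (r - x₀) with hq
  set N := Real.pi ^ Fintype.card ι * √γ.det with hN
  have hd : d = join (phaseEquiv ι) x₀ p₀ := by
    rw [← phasePoint_eq_join, phasePoint_self]
  have hpt : ∀ p : ι → ℝ, (gaussianWigner d γ (phasePoint r p) : ℂ) *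
      Complex.exp (Complex.I * ((p ⬝ᵥ (x - y) : ℝ) : ℂ)) =
      (((Real.exp (-((r - x₀) ⬝ᵥ A⁻¹ *ᵥ (r - x₀))) / N : ℝ) : ℂ) *
        Complex.exp (Complex.I * ((q ⬝ᵥ (x - y) : ℝ) : ℂ))) *
      Complex.exp (((-((p - q) ⬝ᵥ S⁻¹ *ᵥ (p - q)) : ℝ) : ℂ) +
        Complex.I * (((p - q) ⬝ᵥ (x - y) : ℝ) : ℂ)) := fun p => by
    unfold gaussianWigner
    have hquad : join (phaseEquiv ι) (r - x₀) (p - p₀) ⬝ᵥ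
        γ⁻¹ *ᵥ join (phaseEquiv ι) (r - x₀) (p - p₀) =
        (r - x₀) ⬝ᵥ A⁻¹ *ᵥ (r - x₀) + (p - q) ⬝ᵥ S⁻¹ *ᵥ (p - q) := by
      rw [join_inv_quadratic _ hγ, hq, ← sub_sub]
    have hsub : (p - q) ⬝ᵥ (x - y) = p ⬝ᵥ (x - y) - q ⬝ᵥ (x - y) := sub_dotProduct _ _ _
    rw [phasePoint_eq_join, hd, join_sub, hquad, neg_add, Real.exp_add, ← hN, hsub]
    push_cast
    rw [mul_sub, Complex.exp_add, Complex.exp_sub]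
    have := Complex.exp_ne_zero (Complex.I * ((q ⬝ᵥ (x - y) : ℝ) : ℂ))
    field_simp
  unfold wignerKernel
  simp_rw [← hr, hpt]
  rw [integral_const_mul, integral_sub_right_eq_self (fun p : ι → ℝ =>
    Complex.exp (((-(p ⬝ᵥ S⁻¹ *ᵥ p) : ℝ) : ℂ) + Complex.I * ((p ⬝ᵥ (x - y) : ℝ) : ℂ))) q,
    integral_gaussian_fourier (posDef_condCov _ hγ)]
  unfold gaussKernel gaussConst
  rw [← hr, ← hq, ← hN, ← hS, sub_eq_add_neg (-_), Complex.ofReal_add, Complex.exp_add,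
    Complex.exp_add, neg_div]
  push_cast
  ring

theorem continuous_wignerKernel_gaussianWigner {γ : Matrix (ι × Fin 2) (ι × Fin 2) ℝ}
    (hγ : γ.PosDef) : Continuous fun z : (ι × Fin 2 → ℝ) × (ι → ℝ) × (ι → ℝ) =>
      wignerKernel (gaussianWigner z.1 γ) z.2.1 z.2.2 := by
  simp_rw [wignerKernel_gaussianWigner hγ]
  have h1 := continuous_gaussKernel (margCov (phaseEquiv ι) γ)⁻¹ (condCov (phaseEquiv ι) γ)
    (regr (phaseEquiv ι) γ) (gaussConst γ)
  have h2 : Continuous fun z : (ι × Fin 2 → ℝ) × (ι → ℝ) × (ι → ℝ) =>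
      ((fun i => z.1 (i, 0)), (fun i => z.1 (i, 1)), z.2) := by fun_prop
  have h3 := h1.comp h2
  simp only [Function.comp_def] at h3
  exact h3

theorem continuous_wignerKernel_uncurry {γ : Matrix (ι × Fin 2) (ι × Fin 2) ℝ}
    (hγ : γ.PosDef) (d : ι × Fin 2 → ℝ) :
    Continuous (Function.uncurry (wignerKernel (gaussianWigner d γ))) := by
  have h2 : Continuous fun z : (ι → ℝ) × (ι → ℝ) => (d, z) := by fun_prop
  have h3 := (continuous_wignerKernel_gaussianWigner hγ).comp h2
  simp only [Function.comp_def] at h3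
  exact h3

/-- Gaussian kernels are dominated, uniformly in the displacement. -/
theorem exists_isDominatedKernel_gaussianWigner {γ : Matrix (ι × Fin 2) (ι × Fin 2) ℝ}
    (hγ : γ.PosDef) : ∃ ε > 0, ∀ d : ι × Fin 2 → ℝ, IsDominatedKernel volume
      (wignerKernel (gaussianWigner d γ)) (gaussBound ε (gaussConst γ) fun i => d (i, 0)) := by
  obtain ⟨ε, hε, h⟩ := exists_norm_gaussKernel_le (posDef_margCov (phaseEquiv ι) hγ).inv
    (posDef_condCov (phaseEquiv ι) hγ) (regr (phaseEquiv ι) γ) (gaussConst_pos hγ).le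
  refine ⟨ε, hε, fun d => ⟨?_, memLp_gaussBound hε _ _, fun x => ?_, fun x y => ?_⟩⟩
  · exact (continuous_wignerKernel_uncurry hγ d).stronglyMeasurable
  · unfold gaussBound
    positivity
  · rw [wignerKernel_gaussianWigner hγ]
    exact h _ _ _ _

theorem wignerKernel_gaussianWigner_conj {γ : Matrix (ι × Fin 2) (ι × Fin 2) ℝ} (hγ : γ.PosDef)
    (d : ι × Fin 2 → ℝ) (x y : ι → ℝ) :
    wignerKernel (gaussianWigner d γ) y x =
      (starRingEnd ℂ) (wignerKernel (gaussianWigner d γ) x y) := by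
  rw [wignerKernel_gaussianWigner hγ, wignerKernel_gaussianWigner hγ, gaussKernel_conj]

/-- The diagonal of the kernel of a Gaussian operator is a probability density. -/
theorem exists_diagonal_gaussianWigner {γ : Matrix (ι × Fin 2) (ι × Fin 2) ℝ} (hγ : γ.PosDef)
    (d : ι × Fin 2 → ℝ) : ∃ k : (ι → ℝ) → ℝ, Integrable k ∧ ∫ x, k x = 1 ∧
      ∀ x, wignerKernel (gaussianWigner d γ) x x = (k x : ℂ) := by
  have hA := posDef_margCov (phaseEquiv ι) hγ
  have hS := posDef_condCov (phaseEquiv ι) hγ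
  refine ⟨fun x => gaussConst γ * Real.exp (-((x - fun i => d (i, 0)) ⬝ᵥ
    (margCov (phaseEquiv ι) γ)⁻¹ *ᵥ (x - fun i => d (i, 0)))), ?_, ?_, fun x => ?_⟩
  · exact ((integrable_exp_neg_quadratic hA.inv).comp_sub_right _).const_mul _
  · rw [integral_const_mul, integral_exp_neg_quadratic hA, gaussConst,
      det_eq_margCov_mul_condCov (phaseEquiv ι) hγ]
    have h1 := hA.det_pos
    have h2 := hS.det_pos
    have hpi : (0 : ℝ) < Real.pi ^ Fintype.card ι := by positivity
    rw [Real.sqrt_mul hpi.le, Real.sqrt_mul hpi.le, Real.sqrt_mul h1.le]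
    have h3 := Real.mul_self_sqrt hpi.le
    have h4 := Real.sqrt_pos.2 h1
    have h5 := Real.sqrt_pos.2 h2
    rw [div_mul_eq_mul_div, div_eq_one_iff_eq (by positivity)]
    linear_combination √(condCov (phaseEquiv ι) γ).det * √(margCov (phaseEquiv ι) γ).det * h3
  · rw [wignerKernel_gaussianWigner hγ, gaussKernel_self]

/-- The kernel of a Gaussian operator satisfying the uncertainty relation is a sum of rank one
kernels. -/
theorem exists_rankOne_gaussianWigner {γ : Matrix (ι × Fin 2) (ι × Fin 2) ℝ} (hγ : γ.PosDef)
    (hQ : (plusI γ (Omega ι)).PosSemidef) (d : ι × Fin 2 → ℝ) :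
    ∃ (I : Type) (_ : Countable I) (ψ : I → (ι → ℝ) → ℂ) (hψ : ∀ s, MemLp (ψ s) 2),
      (∀ s, Continuous (ψ s)) ∧ HasSum (fun s => ‖(hψ s).toLp (ψ s)‖ ^ 2) 1 ∧ ∀ x y,
        HasSum (fun s => ψ s x * (starRingEnd ℂ) (ψ s y)) (wignerKernel (gaussianWigner d γ) x y) := by
  obtain ⟨ψ, hc, hs⟩ := exists_hasSum_gaussKernel
    (isSymm_of_posDef (posDef_margCov (phaseEquiv ι) hγ).inv)
    (isSymm_of_posDef (posDef_condCov (phaseEquiv ι) hγ)) (regr (phaseEquiv ι) γ)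
    (fun i => d (i, 0)) (fun i => d (i, 1)) (gaussConst_pos hγ).le
    ((plusI_Omega_posSemidef_iff hγ).1 hQ)
  simp_rw [← wignerKernel_gaussianWigner hγ] at hs
  obtain ⟨k, hk, hk1, hkd⟩ := exists_diagonal_gaussianWigner hγ d
  -- On the diagonal the series is `∑ |ψ_s(x)|² = k(x)` with `∫ k = 1`. Hence each `ψ_s` is square
  -- integrable and the squared norms add up to one.
  have hdiag : ∀ x, HasSum (fun s => ‖ψ s x‖ ^ 2) (k x) := fun x => by
    have h := hs x x
    rw [hkd] at h
    rw [← Complex.hasSum_ofReal]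
    refine h.congr_fun fun s => ?_
    rw [Complex.mul_conj, Complex.normSq_eq_norm_sq]
  have hψ : ∀ s, MemLp (ψ s) 2 := fun s => by
    rw [memLp_two_iff_integrable_sq_norm (hc s).aestronglyMeasurable]
    refine hk.mono' ((hc s).norm.pow 2).aestronglyMeasurable (Filter.Eventually.of_forall fun x => ?_)
    rw [Real.norm_of_nonneg (by positivity)]
    exact le_hasSum (hdiag x) s fun _ _ => by positivity
  refine ⟨_, inferInstance, ψ, hψ, hc, ?_, hs⟩
  rw [← hk1]
  exact hasSum_norm_sq_toLp hψ hk hdiag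

theorem exists_isKernelOperator_gaussianWigner {γ : Matrix (ι × Fin 2) (ι × Fin 2) ℝ}
    (hγ : γ.PosDef) (d : ι × Fin 2 → ℝ) :
    ∃ T : L2 ι →L[ℂ] L2 ι, IsKernelOperator (wignerKernel (gaussianWigner d γ)) T := by
  obtain ⟨ε, -, h⟩ := exists_isDominatedKernel_gaussianWigner hγ
  exact (h d).exists_isKernelOperator

/-- Gaussian operators satisfying the uncertainty relation are density operators. -/
theorem isDensityOperator_of_isKernelOperator {γ : Matrix (ι × Fin 2) (ι × Fin 2) ℝ}
    (hγ : γ.PosDef) (hQ : (plusI γ (Omega ι)).PosSemidef) {d : ι × Fin 2 → ℝ}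
    {T : L2 ι →L[ℂ] L2 ι} (hT : IsKernelOperator (wignerKernel (gaussianWigner d γ)) T) :
    IsDensityOperator T := by
  obtain ⟨ε, -, h⟩ := exists_isDominatedKernel_gaussianWigner hγ
  obtain ⟨I, _, ψ, hψ, -, hsum, hs⟩ := exists_rankOne_gaussianWigner hγ hQ d
  have h1 := (h d).hasSum_rankOne hT hψ hsum.summable hs
  refine ⟨isPositive_of_hasSum_rankOne h1, ?_⟩
  simpa using hasTrace_of_hasSum_rankOne hsum h1

/-! ### Positivity implies the uncertainty relation -/

/-- A positive operator with continuous kernel has a positive definite kernel. Were the form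
negative at the points `x i`, it would stay negative when they are moved slightly, and the
combination of indicators of small balls around them would have negative expectation. -/
theorem re_sum_kernel_nonneg {K : (ι → ℝ) → (ι → ℝ) → ℂ} {h : (ι → ℝ) → ℝ}
    (hK : IsDominatedKernel volume K h) (hc : Continuous (Function.uncurry K))
    {T : L2 ι →L[ℂ] L2 ι} (hT : IsKernelOperator K T) (hpos : T.IsPositive)
    {J : Type} [Fintype J] (x : J → ι → ℝ) (c : J → ℂ) :
    0 ≤ (∑ i, ∑ j, (starRingEnd ℂ) (c i) * (c j * K (x i) (x j))).re := by
  by_contra hneg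
  push Not at hneg
  -- Translating every point to the origin lets all pairs `(i, j)` be integrated over one and the
  -- same set `B ×ˢ B`.
  set H : (ι → ℝ) × (ι → ℝ) → ℂ := fun z =>
    ∑ i, ∑ j, (starRingEnd ℂ) (c i) * (c j * K (z.1 + x i) (z.2 + x j)) with hH
  have hKc : ∀ i j, Continuous fun z : (ι → ℝ) × (ι → ℝ) => K (z.1 + x i) (z.2 + x j) :=
    fun i j => hc.comp (f := fun z : (ι → ℝ) × (ι → ℝ) => (z.1 + x i, z.2 + x j)) (by fun_prop)
  have hHc : Continuous H := continuous_finsetSum _ fun i _ => continuous_finsetSum _ fun j _ =>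
    continuous_const.mul (continuous_const.mul (hKc i j))
  have h0 : (H (0, 0)).re < 0 := by simpa [hH] using hneg
  have hev : ∀ᶠ z in nhds (0 : (ι → ℝ) × (ι → ℝ)), (H z).re < 0 :=
    (Complex.continuous_re.comp hHc).continuousAt.eventually_lt continuousAt_const h0
  obtain ⟨ε, hε, hball⟩ := Metric.eventually_nhds_iff_ball.1 hev
  set B : Set (ι → ℝ) := Metric.ball 0 ε with hB
  have hBm : MeasurableSet B := Metric.isOpen_ball.measurableSet
  have hBf : volume B < ⊤ := measure_ball_lt_top
  have hBB : B ×ˢ B = Metric.ball (0 : (ι → ℝ) × (ι → ℝ)) ε := by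
    rw [hB, ball_prod_same]
    rfl
  set F : J → (ι → ℝ) → ℂ := fun i => Set.indicator ((fun y => y - x i) ⁻¹' B) 1 with hF
  have hFm : ∀ i, MemLp (F i) 2 := fun i => by
    refine memLp_indicator_const 2 ?_ 1 (Or.inr ?_)
    · exact (measurable_sub_const _) hBm
    · rw [(measurePreserving_sub_right volume (x i)).measure_preimage hBm.nullMeasurableSet]
      exact hBf.ne
  have hint : ∀ i j, ⟪(hFm i).toLp (F i), T ((hFm j).toLp (F j))⟫_ℂ =
      ∫ z in B ×ˢ B, K (z.1 + x i) (z.2 + x j) ∂(volume.prod volume) := fun i j => by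
    rw [hK.inner_eq hT]
    have h1 : (fun z : (ι → ℝ) × (ι → ℝ) => (starRingEnd ℂ) ((hFm i).toLp (F i) z.1) *
        (K z.1 z.2 * (hFm j).toLp (F j) z.2)) =ᵐ[volume.prod volume]
        fun z => (starRingEnd ℂ) (F i z.1) * (K z.1 z.2 * F j z.2) := by
      filter_upwards [Measure.quasiMeasurePreserving_fst.ae (hFm i).coeFn_toLp,
        Measure.quasiMeasurePreserving_snd.ae (hFm j).coeFn_toLp] with z h1 h2
      rw [h1, h2]
    rw [integral_congr_ae h1, ← integral_indicator (hBm.prod hBm)]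
    have hmp : MeasurePreserving (fun z : (ι → ℝ) × (ι → ℝ) => (z.1 + x i, z.2 + x j))
        (volume.prod volume) (volume.prod volume) :=
      (measurePreserving_add_right volume (x i)).prod (measurePreserving_add_right volume (x j))
    rw [← hmp.integral_comp ((MeasurableEquiv.addRight (x i)).prodCongr
      (MeasurableEquiv.addRight (x j))).measurableEmbedding]
    refine integral_congr_ae (Filter.Eventually.of_forall fun z => ?_)
    simp only [hF]
    by_cases h2 : z.1 ∈ B <;> by_cases h3 : z.2 ∈ B <;> simp [h2, h3]
  have hIint : ∀ i j, IntegrableOn (fun z : (ι → ℝ) × (ι → ℝ) => K (z.1 + x i) (z.2 + x j))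
      (B ×ˢ B) (volume.prod volume) := fun i j => by
    refine ((hKc i j).continuousOn.integrableOn_compact
      (isCompact_closedBall (0 : (ι → ℝ) × (ι → ℝ)) ε)).mono_set ?_
    rw [hBB]
    exact Metric.ball_subset_closedBall
  set f : L2 ι := ∑ i, c i • (hFm i).toLp (F i) with hf
  have hval : ⟪f, T f⟫_ℂ = ∫ z in B ×ˢ B, H z ∂(volume.prod volume) := by
    rw [hf, map_sum, sum_inner]
    simp_rw [inner_sum, map_smul, inner_smul_left, inner_smul_right, hint]
    rw [hH, integral_finsetSum _ fun i _ => integrable_finsetSum _ fun j _ =>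
      ((hIint i j).const_mul _).const_mul _]
    refine Finset.sum_congr rfl fun i _ => ?_
    rw [integral_finsetSum _ fun j _ => ((hIint i j).const_mul _).const_mul _]
    refine Finset.sum_congr rfl fun j _ => ?_
    rw [integral_const_mul, integral_const_mul]
  have hHint : IntegrableOn H (B ×ˢ B) (volume.prod volume) :=
    integrable_finsetSum _ fun i _ => integrable_finsetSum _ fun j _ =>
      ((hIint i j).const_mul _).const_mul _
  have hre : (⟪f, T f⟫_ℂ).re = ∫ z in B ×ˢ B, (H z).re ∂(volume.prod volume) := by
    rw [hval]
    exact (integral_re hHint).symm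
  have hge : 0 ≤ (⟪f, T f⟫_ℂ).re := by
    have := hpos.re_inner_nonneg_right f
    simpa using this
  have hlt : ∫ z in B ×ˢ B, (H z).re ∂(volume.prod volume) < 0 := by
    rw [← neg_pos, ← integral_neg]
    refine (setIntegral_pos_iff_support_of_nonneg_ae ?_ hHint.re.neg).2 ?_
    · refine (ae_restrict_iff' (hBm.prod hBm)).2 (Filter.Eventually.of_forall fun z hz => ?_)
      have := hball z (hBB ▸ hz)
      exact (neg_pos.2 this).le
    · have hsub : B ×ˢ B ⊆ (Function.support fun z => -(H z).re) ∩ B ×ˢ B := fun z hz => by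
        refine ⟨?_, hz⟩
        have := hball z (hBB ▸ hz)
        simp only [Function.mem_support, ne_eq, neg_eq_zero]
        exact this.ne
      refine lt_of_lt_of_le ?_ (measure_mono hsub)
      rw [Measure.prod_prod]
      have : 0 < volume B := Metric.measure_ball_pos _ _ hε
      exact ENNReal.mul_pos this.ne' this.ne'
  linarith

/-- Positive definiteness of `exp(½ s xᵀQy)` for all `s ≥ 0` makes the form of `Q` nonnegative on
coefficients of sum zero: the constant term drops out and the first order in `s` decides. Placing
one point at the origin removes the restriction on the coefficients. -/
theorem plusI_Omega_posSemidef_of_isPositive {γ : Matrix (ι × Fin 2) (ι × Fin 2) ℝ}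
    (hγ : γ.PosDef) {d : ι × Fin 2 → ℝ} {T : L2 ι →L[ℂ] L2 ι}
    (hT : IsKernelOperator (wignerKernel (gaussianWigner d γ)) T) (hpos : T.IsPositive) :
    (plusI γ (Omega ι)).PosSemidef := by
  rw [plusI_Omega_posSemidef_iff hγ]
  have hA := posDef_margCov (phaseEquiv ι) hγ
  have hS := posDef_condCov (phaseEquiv ι) hγ
  obtain ⟨ε, -, hdom⟩ := exists_isDominatedKernel_gaussianWigner hγ
  have hKc := continuous_wignerKernel_uncurry hγ d
  set P := (margCov (phaseEquiv ι) γ)⁻¹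
  set S := condCov (phaseEquiv ι) γ
  set G := regr (phaseEquiv ι) γ
  set Q := plusI (S - P) (G - Gᵀ) with hQ
  set x₀ : ι → ℝ := fun i => d (i, 0) with hx₀
  have hSs : S.IsSymm := isSymm_of_posDef hS
  have hPs : P.IsSymm := isSymm_of_posDef hA.inv
  set B : (ι → ℝ) → (ι → ℝ) → ℂ := fun x y =>
    (fun i => (x i : ℂ)) ⬝ᵥ Q *ᵥ (fun i => (y i : ℂ)) with hB
  have hexp : ∀ {J : Type} [Fintype J] (x : J → ι → ℝ) (c : J → ℂ),
      0 ≤ (∑ i, ∑ j, (starRingEnd ℂ) (c i) * (c j * Complex.exp (2⁻¹ * B (x i) (x j)))).re := by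
    intro J _ x c
    set g := gaussFactor P S G x₀ (fun i => d (i, 1)) (gaussConst γ) with hg
    have hg0 : ∀ y, g y ≠ 0 := gaussFactor_ne_zero _ _ _ _ _ (gaussConst_pos hγ)
    -- Dividing the coefficients by `conj(g)` cancels the outer factors of the kernel.
    have h1 := re_sum_kernel_nonneg (hdom d) hKc hT hpos (fun i => x i + x₀)
      (fun i => c i / (starRingEnd ℂ) (g (x i + x₀)))
    convert h1 using 4 with i _ j _
    rw [wignerKernel_gaussianWigner hγ, gaussKernel_eq_factor hPs hSs G _ _ (gaussConst_pos hγ).le,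
      ← hg, map_div₀, Complex.conj_conj, ← hQ]
    simp only [← hx₀, add_sub_cancel_right]
    have h2 := hg0 (x i + x₀)
    have h3 : (starRingEnd ℂ) (g (x j + x₀)) ≠ 0 := by
      rw [ne_eq, map_eq_zero]
      exact hg0 _
    rw [hB]
    field_simp
  have hherm : Q.IsHermitian := by
    ext i j
    have h1 : S j i - P j i = S i j - P i j := by rw [hSs.apply, hPs.apply]
    simp only [hQ, plusI, conjTranspose_apply, Matrix.add_apply, Matrix.smul_apply, map_apply,
      Matrix.sub_apply, transpose_apply, h1, star_add, smul_eq_mul, star_mul']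
    simp
    ring
  refine PosSemidef.of_dotProduct_mulVec_nonneg hherm fun z => ?_
  set u : ι → ℝ := fun i => (z i).re with hu
  set v : ι → ℝ := fun i => (z i).im with hv
  -- The kernel has real arguments only, so the complex vector is represented as `z = 1·u + i·v`.
  -- The coefficient `-(1 + i)` at the origin makes the sum zero without changing the form of `Q`.
  set p : Fin 3 → ι → ℝ := ![0, u, v] with hp
  set c : Fin 3 → ℂ := ![-(1 + Complex.I), 1, Complex.I] with hc
  have hz : z = (fun i => (u i : ℂ)) + Complex.I • (fun i => (v i : ℂ)) := by
    funext i
    simp [hu, hv, mul_comm Complex.I, Complex.re_add_im]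
  have hsz : star z = (fun i => (u i : ℂ)) - Complex.I • (fun i => (v i : ℂ)) := by
    rw [hz]
    funext i
    simp [sub_eq_add_neg]
  have hval : star z ⬝ᵥ Q *ᵥ z =
      ∑ i, ∑ j, (starRingEnd ℂ) (c i) * (c j * B (p i) (p j)) := by
    have hz0 : (fun i => (((0 : ι → ℝ) i : ℝ) : ℂ)) = 0 := by
      funext i
      simp
    rw [hsz]
    conv_lhs => rw [hz]
    simp only [Fin.sum_univ_three, hc, hp, hB, Matrix.cons_val_zero, Matrix.cons_val_one,
      Matrix.cons_val, hz0, mulVec_zero, dotProduct_zero, zero_dotProduct, mulVec_add, mulVec_smul,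
      dotProduct_add, sub_dotProduct, dotProduct_smul, smul_dotProduct, smul_eq_mul, map_one,
      Complex.conj_I]
    ring
  set Φ : ℝ → ℝ := fun s => (∑ i, ∑ j, (starRingEnd ℂ) (c i) *
    (c j * Complex.exp (2⁻¹ * ((s : ℂ) * B (p i) (p j))))).re with hΦ
  have hΦnn : ∀ s, 0 ≤ s → 0 ≤ Φ s := fun s hs => by
    -- Scaling the points by `√s` multiplies the sesquilinear exponent by `s`.
    have h1 := hexp (fun i => √s • p i) c
    have h2 : ∀ y : ι → ℝ, (fun k => (((√s • y) k : ℝ) : ℂ)) = (√s : ℂ) • fun k => (y k : ℂ) :=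
      fun y => by
        funext k
        simp
    have h3 : (s : ℂ) = (√s : ℂ) * (√s : ℂ) := by
      rw [← Complex.ofReal_mul, Real.mul_self_sqrt hs]
    have h4 : ∀ x y : ι → ℝ, B (√s • x) (√s • y) = (s : ℂ) * B x y := fun x y => by
      simp only [hB]
      rw [h2, h2, mulVec_smul, dotProduct_smul, smul_dotProduct, smul_eq_mul, smul_eq_mul, h3,
        mul_assoc]
    simpa only [h4] using h1
  have hΦ0 : Φ 0 = 0 := by
    simp [hΦ, Fin.sum_univ_three, hc]
  have hder : HasDerivAt Φ (2⁻¹ * (star z ⬝ᵥ Q *ᵥ z).re) 0 := by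
    have h1 : HasDerivAt (fun s : ℝ => ∑ i, ∑ j, (starRingEnd ℂ) (c i) *
        (c j * Complex.exp (2⁻¹ * ((s : ℂ) * B (p i) (p j)))))
        (∑ i, ∑ j, (starRingEnd ℂ) (c i) * (c j * (2⁻¹ * B (p i) (p j)))) 0 := by
      refine HasDerivAt.fun_sum fun i _ => HasDerivAt.fun_sum fun j _ => ?_
      refine HasDerivAt.const_mul _ (HasDerivAt.const_mul _ ?_)
      have h2 : HasDerivAt (fun s : ℝ => 2⁻¹ * ((s : ℂ) * B (p i) (p j)))
          (2⁻¹ * (1 * B (p i) (p j))) 0 :=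
        ((Complex.ofRealCLM.hasDerivAt (x := (0 : ℝ))).mul_const _).const_mul _
      simpa using h2.cexp
    have h3 := Complex.reCLM.hasFDerivAt.comp_hasDerivAt (0 : ℝ) h1
    have h4 : ∑ i, ∑ j, (starRingEnd ℂ) (c i) * (c j * (2⁻¹ * B (p i) (p j))) =
        ((2⁻¹ : ℝ) : ℂ) * ∑ i, ∑ j, (starRingEnd ℂ) (c i) * (c j * B (p i) (p j)) := by
      simp only [Finset.mul_sum]
      refine Finset.sum_congr rfl fun i _ => Finset.sum_congr rfl fun j _ => ?_
      push_cast
      ring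
    rw [h4, ← hval, Complex.reCLM_apply, Complex.re_ofReal_mul] at h3
    exact h3
  have hnn : 0 ≤ (star z ⬝ᵥ Q *ᵥ z).re := by
    have h1 := hder.hasDerivWithinAt (s := Set.Ioi 0)
    rw [hasDerivWithinAt_iff_tendsto_slope' (by simp)] at h1
    have h2 : 0 ≤ 2⁻¹ * (star z ⬝ᵥ Q *ᵥ z).re := by
      refine ge_of_tendsto h1 ?_
      filter_upwards [self_mem_nhdsWithin] with s hs
      rw [slope_def_field, hΦ0, sub_zero, sub_zero]
      exact div_nonneg (hΦnn s (le_of_lt hs)) (le_of_lt hs)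
    linarith
  rw [Complex.nonneg_iff]
  exact ⟨hnn, (hherm.im_star_dotProduct_mulVec_self z).symm⟩

end gaussianOperator

/-! ### Product vectors -/

section prodComm

variable {X Y Z : Type*} [MeasurableSpace X] [MeasurableSpace Y] [MeasurableSpace Z]
  (μ : Measure X) (ν : Measure Y) (τ : Measure Z) [SFinite μ] [SFinite ν] [SFinite τ]

theorem measurePreserving_prodAssoc_symm :
    MeasurePreserving (MeasurableEquiv.prodAssoc : (X × Y) × Z ≃ᵐ X × Y × Z).symm
      (μ.prod (ν.prod τ)) ((μ.prod ν).prod τ) :=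
  MeasurePreserving.symm _ (measurePreserving_prodAssoc μ ν τ)

/-- The map `((x, y), w) ↦ ((y, x), w)`, up to associativity. -/
theorem measurePreserving_swap_left :
    MeasurePreserving (fun z : X × Y × Z => (z.2.1, z.1, z.2.2))
      (μ.prod (ν.prod τ)) (ν.prod (μ.prod τ)) :=
  (measurePreserving_prodAssoc ν μ τ).comp
    ((Measure.measurePreserving_swap.prod (MeasurePreserving.id τ)).comp
      (measurePreserving_prodAssoc_symm μ ν τ))

/-- The exchange of the middle two factors. -/
theorem measurePreserving_prodProdProdComm {W : Type*} [MeasurableSpace W] (ω : Measure W)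
    [SFinite ω] : MeasurePreserving
      (fun z : (X × Y) × (Z × W) => ((z.1.1, z.2.1), (z.1.2, z.2.2)))
      ((μ.prod ν).prod (τ.prod ω)) ((μ.prod τ).prod (ν.prod ω)) :=
  (measurePreserving_prodAssoc_symm μ τ (ν.prod ω)).comp
    (((MeasurePreserving.id μ).prod (measurePreserving_swap_left ν τ ω)).comp
      (measurePreserving_prodAssoc μ ν (τ.prod ω)))

/-- The exchange of the first factors of two pairs. -/
theorem measurePreserving_swap_fst : MeasurePreserving
    (fun z : (X × Y) × (X × Y) => ((z.2.1, z.1.2), (z.1.1, z.2.2)))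
      ((μ.prod ν).prod (μ.prod ν)) ((μ.prod ν).prod (μ.prod ν)) :=
  (measurePreserving_prodProdProdComm μ μ ν ν).comp
    ((Measure.measurePreserving_swap.prod (MeasurePreserving.id (ν.prod ν))).comp
      (measurePreserving_prodProdProdComm μ ν μ ν))

theorem measurableEmbedding_swap_fst : MeasurableEmbedding
    (fun z : (X × Y) × (X × Y) => ((z.2.1, z.1.2), (z.1.1, z.2.2))) := by
  let e : (X × Y) × (X × Y) ≃ᵐ (X × Y) × (X × Y) :=
    { toFun := fun z => ((z.2.1, z.1.2), (z.1.1, z.2.2))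
      invFun := fun z => ((z.2.1, z.1.2), (z.1.1, z.2.2))
      left_inv := fun _ => rfl
      right_inv := fun _ => rfl
      measurable_toFun := by
        simp only [Equiv.coe_fn_mk]
        fun_prop
      measurable_invFun := by
        simp only [Equiv.coe_fn_symm_mk]
        fun_prop }
  exact e.measurableEmbedding

end prodComm

/-- `τ f g` is the product vector `f ⊗ g`, where the modes are labelled through `e`. -/
def IsTensor {α β ι : Type} [Fintype α] [Fintype β] [Fintype ι] (e : α ⊕ β ≃ ι)
    (τ : L2 α → L2 β → L2 ι) : Prop :=
  ∀ f g, τ f g =ᵐ[volume] fun x => f (fun i => x (e (.inl i))) * g (fun j => x (e (.inr j)))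

section tensor

variable {α β ι : Type} [Fintype α] [Fintype β] [Fintype ι] {e : α ⊕ β ≃ ι}
  {τ : L2 α → L2 β → L2 ι}

theorem isTensor_tensor :
    IsTensor (Equiv.refl (α ⊕ β)) (fun (f : L2 α) (g : L2 β) => tensor f g) :=
  fun f g => (memLp_tensor f g).coeFn_toLp

/-- With the labelling of the modes as a parameter, both steering directions are instances of one
statement. -/
theorem isTensor_tensor_swap :
    IsTensor (Equiv.sumComm β α) (fun (g : L2 β) (f : L2 α) => tensor f g) := fun g f => by
  filter_upwards [(memLp_tensor f g).coeFn_toLp] with x hx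
  rw [tensor, hx, mul_comm]
  rfl

theorem IsTensor.ae_join (hτ : IsTensor e τ) (f : L2 α) (g : L2 β) :
    ∀ᵐ z : (α → ℝ) × (β → ℝ) ∂((volume : Measure (α → ℝ)).prod volume),
      τ f g (join e z.1 z.2) = f z.1 * g z.2 := by
  filter_upwards [(measurePreserving_join e).quasiMeasurePreserving.ae (hτ f g)] with z hz
  rw [hz]
  simp only [join_inl, join_inr]

theorem IsTensor.inner_eq_integral (hτ : IsTensor e τ) {K : (ι → ℝ) → (ι → ℝ) → ℂ}
    {h : (ι → ℝ) → ℝ} (hK : IsDominatedKernel volume K h) {T : L2 ι →L[ℂ] L2 ι}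
    (hT : IsKernelOperator K T) (f f' : L2 α) (g g' : L2 β) :
    ⟪τ f g, T (τ f' g')⟫_ℂ = ∫ w : ((α → ℝ) × (β → ℝ)) × ((α → ℝ) × (β → ℝ)),
      (starRingEnd ℂ) (f w.1.1 * g w.1.2) *
        (K (join e w.1.1 w.1.2) (join e w.2.1 w.2.2) * (f' w.2.1 * g' w.2.2))
          ∂(((volume : Measure (α → ℝ)).prod volume).prod
            ((volume : Measure (α → ℝ)).prod volume)) := by
  rw [hK.inner_eq hT]
  have hmp := (measurePreserving_join e).prod (measurePreserving_join e)
  have hme : MeasurableEmbedding (Prod.map (fun z : (α → ℝ) × (β → ℝ) => join e z.1 z.2)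
      (fun z : (α → ℝ) × (β → ℝ) => join e z.1 z.2)) :=
    (measurableEmbedding_join e).prodMap (measurableEmbedding_join e)
  rw [← hmp.integral_comp hme]
  refine integral_congr_ae ?_
  filter_upwards [Measure.quasiMeasurePreserving_fst.ae (hτ.ae_join f g),
    Measure.quasiMeasurePreserving_snd.ae (hτ.ae_join f' g')] with w h1 h2
  simp only [Prod.map_fst, Prod.map_snd]
  rw [h1, h2]

end tensor

/-! ### Partial transposition of Gaussian operators -/

section partialTranspose

open Matrix

variable {α β : Type} [Fintype α] [Fintype β] [DecidableEq α] [DecidableEq β]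

/-- Exchanging the two `A`-arguments of the double integral preserves the measure; it trades `K'`
for `K` and `f` for the conjugate of `f'`. -/
theorem isPartialTranspose_of_isKernelOperator {K K' : (α ⊕ β → ℝ) → (α ⊕ β → ℝ) → ℂ}
    {h h' : (α ⊕ β → ℝ) → ℝ} (hK : IsDominatedKernel volume K h)
    (hK' : IsDominatedKernel volume K' h') {ρ T : L2 (α ⊕ β) →L[ℂ] L2 (α ⊕ β)}
    (hρ : IsKernelOperator K ρ) (hT : IsKernelOperator K' T)
    (hKK : ∀ x x' y y', K' (join (Equiv.refl _) x y) (join (Equiv.refl _) x' y') =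
      K (join (Equiv.refl _) x' y) (join (Equiv.refl _) x y')) :
    IsPartialTranspose ρ T := by
  intro f f' g g'
  rw [isTensor_tensor.inner_eq_integral hK' hT, isTensor_tensor.inner_eq_integral hK hρ,
    ← (measurePreserving_swap_fst (volume : Measure (α → ℝ))
      (volume : Measure (β → ℝ))).integral_comp measurableEmbedding_swap_fst]
  have hs1 : ∀ f : L2 α, ∀ᵐ w : ((α → ℝ) × (β → ℝ)) × ((α → ℝ) × (β → ℝ))
      ∂(((volume : Measure (α → ℝ)).prod volume).prod ((volume : Measure (α → ℝ)).prod volume)),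
      (star f : L2 α) w.1.1 = (starRingEnd ℂ) (f w.1.1) := fun f =>
    Measure.quasiMeasurePreserving_fst.ae (Measure.quasiMeasurePreserving_fst.ae (Lp.coeFn_star f))
  have hs2 : ∀ f : L2 α, ∀ᵐ w : ((α → ℝ) × (β → ℝ)) × ((α → ℝ) × (β → ℝ))
      ∂(((volume : Measure (α → ℝ)).prod volume).prod ((volume : Measure (α → ℝ)).prod volume)),
      (star f : L2 α) w.2.1 = (starRingEnd ℂ) (f w.2.1) := fun f =>
    Measure.quasiMeasurePreserving_snd.ae (Measure.quasiMeasurePreserving_fst.ae (Lp.coeFn_star f))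
  refine integral_congr_ae ?_
  filter_upwards [hs1 f', hs2 f] with w h1 h2
  rw [h1, h2, hKK]
  simp only [map_mul, Complex.conj_conj]
  ring

/-- The signs of the coordinates under transposition of the first party: momenta change sign. -/
def transposeSign (q : (α ⊕ β) × Fin 2) : ℝ :=
  if q.2 = 1 then Sum.elim (fun _ => -1) (fun _ => 1) q.1 else 1

theorem transposeSign_mul_self (q : (α ⊕ β) × Fin 2) :
    transposeSign q * transposeSign q = 1 := by
  obtain ⟨i | i, j⟩ := q <;> fin_cases j <;> simp [transposeSign]

/-- The covariance matrix of the partial transpose. -/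
def transposeCov (γ : Matrix ((α ⊕ β) × Fin 2) ((α ⊕ β) × Fin 2) ℝ) :
    Matrix ((α ⊕ β) × Fin 2) ((α ⊕ β) × Fin 2) ℝ :=
  diagonal transposeSign * γ * diagonal transposeSign

theorem diagonal_transposeSign_mul_self :
    diagonal (transposeSign (α := α) (β := β)) * diagonal transposeSign = 1 := by
  rw [diagonal_mul_diagonal]
  simp_rw [transposeSign_mul_self]
  exact diagonal_one

theorem posDef_transposeCov {γ : Matrix ((α ⊕ β) × Fin 2) ((α ⊕ β) × Fin 2) ℝ} (hγ : γ.PosDef) :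
    (transposeCov γ).PosDef := by
  have hU : IsUnit (diagonal (transposeSign (α := α) (β := β))) :=
    IsUnit.of_mul_eq_one _ diagonal_transposeSign_mul_self
  have h := (IsUnit.posDef_star_left_conjugate_iff hU).2 hγ
  rwa [star_eq_conjTranspose, diagonal_conjTranspose, star_trivial] at h

/-- Conjugating again by the sign matrix restores `γ`. Reversing the momenta of `A` turns `Ω_A` into
`-Ω_A` and leaves `Ω_B` alone. -/
theorem plusI_transposeCov_posSemidef {γ : Matrix ((α ⊕ β) × Fin 2) ((α ⊕ β) × Fin 2) ℝ}
    (h : (plusI (transposeCov γ) (Omega (α ⊕ β))).PosSemidef) :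
    (plusI γ (partialOmega α β)).PosSemidef := by
  have h1 := h.conjTranspose_mul_mul_same
    (diagonal fun q : (α ⊕ β) × Fin 2 => (transposeSign q : ℂ))
  convert h1 using 1
  have h2 : star (fun q : (α ⊕ β) × Fin 2 => (transposeSign q : ℂ)) =
      fun q => (transposeSign q : ℂ) := by
    funext q
    simp
  rw [diagonal_conjTranspose, h2]
  ext q q'
  rw [mul_diagonal, diagonal_mul]
  have h3 : transposeCov γ q q' = transposeSign q * γ q q' * transposeSign q' := by
    rw [transposeCov, mul_diagonal, diagonal_mul]
  have h4 : partialOmega α β q q' = transposeSign q * Omega (α ⊕ β) q q' * transposeSign q' := by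
    obtain ⟨i | i, j⟩ := q <;> obtain ⟨i' | i', j'⟩ := q' <;> fin_cases j <;> fin_cases j' <;>
      simp [partialOmega, Omega, transposeSign, one_apply, apply_ite (Neg.neg : ℝ → ℝ)]
  have h5 : (transposeSign q : ℂ) * (transposeSign q : ℂ) = 1 := by
    exact_mod_cast transposeSign_mul_self q
  have h6 : (transposeSign q' : ℂ) * (transposeSign q' : ℂ) = 1 := by
    exact_mod_cast transposeSign_mul_self q'
  simp only [plusI, Matrix.add_apply, Matrix.smul_apply, map_apply, h3, h4, smul_eq_mul]
  push_cast
  linear_combination (-(γ q q' : ℂ)) * h5 - (γ q q' : ℂ) * (transposeSign q : ℂ) *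
    (transposeSign q : ℂ) * h6

/-- Exchanging `x` and `x'` keeps the midpoint and reverses the `A`-part of the difference.
Substituting `p_A ↦ -p_A` moves the sign into the Wigner function, where it acts on mean and
covariance. -/
theorem wignerKernel_transposeCov {γ : Matrix ((α ⊕ β) × Fin 2) ((α ⊕ β) × Fin 2) ℝ}
    (d : (α ⊕ β) × Fin 2 → ℝ) (x x' : α → ℝ) (y y' : β → ℝ) :
    wignerKernel (gaussianWigner (fun q => transposeSign q * d q) (transposeCov γ))
      (join (Equiv.refl _) x y) (join (Equiv.refl _) x' y') =
    wignerKernel (gaussianWigner d γ) (join (Equiv.refl _) x' y) (join (Equiv.refl _) x y') := by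
  set θ := diagonal (transposeSign (α := α) (β := β)) with hθ
  have hθθ : θ * θ = 1 := diagonal_transposeSign_mul_self
  have hθinv : θ⁻¹ = θ := Matrix.inv_eq_right_inv hθθ
  have hw : ∀ ξ, gaussianWigner (fun q => transposeSign q * d q) (transposeCov γ) ξ =
      gaussianWigner d γ (θ *ᵥ ξ) := fun ξ => by
    have h1 : (transposeCov γ)⁻¹ = θ * γ⁻¹ * θ := by
      rw [transposeCov, Matrix.mul_inv_rev, Matrix.mul_inv_rev, ← hθ, hθinv, Matrix.mul_assoc]
    have h2 : (transposeCov γ).det = γ.det := by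
      rw [transposeCov, det_mul, det_mul, ← hθ, mul_right_comm, ← det_mul, hθθ, det_one, one_mul]
    have h3 : ξ - (fun q => transposeSign q * d q) = θ *ᵥ (θ *ᵥ ξ - d) := by
      rw [mulVec_sub, mulVec_mulVec, hθθ, one_mulVec]
      congr 1
      funext q
      rw [hθ, mulVec_diagonal]
    have h4 : ∀ v, (θ *ᵥ v) ⬝ᵥ (θ * γ⁻¹ * θ) *ᵥ (θ *ᵥ v) = v ⬝ᵥ γ⁻¹ *ᵥ v := fun v => by
      rw [mulVec_mulVec, Matrix.mul_assoc, hθθ, Matrix.mul_one, ← mulVec_mulVec,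
        dotProduct_mulVec, ← mulVec_transpose, mulVec_mulVec, hθ, diagonal_transpose, ← hθ, hθθ,
        one_mulVec]
    unfold gaussianWigner
    rw [h1, h2, h3, h4]
  set s : α ⊕ β → ℝ := Sum.elim (fun _ => -1) (fun _ => 1) with hs
  have hphase : ∀ r p : α ⊕ β → ℝ, θ *ᵥ phasePoint r p = phasePoint r (diagonal s *ᵥ p) :=
    fun r p => by
      funext q
      rw [hθ, mulVec_diagonal]
      obtain ⟨i, j⟩ := q
      fin_cases j
      · simp [transposeSign, phasePoint]
      · simp [transposeSign, phasePoint, mulVec_diagonal, hs]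
  have hss : diagonal s * diagonal s = 1 := by
    rw [diagonal_mul_diagonal, ← diagonal_one]
    congr 1
    funext i
    rcases i with i | i <;> simp [hs]
  have hdet : |(diagonal s).det| = 1 := by
    have h1 : (diagonal s).det * (diagonal s).det = 1 := by rw [← det_mul, hss, det_one]
    have h2 : |(diagonal s).det| * |(diagonal s).det| = 1 := by rw [← abs_mul, h1, abs_one]
    nlinarith [abs_nonneg (diagonal s).det]
  have hdet0 : (diagonal s).det ≠ 0 := fun h => by simp [h] at hdet
  have hsum : join (Equiv.refl (α ⊕ β)) x y + join (Equiv.refl _) x' y' =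
      join (Equiv.refl _) x' y + join (Equiv.refl _) x y' := by
    rw [join_add, join_add, add_comm x x']
  have hdiff : join (Equiv.refl (α ⊕ β)) x y - join (Equiv.refl _) x' y' =
      diagonal s *ᵥ (join (Equiv.refl _) x' y - join (Equiv.refl _) x y') := by
    rw [join_sub, join_sub]
    funext i
    rw [mulVec_diagonal]
    rcases i with i | i <;> simp [join, hs]
  have hdot : ∀ p v : α ⊕ β → ℝ, p ⬝ᵥ diagonal s *ᵥ v = (diagonal s *ᵥ p) ⬝ᵥ v := fun p v => by
    rw [dotProduct_mulVec, ← mulVec_transpose, diagonal_transpose]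
  unfold wignerKernel
  simp_rw [hw, hsum, hdiff, hphase, hdot]
  have hcont : Continuous fun p : α ⊕ β → ℝ =>
      (gaussianWigner d γ (phasePoint ((2 : ℝ)⁻¹ • (join (Equiv.refl _) x' y +
        join (Equiv.refl _) x y')) p) : ℂ) * Complex.exp (Complex.I *
        ((p ⬝ᵥ (join (Equiv.refl _) x' y - join (Equiv.refl _) x y') : ℝ) : ℂ)) := by
    have h1 : Continuous fun p : α ⊕ β → ℝ => phasePoint ((2 : ℝ)⁻¹ •
        (join (Equiv.refl _) x' y + join (Equiv.refl _) x y')) p := by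
      refine continuous_pi fun q => ?_
      obtain ⟨i, j⟩ := q
      fin_cases j
      · exact continuous_const
      · exact continuous_apply i
    have h2 := (continuous_gaussianWigner d γ).comp h1
    have h3 : Continuous fun p : α ⊕ β → ℝ =>
        p ⬝ᵥ (join (Equiv.refl _) x' y - join (Equiv.refl _) x y') := by
      unfold dotProduct
      fun_prop
    simp only [Function.comp_def] at h2
    fun_prop
  rw [integral_comp_mulVec hdet0 hcont, hdet, Complex.ofReal_one, one_mul]

/-- A Gaussian state violating the criterion on the covariance matrix is NPT. -/
theorem isNPT_of_not_posSemidef {ρ : L2 (α ⊕ β) →L[ℂ] L2 (α ⊕ β)} {d : (α ⊕ β) × Fin 2 → ℝ}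
    {γ : Matrix ((α ⊕ β) × Fin 2) ((α ⊕ β) × Fin 2) ℝ} (hρ : IsGaussianState ρ d γ)
    (h : ¬ (plusI γ (partialOmega α β)).PosSemidef) : IsNPT ρ := by
  obtain ⟨-, hγ, hk⟩ := hρ
  have hγ' := posDef_transposeCov hγ
  obtain ⟨ε, -, hdom⟩ := exists_isDominatedKernel_gaussianWigner hγ
  obtain ⟨ε', -, hdom'⟩ := exists_isDominatedKernel_gaussianWigner hγ'
  obtain ⟨T, hT⟩ := exists_isKernelOperator_gaussianWigner hγ' fun q => transposeSign q * d q
  refine ⟨T, isPartialTranspose_of_isKernelOperator (hdom d) (hdom' _) hk hT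
    fun x x' y y' => wignerKernel_transposeCov d x x' y y', ?_⟩
  refine exists_neg_eigenvalue_of_isCompactOperator ((hdom' _).isCompactOperator hT)
    ((hdom' _).isSelfAdjoint hT (wignerKernel_gaussianWigner_conj hγ' _)) fun hpos => h ?_
  exact plusI_transposeCov_posSemidef (plusI_Omega_posSemidef_of_isPositive hγ' hT hpos)

end partialTranspose

/-! ### Conditioning of Gaussian kernels -/

section conditioning

open Matrix

theorem integrable_gaussianWigner_phasePoint {ι : Type} [Fintype ι] [DecidableEq ι]
    {γ : Matrix (ι × Fin 2) (ι × Fin 2) ℝ} (hγ : γ.PosDef) (d : ι × Fin 2 → ℝ) (r : ι → ℝ) :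
    Integrable fun p => gaussianWigner d γ (phasePoint r p) := by
  set x₀ : ι → ℝ := fun i => d (i, 0) with hx₀
  set p₀ : ι → ℝ := fun i => d (i, 1) with hp₀
  have hd : d = join (phaseEquiv ι) x₀ p₀ := by
    rw [← phasePoint_eq_join, phasePoint_self]
  unfold gaussianWigner
  refine Integrable.div_const ?_ _
  have h := (((integrable_exp_neg_quadratic (posDef_condCov (phaseEquiv ι) hγ).inv).comp_sub_right
    (p₀ + regr (phaseEquiv ι) γ *ᵥ (r - x₀))).const_mul
      (Real.exp (-((r - x₀) ⬝ᵥ (margCov (phaseEquiv ι) γ)⁻¹ *ᵥ (r - x₀)))))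
  refine h.congr (Filter.Eventually.of_forall fun p => ?_)
  simp only
  rw [phasePoint_eq_join, hd, join_sub, join_inv_quadratic _ hγ, ← sub_sub, neg_add, Real.exp_add]

variable {α β ι : Type} [Fintype α] [Fintype β] [Fintype ι] [DecidableEq α] [DecidableEq β]
  [DecidableEq ι] (e : α ⊕ β ≃ ι) {γ : Matrix (ι × Fin 2) (ι × Fin 2) ℝ}

/-- The mean of the second party conditional on the phase-space point `ξ` of the first. -/
def condMean (e : α ⊕ β ≃ ι) (γ : Matrix (ι × Fin 2) (ι × Fin 2) ℝ) (dA : α × Fin 2 → ℝ)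
    (dB : β × Fin 2 → ℝ) (ξ : α × Fin 2 → ℝ) : β × Fin 2 → ℝ :=
  dB + regr (modeEquiv e) γ *ᵥ (ξ - dA)

theorem continuous_condMean (dA : α × Fin 2 → ℝ) (dB : β × Fin 2 → ℝ) :
    Continuous (condMean e γ dA dB) := by
  unfold condMean mulVec dotProduct
  fun_prop

/-- The integral kernel of the second party conditional on the phase-space point of the first. -/
def condKernel (e : α ⊕ β ≃ ι) (γ : Matrix (ι × Fin 2) (ι × Fin 2) ℝ) (dA : α × Fin 2 → ℝ)
    (dB : β × Fin 2 → ℝ) (ξ : α × Fin 2 → ℝ) : (β → ℝ) → (β → ℝ) → ℂ :=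
  wignerKernel (gaussianWigner (condMean e γ dA dB ξ) (condCov (modeEquiv e) γ))

theorem continuous_condKernel (hγ : γ.PosDef) (dA : α × Fin 2 → ℝ) (dB : β × Fin 2 → ℝ) :
    Continuous fun z : (α × Fin 2 → ℝ) × (β → ℝ) × (β → ℝ) =>
      condKernel e γ dA dB z.1 z.2.1 z.2.2 := by
  have h1 := continuous_wignerKernel_gaussianWigner (posDef_condCov (modeEquiv e) hγ)
  have h2 : Continuous fun z : (α × Fin 2 → ℝ) × (β → ℝ) × (β → ℝ) =>
      (condMean e γ dA dB z.1, z.2) :=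
    ((continuous_condMean e dA dB).comp continuous_fst).prodMk continuous_snd
  have h3 := h1.comp h2
  simp only [Function.comp_def] at h3
  exact h3

theorem exists_isDominatedKernel_condKernel (hγ : γ.PosDef) (dA : α × Fin 2 → ℝ)
    (dB : β × Fin 2 → ℝ) : ∃ ε > 0, ∃ C, ∀ ξ, IsDominatedKernel volume (condKernel e γ dA dB ξ)
      (gaussBound ε C fun i => condMean e γ dA dB ξ (i, 0)) := by
  obtain ⟨ε, hε, h⟩ := exists_isDominatedKernel_gaussianWigner (posDef_condCov (modeEquiv e) hγ)
  exact ⟨ε, hε, _, fun ξ => h _⟩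

theorem gaussBound_nonneg {κ : Type} [Fintype κ] (ε C : ℝ) (x₀ x : κ → ℝ) :
    0 ≤ gaussBound ε C x₀ x := by
  unfold gaussBound
  positivity

theorem gaussBound_le {κ : Type} [Fintype κ] {ε : ℝ} (hε : 0 < ε) (C : ℝ) (x₀ x : κ → ℝ) :
    gaussBound ε C x₀ x ≤ √C := by
  have hnn : 0 ≤ (x - x₀) ⬝ᵥ (x - x₀) := Finset.sum_nonneg fun i _ => mul_self_nonneg _
  unfold gaussBound
  refine mul_le_of_le_one_right (Real.sqrt_nonneg _) (Real.exp_le_one_iff.2 ?_)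
  have := mul_nonneg hε.le hnn
  linarith

theorem gaussBound_join (ε C : ℝ) (x₀ x : α → ℝ) (y₀ y : β → ℝ) :
    gaussBound ε C (join e x₀ y₀) (join e x y) = gaussBound ε C x₀ x * gaussBound ε 1 y₀ y := by
  unfold gaussBound
  rw [join_sub, join_dotProduct, mul_add, neg_add, Real.exp_add, Real.sqrt_one]
  ring

/-- Fubini over the momenta of the two parties: by `gaussianWigner_join` the inner integral is the
kernel of the conditional state, weighted by the marginal density. -/
theorem wignerKernel_join (hγ : γ.PosDef) (dA : α × Fin 2 → ℝ) (dB : β × Fin 2 → ℝ)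
    (x x' : α → ℝ) (y y' : β → ℝ) :
    wignerKernel (gaussianWigner (join (modeEquiv e) dA dB) γ) (join e x y) (join e x' y') =
      ∫ p : α → ℝ, Complex.exp (Complex.I * ((p ⬝ᵥ (x - x') : ℝ) : ℂ)) *
        (gaussianWigner dA (margCov (modeEquiv e) γ) (phasePoint ((2 : ℝ)⁻¹ • (x + x')) p) *
          condKernel e γ dA dB (phasePoint ((2 : ℝ)⁻¹ • (x + x')) p) y y') := by
  have hint : Integrable fun q : ι → ℝ =>
      (gaussianWigner (join (modeEquiv e) dA dB) γ
        (phasePoint ((2 : ℝ)⁻¹ • (join e x y + join e x' y')) q) : ℂ) *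
      Complex.exp (Complex.I * ((q ⬝ᵥ (join e x y - join e x' y') : ℝ) : ℂ)) := by
    refine (integrable_gaussianWigner_phasePoint hγ _ _).ofReal.mul_bdd (c := 1) ?_ ?_
    · have : Continuous fun q : ι → ℝ =>
          Complex.exp (Complex.I * ((q ⬝ᵥ (join e x y - join e x' y') : ℝ) : ℂ)) := by
        unfold dotProduct
        fun_prop
      exact this.aestronglyMeasurable
    · refine Filter.Eventually.of_forall fun q => ?_
      rw [mul_comm, Complex.norm_exp_ofReal_mul_I]
  rw [wignerKernel, ← integral_join e, integral_prod _ ((integrable_join_iff e).2 hint)]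
  refine integral_congr_ae (Filter.Eventually.of_forall fun p => ?_)
  simp only
  rw [condKernel, wignerKernel, ← integral_const_mul, ← integral_const_mul]
  refine integral_congr_ae (Filter.Eventually.of_forall fun p' => ?_)
  simp only
  rw [join_add, join_smul, join_sub, phasePoint_join, join_dotProduct, gaussianWigner_join e hγ,
    Complex.ofReal_add, mul_add, Complex.exp_add, condMean]
  push_cast
  ring

/-- The left side is the kernel of the partial trace over `A` of `ρ` against a Weyl operator. It
equals the Fourier transform in `ξ_A` of the Wigner function, since Weyl expectations are the
characteristic function of a Wigner function. -/
theorem integral_wignerKernel_join (hγ : γ.PosDef) (dA : α × Fin 2 → ℝ) (dB : β × Fin 2 → ℝ)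
    (u v : α → ℝ) (y y' : β → ℝ) :
    ∫ x, Complex.exp (Complex.I * ((u ⬝ᵥ x + (u ⬝ᵥ v) / 2 : ℝ) : ℂ)) *
      wignerKernel (gaussianWigner (join (modeEquiv e) dA dB) γ) (join e (x + v) y) (join e x y') =
    ∫ ξ, Complex.exp (Complex.I * ((phasePoint u v ⬝ᵥ ξ : ℝ) : ℂ)) *
      (gaussianWigner dA (margCov (modeEquiv e) γ) ξ * condKernel e γ dA dB ξ y y') := by
  obtain ⟨ε, hε, C, hdom⟩ := exists_isDominatedKernel_condKernel e hγ dA dB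
  have hint : Integrable fun ξ => Complex.exp (Complex.I * ((phasePoint u v ⬝ᵥ ξ : ℝ) : ℂ)) *
      (gaussianWigner dA (margCov (modeEquiv e) γ) ξ * condKernel e γ dA dB ξ y y') := by
    refine Integrable.bdd_mul (c := 1) ?_ ?_ ?_
    · refine (integrable_gaussianWigner (posDef_margCov _ hγ) dA).ofReal.mul_bdd (c := √C * √C) ?_ ?_
      · have h1 : Continuous fun ξ : α × Fin 2 → ℝ => (ξ, (y, y')) := by fun_prop
        exact ((continuous_condKernel e hγ dA dB).comp h1).aestronglyMeasurable
      · refine Filter.Eventually.of_forall fun ξ => ((hdom ξ).norm_le y y').trans ?_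
        exact mul_le_mul (gaussBound_le hε _ _ _) (gaussBound_le hε _ _ _)
          (gaussBound_nonneg _ _ _ _) (Real.sqrt_nonneg _)
    · have : Continuous fun ξ : α × Fin 2 → ℝ =>
          Complex.exp (Complex.I * ((phasePoint u v ⬝ᵥ ξ : ℝ) : ℂ)) := by
        unfold dotProduct
        fun_prop
      exact this.aestronglyMeasurable
    · refine Filter.Eventually.of_forall fun ξ => ?_
      rw [mul_comm, Complex.norm_exp_ofReal_mul_I]
  -- Shifting `x` by `-v/2` makes the midpoint of `x + v` and `x` equal to the new `x` and absorbs
  -- the phase `u·v/2`.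
  rw [← integral_join (phaseEquiv α), integral_prod _ ((integrable_join_iff _).2 hint),
    ← integral_add_right_eq_self _ (-((2 : ℝ)⁻¹ • v))]
  refine integral_congr_ae (Filter.Eventually.of_forall fun x => ?_)
  simp only
  rw [wignerKernel_join e hγ, ← integral_const_mul]
  refine integral_congr_ae (Filter.Eventually.of_forall fun p => ?_)
  simp only
  have h1 : (2 : ℝ)⁻¹ • (x + -((2 : ℝ)⁻¹ • v) + v + (x + -((2 : ℝ)⁻¹ • v))) = x := by
    funext i
    simp only [Pi.add_apply, Pi.smul_apply, Pi.neg_apply, smul_eq_mul]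
    ring
  have h2 : x + -((2 : ℝ)⁻¹ • v) + v - (x + -((2 : ℝ)⁻¹ • v)) = v := by abel
  rw [h1, h2, ← mul_assoc, ← Complex.exp_add, ← mul_add, ← Complex.ofReal_add,
    ← phasePoint_eq_join, phasePoint_eq_join u, phasePoint_eq_join _ p, join_dotProduct]
  congr 4
  rw [dotProduct_add, dotProduct_neg, dotProduct_smul, smul_eq_mul, dotProduct_comm p v]
  ring

end conditioning

/-! ### Partial scalar products -/

section partialVector

variable {α β ι : Type} [Fintype α] [Fintype β] [Fintype ι] (e : α ⊕ β ≃ ι)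

/-- The partial scalar product of `ψ` with the vector `φ` of the second party. -/
def partialVector (φ : L2 β) (ψ : (ι → ℝ) → ℂ) (x : α → ℝ) : ℂ :=
  ∫ y, (starRingEnd ℂ) (φ y) * ψ (join e x y)

/-- The partial expectation in `φ` of a kernel. -/
def partialKernel (φ : L2 β) (K : (ι → ℝ) → (ι → ℝ) → ℂ) (x x' : α → ℝ) : ℂ :=
  ∫ z : (β → ℝ) × (β → ℝ), (starRingEnd ℂ) (φ z.1) * (K (join e x z.1) (join e x' z.2) * φ z.2)
    ∂((volume : Measure (β → ℝ)).prod volume)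

theorem stronglyMeasurable_conj {X : Type*} [MeasurableSpace X] {ν : Measure X} (φ : Lp ℂ 2 ν) :
    StronglyMeasurable fun y => (starRingEnd ℂ) (φ y) :=
  Complex.continuous_conj.comp_stronglyMeasurable (Lp.stronglyMeasurable φ)

variable {e} {φ : L2 β} {a : (α → ℝ) → ℝ} {b : (β → ℝ) → ℝ} {ψ : (ι → ℝ) → ℂ}

theorem stronglyMeasurable_partialVector (hψ : StronglyMeasurable ψ) :
    StronglyMeasurable (partialVector e φ ψ) := by
  have h : StronglyMeasurable (Function.uncurry fun (x : α → ℝ) (y : β → ℝ) =>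
      (starRingEnd ℂ) (φ y) * ψ (join e x y)) :=
    ((stronglyMeasurable_conj φ).comp_measurable measurable_snd).mul
      (hψ.comp_measurable (measurable_join e))
  exact h.integral_prod_right

theorem integrable_partialVector (hψ : StronglyMeasurable ψ) (hb : MemLp b 2)
    (hle : ∀ x y, ‖ψ (join e x y)‖ ≤ a x * b y) (x : α → ℝ) :
    Integrable fun y => (starRingEnd ℂ) (φ y) * ψ (join e x y) := by
  refine ((integrable_mul_norm hb (Lp.memLp φ)).const_mul (a x)).mono' ?_
    (Filter.Eventually.of_forall fun y => ?_)
  · exact ((stronglyMeasurable_conj φ).mul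
      (hψ.comp_measurable ((measurable_join e).comp measurable_prodMk_left))).aestronglyMeasurable
  · rw [norm_mul, RCLike.norm_conj, ← mul_assoc, mul_comm]
    gcongr
    exact hle x y

theorem norm_partialVector_le (hb : MemLp b 2)
    (hle : ∀ x y, ‖ψ (join e x y)‖ ≤ a x * b y) (x : α → ℝ) :
    ‖partialVector e φ ψ x‖ ≤ (∫ y, b y * ‖φ y‖) * a x := by
  rw [mul_comm, ← integral_const_mul]
  refine norm_integral_le_of_norm_le ((integrable_mul_norm hb (Lp.memLp φ)).const_mul (a x))
    (Filter.Eventually.of_forall fun y => ?_)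
  rw [norm_mul, RCLike.norm_conj, ← mul_assoc, mul_comm]
  gcongr
  exact hle x y

theorem memLp_partialVector (hψ : StronglyMeasurable ψ) (ha : MemLp a 2) (ha0 : ∀ x, 0 ≤ a x)
    (hb : MemLp b 2) (hle : ∀ x y, ‖ψ (join e x y)‖ ≤ a x * b y) :
    MemLp (partialVector e φ ψ) 2 := by
  refine MemLp.of_le_mul (c := ∫ y, b y * ‖φ y‖) ha
    (stronglyMeasurable_partialVector hψ).aestronglyMeasurable
    (Filter.Eventually.of_forall fun x => ?_)
  rw [Real.norm_of_nonneg (ha0 x)]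
  exact norm_partialVector_le hb hle x

theorem inner_tensor_eq {τ : L2 α → L2 β → L2 ι} (hτ : IsTensor e τ)
    (hψ2 : MemLp ψ 2) (hr : MemLp (partialVector e φ ψ) 2) (f : L2 α) :
    ⟪τ f φ, hψ2.toLp ψ⟫_ℂ = ⟪f, hr.toLp _⟫_ℂ := by
  have hint : Integrable fun z => (starRingEnd ℂ) (τ f φ z) * ψ z := by
    have h := (Lp.memLp (τ f φ)).star.integrable_mul hψ2
    exact h
  rw [inner_eq_integral, inner_eq_integral]
  calc ∫ z, (starRingEnd ℂ) (τ f φ z) * hψ2.toLp ψ z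
      = ∫ z, (starRingEnd ℂ) (τ f φ z) * ψ z := by
        refine integral_congr_ae ?_
        filter_upwards [hψ2.coeFn_toLp] with z hz
        rw [hz]
    _ = ∫ z : (α → ℝ) × (β → ℝ), (starRingEnd ℂ) (f z.1 * φ z.2) * ψ (join e z.1 z.2)
          ∂((volume : Measure (α → ℝ)).prod volume) := by
        rw [← integral_join e]
        refine integral_congr_ae ?_
        filter_upwards [hτ.ae_join f φ] with z hz
        rw [hz]
    _ = ∫ x, ∫ y, (starRingEnd ℂ) (f x * φ y) * ψ (join e x y) := by
        refine integral_prod _ (((integrable_join_iff e).2 hint).congr ?_)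
        filter_upwards [hτ.ae_join f φ] with z hz
        rw [hz]
    _ = ∫ x, (starRingEnd ℂ) (f x) * hr.toLp _ x := by
        refine integral_congr_ae ?_
        filter_upwards [hr.coeFn_toLp] with x hx
        rw [hx, partialVector, ← integral_const_mul]
        simp only [map_mul, mul_assoc]

/-! ### Partial scalar products along a rank one decomposition -/

section kernel

variable {I : Type} [Countable I] {Ψ : I → (ι → ℝ) → ℂ} {K : (ι → ℝ) → (ι → ℝ) → ℂ}

/-- Each `|Ψ_s(z)|²` is a term of a nonnegative series with sum `K(z, z)`. -/
theorem norm_le_of_hasSum (hs : ∀ z z', HasSum (fun s => Ψ s z * (starRingEnd ℂ) (Ψ s z')) (K z z'))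
    (ha0 : ∀ x, 0 ≤ a x) (hb0 : ∀ y, 0 ≤ b y)
    (hK : ∀ x y x' y', ‖K (join e x y) (join e x' y')‖ ≤ (a x * b y) * (a x' * b y'))
    (s : I) (x : α → ℝ) (y : β → ℝ) : ‖Ψ s (join e x y)‖ ≤ a x * b y := by
  set z := join e x y with hz
  have h1 : HasSum (fun s => ‖Ψ s z‖ ^ 2) (K z z).re := by
    refine (Complex.hasSum_re (hs z z)).congr_fun fun s => ?_
    rw [Complex.mul_conj, Complex.normSq_eq_norm_sq, Complex.ofReal_re]
  have h2 := le_hasSum h1 s fun _ _ => by positivity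
  have h3 := (h2.trans (Complex.re_le_norm _)).trans (hK x y x y)
  rw [← sq] at h3
  exact le_of_sq_le_sq h3 (mul_nonneg (ha0 x) (hb0 y))

/-- The maps `l`, `l'` and the weight `c` cover both the diagonal, for traces, and the pair `(x + v,
x)` with a phase, for Weyl operators. -/
theorem integrable_partialKernel (hKm : StronglyMeasurable (Function.uncurry K)) (hb : MemLp b 2)
    (hK : ∀ x y x' y', ‖K (join e x y) (join e x' y')‖ ≤ (a x * b y) * (a x' * b y'))
    {X : Type} [MeasurableSpace X] {ν : Measure X} [SFinite ν] {c : X → ℂ}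
    (hc : StronglyMeasurable c) (hc1 : ∀ x, ‖c x‖ ≤ 1) {l l' : X → α → ℝ} (hl : Measurable l)
    (hl' : Measurable l') (hll : Integrable (fun x => a (l x) * a (l' x)) ν) :
    Integrable (Function.uncurry fun (x : X) (z : (β → ℝ) × (β → ℝ)) => c x *
      ((starRingEnd ℂ) (φ z.1) * (K (join e (l x) z.1) (join e (l' x) z.2) * φ z.2)))
      (ν.prod ((volume : Measure (β → ℝ)).prod volume)) := by
  have hbφ := integrable_mul_norm hb (Lp.memLp φ)
  refine (hll.mul_prod (hbφ.mul_prod hbφ)).mono' ?_ (Filter.Eventually.of_forall fun w => ?_)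
  · refine ((hc.comp_measurable measurable_fst).mul
      (((stronglyMeasurable_conj φ).comp_measurable (measurable_fst.comp measurable_snd)).mul
      ((hKm.comp_measurable (Measurable.prodMk ((measurable_join e).comp
        ((hl.comp measurable_fst).prodMk (measurable_fst.comp measurable_snd)))
        ((measurable_join e).comp
        ((hl'.comp measurable_fst).prodMk (measurable_snd.comp measurable_snd))))).mul
      ((Lp.stronglyMeasurable φ).comp_measurable
        (measurable_snd.comp measurable_snd))))).aestronglyMeasurable
  · simp only [Function.uncurry]
    rw [norm_mul, norm_mul, norm_mul, RCLike.norm_conj]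
    have h1 := hK (l w.1) w.2.1 (l' w.1) w.2.2
    have h2 := hc1 w.1
    calc _ ≤ 1 * (‖φ w.2.1‖ * ((a (l w.1) * b w.2.1) * (a (l' w.1) * b w.2.2) * ‖φ w.2.2‖)) := by
          gcongr
      _ = _ := by ring

/-- The slices `Ψ_s(x, ·)` have square summable norms, because `∑ |Ψ_s(x, y)|²` is the diagonal of
`K`. Cauchy–Schwarz then lets the sum be exchanged with the integral against `φ`, for every `x` and
not merely almost every one. -/
theorem hasSum_partialKernel (hΨ : ∀ s, StronglyMeasurable (Ψ s))
    (hs : ∀ z z', HasSum (fun s => Ψ s z * (starRingEnd ℂ) (Ψ s z')) (K z z'))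
    (hKm : StronglyMeasurable (Function.uncurry K))
    (hb : MemLp b 2) (ha0 : ∀ x, 0 ≤ a x) (hb0 : ∀ y, 0 ≤ b y)
    (hK : ∀ x y x' y', ‖K (join e x y) (join e x' y')‖ ≤ (a x * b y) * (a x' * b y'))
    (x x' : α → ℝ) :
    HasSum (fun s => partialVector e φ (Ψ s) x * (starRingEnd ℂ) (partialVector e φ (Ψ s) x'))
      (partialKernel e φ K x x') := by
  have hle := norm_le_of_hasSum hs ha0 hb0 hK
  have hsm : ∀ s x, StronglyMeasurable fun y => Ψ s (join e x y) := fun s x =>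
    (hΨ s).comp_measurable ((measurable_join e).comp measurable_prodMk_left)
  have hmem : ∀ s x, MemLp (fun y => Ψ s (join e x y)) 2 := fun s x => by
    refine MemLp.of_le_mul (c := a x) hb (hsm s x).aestronglyMeasurable
      (Filter.Eventually.of_forall fun y => ?_)
    rw [Real.norm_of_nonneg (hb0 y)]
    exact hle s x y
  have hsq : ∀ x, Summable fun s => ‖(hmem s x).toLp _‖ ^ 2 := fun x => by
    refine (hasSum_norm_sq_toLp (k := fun y => (K (join e x y) (join e x y)).re)
      (fun s => hmem s x) ?_ fun y => ?_).summable
    · refine ((hb.integrable_sq).const_mul (a x ^ 2)).mono' ?_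
        (Filter.Eventually.of_forall fun y => ?_)
      · have hm : Measurable fun y => (join e x y, join e x y) :=
          ((measurable_join e).comp measurable_prodMk_left).prodMk
            ((measurable_join e).comp measurable_prodMk_left)
        exact (Complex.continuous_re.comp_stronglyMeasurable
          (hKm.comp_measurable hm)).aestronglyMeasurable
      · rw [Real.norm_eq_abs]
        refine ((Complex.abs_re_le_norm _).trans (hK x y x y)).trans (le_of_eq ?_)
        ring
    · refine (Complex.hasSum_re (hs _ _)).congr_fun fun s => ?_
      rw [Complex.mul_conj, Complex.normSq_eq_norm_sq, Complex.ofReal_re]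
  have hA : ∀ s x, ∫ y, ‖(starRingEnd ℂ) (φ y) * Ψ s (join e x y)‖ ≤
      ‖φ‖ * ‖(hmem s x).toLp _‖ := fun s x => by
    have h := integral_mul_norm_le (Lp.memLp φ).norm ((hmem s x).toLp _)
    have h2 : ‖(Lp.memLp φ).norm.toLp _‖ = ‖φ‖ := by
      rw [Lp.norm_toLp, eLpNorm_norm, Lp.norm_def]
    rw [h2] at h
    refine le_trans (le_of_eq (integral_congr_ae ?_)) h
    filter_upwards [(hmem s x).coeFn_toLp] with y hy
    rw [hy, norm_mul, RCLike.norm_conj]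
  set F : I → (β → ℝ) × (β → ℝ) → ℂ := fun s z => ((starRingEnd ℂ) (φ z.1) * Ψ s (join e x z.1)) *
    (starRingEnd ℂ) ((starRingEnd ℂ) (φ z.2) * Ψ s (join e x' z.2)) with hF
  have hI : ∀ s x, Integrable fun y => (starRingEnd ℂ) (φ y) * Ψ s (join e x y) := fun s x =>
    integrable_partialVector (hΨ s) hb (hle s) x
  have hI' : ∀ s x, Integrable fun y =>
      (starRingEnd ℂ) ((starRingEnd ℂ) (φ y) * Ψ s (join e x y)) := fun s x => by
    have h := (hI s x).norm
    refine h.mono' (Complex.continuous_conj.comp_aestronglyMeasurable (hI s x).1)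
      (Filter.Eventually.of_forall fun y => ?_)
    rw [RCLike.norm_conj]
  have key := hasSum_integral_of_summable_integral_norm (F := F)
    (μ := (volume : Measure (β → ℝ)).prod volume) (fun s => (hI s x).mul_prod (hI' s x')) ?_
  · have hsum : ∫ z, ∑' s, F s z ∂((volume : Measure (β → ℝ)).prod volume) =
        partialKernel e φ K x x' := by
      refine integral_congr_ae (Filter.Eventually.of_forall fun z => HasSum.tsum_eq ?_)
      have h := (((hs (join e x z.1) (join e x' z.2)).mul_right (φ z.2)).mul_left
        ((starRingEnd ℂ) (φ z.1)))
      refine h.congr_fun fun s => ?_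
      simp only [hF, map_mul, Complex.conj_conj]
      ring
    rw [hsum] at key
    refine key.congr_fun fun s => ?_
    simp only [hF]
    rw [integral_prod_mul (fun y => (starRingEnd ℂ) (φ y) * Ψ s (join e x y))
      (fun y => (starRingEnd ℂ) ((starRingEnd ℂ) (φ y) * Ψ s (join e x' y))), integral_conj]
    rfl
  · refine Summable.of_nonneg_of_le (fun s => integral_nonneg fun _ => norm_nonneg _) (fun s => ?_)
      (((hsq x).add (hsq x')).mul_left (‖φ‖ ^ 2))
    simp only [hF, norm_mul (_ * _)]
    rw [integral_prod_mul (fun y => ‖(starRingEnd ℂ) (φ y) * Ψ s (join e x y)‖)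
        (fun y => ‖(starRingEnd ℂ) ((starRingEnd ℂ) (φ y) * Ψ s (join e x' y))‖)]
    simp only [RCLike.norm_conj]
    have h1 := hA s x
    have h2 := hA s x'
    have h3 : 0 ≤ ∫ y, ‖(starRingEnd ℂ) (φ y) * Ψ s (join e x' y)‖ :=
      integral_nonneg fun _ => norm_nonneg _
    refine (mul_le_mul h1 h2 h3 (by positivity)).trans ?_
    have h4 := sq_nonneg (‖(hmem s x).toLp _‖ - ‖(hmem s x').toLp _‖)
    have h5 : ‖φ‖ ^ 2 * (‖(hmem s x).toLp _‖ * ‖(hmem s x').toLp _‖) ≤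
        ‖φ‖ ^ 2 * (‖(hmem s x).toLp _‖ ^ 2 + ‖(hmem s x').toLp _‖ ^ 2) := by
      gcongr
      nlinarith [sq_nonneg ‖(hmem s x).toLp _‖, sq_nonneg ‖(hmem s x').toLp _‖]
    calc _ = _ := by ring
      _ ≤ _ := h5

theorem summable_norm_sq_partialVector (hΨ : ∀ s, StronglyMeasurable (Ψ s))
    (hs : ∀ z z', HasSum (fun s => Ψ s z * (starRingEnd ℂ) (Ψ s z')) (K z z'))
    (hKm : StronglyMeasurable (Function.uncurry K)) (ha : MemLp a 2)
    (hb : MemLp b 2) (ha0 : ∀ x, 0 ≤ a x) (hb0 : ∀ y, 0 ≤ b y)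
    (hK : ∀ x y x' y', ‖K (join e x y) (join e x' y')‖ ≤ (a x * b y) * (a x' * b y'))
    (hr : ∀ s, MemLp (partialVector e φ (Ψ s)) 2) :
    Summable fun s => ‖(hr s).toLp _‖ ^ 2 := by
  have hint := integrable_partialKernel (φ := φ) hKm hb hK (ν := volume) (c := fun _ => 1)
    stronglyMeasurable_const (by simp) measurable_id measurable_id
    (by simpa [← sq] using ha.integrable_sq)
  refine (hasSum_norm_sq_toLp (k := fun x => (partialKernel e φ K x x).re) hr ?_
    fun x => ?_).summable
  · have h := hint.integral_prod_left.re
    simpa [Function.uncurry, partialKernel] using h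
  · refine (Complex.hasSum_re (hasSum_partialKernel hΨ hs hKm hb ha0 hb0 hK x x)).congr_fun
      fun s => ?_
    rw [Complex.mul_conj, Complex.normSq_eq_norm_sq, Complex.ofReal_re]

/-- Both sides express the trace of the state against `W ⊗ |φ⟩⟨φ|`. The exchange is dominated by
`|r(x)|² + |r(x + v)|²`, whose integrals are summable in `s`. -/
theorem hasSum_weylExpectation (hΨ : ∀ s, StronglyMeasurable (Ψ s))
    (hs : ∀ z z', HasSum (fun s => Ψ s z * (starRingEnd ℂ) (Ψ s z')) (K z z'))
    (hKm : StronglyMeasurable (Function.uncurry K)) (ha : MemLp a 2)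
    (hb : MemLp b 2) (ha0 : ∀ x, 0 ≤ a x) (hb0 : ∀ y, 0 ≤ b y)
    (hK : ∀ x y x' y', ‖K (join e x y) (join e x' y')‖ ≤ (a x * b y) * (a x' * b y'))
    (hr : ∀ s, MemLp (partialVector e φ (Ψ s)) 2) (u v : α → ℝ) :
    HasSum (fun s => weylExpectation (phasePoint u v) ((hr s).toLp _))
      (∫ x, Complex.exp (Complex.I * ((u ⬝ᵥ x + (u ⬝ᵥ v) / 2 : ℝ) : ℂ)) *
        partialKernel e φ K (x + v) x) := by
  set E : (α → ℝ) → ℂ := fun x =>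
    Complex.exp (Complex.I * ((u ⬝ᵥ x + (u ⬝ᵥ v) / 2 : ℝ) : ℂ)) with hE
  have hEc : Continuous E := by
    rw [hE]
    unfold dotProduct
    fun_prop
  have hE1 : ∀ x, ‖E x‖ = 1 := fun x => by
    simp only [hE]
    rw [mul_comm, Complex.norm_exp_ofReal_mul_I]
  set r : I → (α → ℝ) → ℂ := fun s => partialVector e φ (Ψ s) with hrdef
  have hmp : MeasurePreserving (fun x : α → ℝ => x + v) volume volume :=
    measurePreserving_add_right volume v
  have hr' : ∀ s, MemLp (fun x => r s (x + v)) 2 := fun s => (hr s).comp_measurePreserving hmp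
  have hweyl : ∀ s, weylExpectation (phasePoint u v) ((hr s).toLp _) =
      ∫ x, (starRingEnd ℂ) (r s x) * E x * r s (x + v) := fun s => by
    refine integral_congr_ae ?_
    filter_upwards [(hr s).coeFn_toLp,
      hmp.quasiMeasurePreserving.ae ((hr s).coeFn_toLp)] with x h1 h2
    have h3 : (fun i => phasePoint u v (i, 1)) = v := rfl
    have h4 : (fun i => phasePoint u v (i, 0)) = u := rfl
    rw [h3, h4, h1, h2]
  simp_rw [hweyl]
  have hnorm : ∀ s x, ‖(starRingEnd ℂ) (r s x) * E x * r s (x + v)‖ ≤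
      (‖r s x‖ ^ 2 + ‖r s (x + v)‖ ^ 2) := fun s x => by
    rw [norm_mul, norm_mul, RCLike.norm_conj, hE1, mul_one]
    nlinarith [sq_nonneg (‖r s x‖ - ‖r s (x + v)‖), sq_nonneg ‖r s x‖, sq_nonneg ‖r s (x + v)‖]
  have hsqi : ∀ s, Integrable fun x => ‖r s x‖ ^ 2 := fun s =>
    (memLp_two_iff_integrable_sq_norm (hr s).1).1 (hr s)
  have hsqi' : ∀ s, Integrable fun x => ‖r s (x + v)‖ ^ 2 := fun s =>
    (memLp_two_iff_integrable_sq_norm (hr' s).1).1 (hr' s)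
  have hint : ∀ s, Integrable fun x => (starRingEnd ℂ) (r s x) * E x * r s (x + v) := fun s =>
    ((hsqi s).add (hsqi' s)).mono' (((Complex.continuous_conj.comp_aestronglyMeasurable
      (hr s).1).mul hEc.aestronglyMeasurable).mul (hr' s).1)
      (Filter.Eventually.of_forall (hnorm s))
  have key := hasSum_integral_of_summable_integral_norm hint ?_
  · have hsum : ∫ x, ∑' s, (starRingEnd ℂ) (r s x) * E x * r s (x + v) =
        ∫ x, E x * partialKernel e φ K (x + v) x := by
      refine integral_congr_ae (Filter.Eventually.of_forall fun x => HasSum.tsum_eq ?_)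
      have h := (hasSum_partialKernel (φ := φ) hΨ hs hKm hb ha0 hb0 hK (x + v) x).mul_left (E x)
      refine h.congr_fun fun s => ?_
      ring
    rw [hsum] at key
    exact key
  · have hsum := summable_norm_sq_partialVector hΨ hs hKm ha hb ha0 hb0 hK hr
    refine Summable.of_nonneg_of_le (fun s => integral_nonneg fun _ => norm_nonneg _) (fun s => ?_)
      (hsum.mul_left 2)
    refine (integral_mono (hint s).norm ((hsqi s).add (hsqi' s)) (hnorm s)).trans (le_of_eq ?_)
    simp only [Pi.add_apply]
    rw [integral_add (hsqi s) (hsqi' s),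
      integral_add_right_eq_self (fun x => ‖r s x‖ ^ 2) v, norm_sq_toLp, ← two_mul]

end kernel

end partialVector

/-! ### The characteristic function of the conditional states -/

section characteristic

open Matrix

variable {α β ι : Type} [Fintype α] [Fintype β] [Fintype ι] [DecidableEq α] [DecidableEq β]
  [DecidableEq ι] (e : α ⊕ β ≃ ι) {γ : Matrix (ι × Fin 2) (ι × Fin 2) ℝ}

theorem join_modeEquiv_apply (e : α ⊕ β ≃ ι) (dA : α × Fin 2 → ℝ) (dB : β × Fin 2 → ℝ)
    (j : Fin 2) : (fun i => join (modeEquiv e) dA dB (i, j)) =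
      join e (fun i => dA (i, j)) (fun i => dB (i, j)) := by
  funext k
  obtain ⟨s, rfl⟩ := e.surjective k
  rcases s with i | i
  · rw [join_inl, ← join_inl (modeEquiv e) dA dB (i, j), modeEquiv_inl]
  · rw [join_inr, ← join_inr (modeEquiv e) dA dB (i, j), modeEquiv_inr]

theorem exists_norm_wignerKernel_join_le (hγ : γ.PosDef) (dA : α × Fin 2 → ℝ)
    (dB : β × Fin 2 → ℝ) : ∃ (a : (α → ℝ) → ℝ) (b : (β → ℝ) → ℝ),
      MemLp a 2 ∧ MemLp b 2 ∧ (∀ x, 0 ≤ a x) ∧ (∀ y, 0 ≤ b y) ∧ ∀ x y x' y',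
        ‖wignerKernel (gaussianWigner (join (modeEquiv e) dA dB) γ) (join e x y) (join e x' y')‖ ≤
          (a x * b y) * (a x' * b y') := by
  obtain ⟨ε, hε, h⟩ := exists_isDominatedKernel_gaussianWigner hγ
  refine ⟨gaussBound ε (gaussConst γ) fun i => dA (i, 0), gaussBound ε 1 fun i => dB (i, 0),
    memLp_gaussBound hε _ _, memLp_gaussBound hε _ _, gaussBound_nonneg _ _ _,
    gaussBound_nonneg _ _ _, fun x y x' y' => ?_⟩
  rw [← gaussBound_join e, ← gaussBound_join e, ← join_modeEquiv_apply]
  exact (h _).norm_le _ _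

/-- The expectation in `φ` of the state of the second party conditional on `ξ`. -/
def condExpectation (e : α ⊕ β ≃ ι) (γ : Matrix (ι × Fin 2) (ι × Fin 2) ℝ) (dA : α × Fin 2 → ℝ)
    (dB : β × Fin 2 → ℝ) (φ : L2 β) (ξ : α × Fin 2 → ℝ) : ℂ :=
  ∫ z : (β → ℝ) × (β → ℝ), (starRingEnd ℂ) (φ z.1) * (condKernel e γ dA dB ξ z.1 z.2 * φ z.2)
    ∂((volume : Measure (β → ℝ)).prod volume)

theorem stronglyMeasurable_condExpectation_integrand (hγ : γ.PosDef) (dA : α × Fin 2 → ℝ)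
    (dB : β × Fin 2 → ℝ) (φ : L2 β) :
    StronglyMeasurable (Function.uncurry fun (ξ : α × Fin 2 → ℝ) (z : (β → ℝ) × (β → ℝ)) =>
      (starRingEnd ℂ) (φ z.1) * (condKernel e γ dA dB ξ z.1 z.2 * φ z.2)) :=
  ((stronglyMeasurable_conj φ).comp_measurable (measurable_fst.comp measurable_snd)).mul
    ((continuous_condKernel e hγ dA dB).stronglyMeasurable.mul
      ((Lp.stronglyMeasurable φ).comp_measurable (measurable_snd.comp measurable_snd)))

theorem stronglyMeasurable_condExpectation (hγ : γ.PosDef) (dA : α × Fin 2 → ℝ)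
    (dB : β × Fin 2 → ℝ) (φ : L2 β) : StronglyMeasurable (condExpectation e γ dA dB φ) :=
  (stronglyMeasurable_condExpectation_integrand e hγ dA dB φ).integral_prod_right

/-- The point `ξ` merely translates the Gaussian dominating the conditional kernel, so its `L²` norm
and the resulting bound do not depend on `ξ`. -/
theorem exists_integral_norm_condExpectation_le (hγ : γ.PosDef) (dA : α × Fin 2 → ℝ)
    (dB : β × Fin 2 → ℝ) (φ : L2 β) : ∃ M, ∀ ξ,
      ∫ z : (β → ℝ) × (β → ℝ), ‖(starRingEnd ℂ) (φ z.1) * (condKernel e γ dA dB ξ z.1 z.2 * φ z.2)‖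
        ∂((volume : Measure (β → ℝ)).prod volume) ≤ M := by
  obtain ⟨ε, hε, C, hdom⟩ := exists_isDominatedKernel_condKernel e hγ dA dB
  set N := ‖(memLp_gaussBound hε C (0 : β → ℝ)).toLp _‖ * ‖φ‖ with hN
  refine ⟨N * N, fun ξ => ?_⟩
  set x₀ : β → ℝ := fun i => condMean e γ dA dB ξ (i, 0) with hx₀
  have hb := memLp_gaussBound (ι := β) hε C x₀
  have hnorm : ‖hb.toLp _‖ = ‖(memLp_gaussBound hε C (0 : β → ℝ)).toLp _‖ := by
    rw [Lp.norm_toLp, Lp.norm_toLp]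
    congr 1
    have h := eLpNorm_comp_measurePreserving (p := 2)
      (memLp_gaussBound hε C (0 : β → ℝ)).1 (measurePreserving_sub_right volume x₀)
    rw [← h]
    congr 1
    funext x
    simp [gaussBound]
  have h1 : ∫ y, gaussBound ε C x₀ y * ‖φ y‖ ≤ N := by
    rw [hN, ← hnorm]
    exact integral_mul_norm_le hb φ
  have h0 : 0 ≤ ∫ y, gaussBound ε C x₀ y * ‖φ y‖ :=
    integral_nonneg fun y => mul_nonneg (gaussBound_nonneg _ _ _ _) (norm_nonneg _)
  have hbφ := integrable_mul_norm hb (Lp.memLp φ)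
  calc _ ≤ ∫ z : (β → ℝ) × (β → ℝ), (gaussBound ε C x₀ z.1 * ‖φ z.1‖) *
        (gaussBound ε C x₀ z.2 * ‖φ z.2‖) ∂((volume : Measure (β → ℝ)).prod volume) := by
        refine integral_mono ((hdom ξ).integrable_prod (Lp.memLp φ) (Lp.memLp φ)).norm
          (hbφ.mul_prod hbφ) fun z => ?_
        simp only
        rw [norm_mul, norm_mul, RCLike.norm_conj]
        have h := (hdom ξ).norm_le z.1 z.2
        calc _ ≤ ‖φ z.1‖ * ((gaussBound ε C x₀ z.1 * gaussBound ε C x₀ z.2) * ‖φ z.2‖) := by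
              gcongr
          _ = _ := by ring
    _ = (∫ y, gaussBound ε C x₀ y * ‖φ y‖) * ∫ y, gaussBound ε C x₀ y * ‖φ y‖ :=
        integral_prod_mul (fun y => gaussBound ε C x₀ y * ‖φ y‖)
          fun y => gaussBound ε C x₀ y * ‖φ y‖
    _ ≤ N * N := mul_le_mul h1 h1 h0 (h0.trans h1)

theorem continuous_cexp_dotProduct {κ : Type} [Fintype κ] (s : κ → ℝ) :
    Continuous fun x : κ → ℝ => Complex.exp (Complex.I * ((s ⬝ᵥ x : ℝ) : ℂ)) := by
  unfold dotProduct
  fun_prop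

/-- The bridge from quantum to classical: the Weyl expectations on `A` conditional on `φ` form the
Fourier transform of a density on phase space, the marginal density times the conditional
expectation. Fubini is applied on either side of `integral_wignerKernel_join`. -/
theorem integral_partialKernel_eq (hγ : γ.PosDef) (dA : α × Fin 2 → ℝ) (dB : β × Fin 2 → ℝ)
    (φ : L2 β) (u v : α → ℝ) :
    ∫ x, Complex.exp (Complex.I * ((u ⬝ᵥ x + (u ⬝ᵥ v) / 2 : ℝ) : ℂ)) * partialKernel e φ
      (wignerKernel (gaussianWigner (join (modeEquiv e) dA dB) γ)) (x + v) x =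
    ∫ ξ, Complex.exp (Complex.I * ((phasePoint u v ⬝ᵥ ξ : ℝ) : ℂ)) *
      (gaussianWigner dA (margCov (modeEquiv e) γ) ξ * condExpectation e γ dA dB φ ξ) := by
  obtain ⟨a, b, ha, hb, ha0, hb0, hK⟩ := exists_norm_wignerKernel_join_le e hγ dA dB
  obtain ⟨M, hM⟩ := exists_integral_norm_condExpectation_le e hγ dA dB φ
  obtain ⟨ε, hε, C, hdom⟩ := exists_isDominatedKernel_condKernel e hγ dA dB
  have hE : Continuous fun x : α → ℝ =>
      Complex.exp (Complex.I * ((u ⬝ᵥ x + (u ⬝ᵥ v) / 2 : ℝ) : ℂ)) := by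
    unfold dotProduct
    fun_prop
  have hint1 := integrable_partialKernel (φ := φ)
    (continuous_wignerKernel_uncurry hγ (join (modeEquiv e) dA dB)).stronglyMeasurable hb hK
    (ν := volume) hE.stronglyMeasurable
    (fun x => by rw [mul_comm Complex.I, Complex.norm_exp_ofReal_mul_I])
    (l := fun x => x + v) (l' := id) (by fun_prop) measurable_id
    ((ha.comp_measurePreserving (measurePreserving_add_right volume v)).integrable_mul ha)
  have hw := integrable_gaussianWigner (posDef_margCov (modeEquiv e) hγ) dA
  have hE' := continuous_cexp_dotProduct (phasePoint u v)
  have hnorm : ∀ (ξ : α × Fin 2 → ℝ) (c : ℂ),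
      ‖Complex.exp (Complex.I * ((phasePoint u v ⬝ᵥ ξ : ℝ) : ℂ)) *
      (gaussianWigner dA (margCov (modeEquiv e) γ) ξ * c)‖ =
      gaussianWigner dA (margCov (modeEquiv e) γ) ξ * ‖c‖ := fun ξ c => by
    rw [norm_mul, norm_mul, mul_comm Complex.I, Complex.norm_exp_ofReal_mul_I, one_mul,
      Complex.norm_real, Real.norm_of_nonneg (gaussianWigner_pos (posDef_margCov _ hγ) _ _).le]
  have hint2 : Integrable (Function.uncurry fun (ξ : α × Fin 2 → ℝ) (z : (β → ℝ) × (β → ℝ)) =>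
      Complex.exp (Complex.I * ((phasePoint u v ⬝ᵥ ξ : ℝ) : ℂ)) *
      (gaussianWigner dA (margCov (modeEquiv e) γ) ξ *
        ((starRingEnd ℂ) (φ z.1) * (condKernel e γ dA dB ξ z.1 z.2 * φ z.2))))
      ((volume : Measure (α × Fin 2 → ℝ)).prod ((volume : Measure (β → ℝ)).prod volume)) := by
    have hm : StronglyMeasurable (Function.uncurry fun (ξ : α × Fin 2 → ℝ)
        (z : (β → ℝ) × (β → ℝ)) => Complex.exp (Complex.I * ((phasePoint u v ⬝ᵥ ξ : ℝ) : ℂ)) *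
        (gaussianWigner dA (margCov (modeEquiv e) γ) ξ *
          ((starRingEnd ℂ) (φ z.1) * (condKernel e γ dA dB ξ z.1 z.2 * φ z.2)))) :=
      (hE'.stronglyMeasurable.comp_measurable measurable_fst).mul
        (((Complex.continuous_ofReal.comp (continuous_gaussianWigner _ _)).stronglyMeasurable
          |>.comp_measurable measurable_fst).mul
          (stronglyMeasurable_condExpectation_integrand e hγ dA dB φ))
    rw [integrable_prod_iff hm.aestronglyMeasurable]
    refine ⟨Filter.Eventually.of_forall fun ξ => ?_, ?_⟩
    · simp only [Function.uncurry]
      exact (((hdom ξ).integrable_prod (Lp.memLp φ) (Lp.memLp φ)).const_mul _).const_mul _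
    · refine (hw.mul_const M).mono' hm.norm.integral_prod_right.aestronglyMeasurable
        (Filter.Eventually.of_forall fun ξ => ?_)
      rw [Real.norm_of_nonneg (integral_nonneg fun _ => norm_nonneg _)]
      simp only [Function.uncurry, hnorm]
      rw [integral_const_mul]
      exact mul_le_mul_of_nonneg_left (hM ξ) (gaussianWigner_pos (posDef_margCov _ hγ) _ _).le
  calc _ = ∫ x, ∫ z : (β → ℝ) × (β → ℝ),
        Complex.exp (Complex.I * ((u ⬝ᵥ x + (u ⬝ᵥ v) / 2 : ℝ) : ℂ)) * ((starRingEnd ℂ) (φ z.1) *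
          (wignerKernel (gaussianWigner (join (modeEquiv e) dA dB) γ) (join e (x + v) z.1)
            (join e x z.2) * φ z.2)) ∂((volume : Measure (β → ℝ)).prod volume) := by
        simp only [partialKernel, ← integral_const_mul]
    _ = ∫ z : (β → ℝ) × (β → ℝ), (∫ x,
        Complex.exp (Complex.I * ((u ⬝ᵥ x + (u ⬝ᵥ v) / 2 : ℝ) : ℂ)) * ((starRingEnd ℂ) (φ z.1) *
          (wignerKernel (gaussianWigner (join (modeEquiv e) dA dB) γ) (join e (x + v) z.1)
            (join e x z.2) * φ z.2))) ∂((volume : Measure (β → ℝ)).prod volume) :=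
        integral_integral_swap hint1
    _ = ∫ z : (β → ℝ) × (β → ℝ), (∫ ξ,
        Complex.exp (Complex.I * ((phasePoint u v ⬝ᵥ ξ : ℝ) : ℂ)) *
        (gaussianWigner dA (margCov (modeEquiv e) γ) ξ *
        ((starRingEnd ℂ) (φ z.1) * (condKernel e γ dA dB ξ z.1 z.2 * φ z.2))))
          ∂((volume : Measure (β → ℝ)).prod volume) := by
        refine integral_congr_ae (Filter.Eventually.of_forall fun z => ?_)
        have h := congrArg (fun t => (starRingEnd ℂ) (φ z.1) * φ z.2 * t)
          (integral_wignerKernel_join e hγ dA dB u v z.1 z.2)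
        simp only [← integral_const_mul] at h
        refine Eq.trans (integral_congr_ae (Filter.Eventually.of_forall fun x => ?_))
          (h.trans (integral_congr_ae (Filter.Eventually.of_forall fun ξ => ?_)))
        · ring
        · ring
    _ = ∫ ξ, ∫ z : (β → ℝ) × (β → ℝ),
        Complex.exp (Complex.I * ((phasePoint u v ⬝ᵥ ξ : ℝ) : ℂ)) *
        (gaussianWigner dA (margCov (modeEquiv e) γ) ξ *
        ((starRingEnd ℂ) (φ z.1) * (condKernel e γ dA dB ξ z.1 z.2 * φ z.2)))
          ∂((volume : Measure (β → ℝ)).prod volume) := (integral_integral_swap hint2).symm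
    _ = _ := by
        simp only [condExpectation, ← integral_const_mul]

end characteristic

/-! ### Gaussian response functions -/

section response

open Matrix ProbabilityTheory

variable {k : ℕ} {κ : Type} [Fintype κ]

/-- The centred Gaussian distribution with covariance `L / 2`. -/
def gaussianNoise (L : Matrix (Fin k) (Fin k) ℝ) : Measure (Fin k → ℝ) :=
  (multivariateGaussian 0 ((2 : ℝ)⁻¹ • L)).map WithLp.ofLp

theorem measurable_ofLp : Measurable (WithLp.ofLp : EuclideanSpace ℝ (Fin k) → Fin k → ℝ) :=
  (PiLp.continuous_ofLp 2 _).measurable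

instance isProbabilityMeasure_gaussianNoise (L : Matrix (Fin k) (Fin k) ℝ) :
    IsProbabilityMeasure (gaussianNoise L) :=
  Measure.isProbabilityMeasure_map measurable_ofLp.aemeasurable

theorem integral_cexp_gaussianNoise {L : Matrix (Fin k) (Fin k) ℝ} (hL : L.PosSemidef)
    (s : Fin k → ℝ) :
    ∫ a, Complex.exp (Complex.I * ((s ⬝ᵥ a : ℝ) : ℂ)) ∂(gaussianNoise L) =
      Complex.exp (-((s ⬝ᵥ L *ᵥ s : ℝ) : ℂ) / 4) := by
  rw [gaussianNoise, integral_map measurable_ofLp.aemeasurable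
    (continuous_cexp_dotProduct s).aestronglyMeasurable]
  have h := charFun_multivariateGaussian (μ := 0)
    (hL.smul (show (0 : ℝ) ≤ 2⁻¹ by norm_num)) (WithLp.toLp 2 s)
  rw [charFun_apply] at h
  calc _ = ∫ x : EuclideanSpace ℝ (Fin k), Complex.exp ((⟪x, WithLp.toLp 2 s⟫_ℝ : ℂ) * Complex.I)
        ∂(multivariateGaussian 0 ((2 : ℝ)⁻¹ • L)) := by
        refine integral_congr_ae (Filter.Eventually.of_forall fun x => ?_)
        simp only
        rw [mul_comm, EuclideanSpace.inner_eq_star_dotProduct]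
        simp
    _ = _ := by
        rw [h]
        congr 1
        simp [smul_mulVec, dotProduct_smul]
        ring

/-- The outcome of a Gaussian measurement at the phase-space point `ξ`: the linear combinations
`ξᵀ K` of the quadratures, shifted by `c`, with noise of covariance `L / 2`. -/
def responseKernel (K : Matrix κ (Fin k) ℝ) (L : Matrix (Fin k) (Fin k) ℝ) (c : Fin k → ℝ) :
    Kernel (κ → ℝ) (Fin k → ℝ) :=
  (Kernel.id ×ₖ Kernel.const (κ → ℝ) (gaussianNoise L)).map fun z => z.2 + (z.1 ᵥ* K + c)

theorem measurable_response (K : Matrix κ (Fin k) ℝ) (c : Fin k → ℝ) :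
    Measurable fun z : (κ → ℝ) × (Fin k → ℝ) => z.2 + (z.1 ᵥ* K + c) := by
  have : Continuous fun z : (κ → ℝ) × (Fin k → ℝ) => z.2 + (z.1 ᵥ* K + c) := by
    unfold vecMul dotProduct
    fun_prop
  exact this.measurable

instance isMarkovKernel_responseKernel (K : Matrix κ (Fin k) ℝ) (L : Matrix (Fin k) (Fin k) ℝ)
    (c : Fin k → ℝ) : IsMarkovKernel (responseKernel K L c) :=
  Kernel.IsMarkovKernel.map _ (measurable_response K c)

/-- This is the characteristic function in `IsGaussianMeasurement` with `W(K s)` replaced by its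
classical symbol `exp(i K s · ξ)`, which is why the response reproduces the measurement after
averaging over `ξ`. -/
theorem integral_cexp_responseKernel (K : Matrix κ (Fin k) ℝ) {L : Matrix (Fin k) (Fin k) ℝ}
    (hL : L.PosSemidef) (c : Fin k → ℝ) (ξ : κ → ℝ) (s : Fin k → ℝ) :
    ∫ a, Complex.exp (Complex.I * ((s ⬝ᵥ a : ℝ) : ℂ)) ∂(responseKernel K L c ξ) =
      Complex.exp (Complex.I * ((K *ᵥ s ⬝ᵥ ξ : ℝ) : ℂ)) *
        Complex.exp (Complex.I * ((s ⬝ᵥ c : ℝ) : ℂ) - ((s ⬝ᵥ L *ᵥ s : ℝ) : ℂ) / 4) := by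
  have hc := continuous_cexp_dotProduct s
  rw [responseKernel, Kernel.map_apply _ (measurable_response K c), Kernel.prod_apply,
    Kernel.id_apply, Kernel.const_apply, Measure.dirac_prod,
    Measure.map_map (measurable_response K c) measurable_prodMk_left,
    integral_map ((measurable_response K c).comp measurable_prodMk_left).aemeasurable
      hc.aestronglyMeasurable]
  have hpt : ∀ a : Fin k → ℝ, Complex.exp (Complex.I * ((s ⬝ᵥ (a + (ξ ᵥ* K + c)) : ℝ) : ℂ)) =
      (Complex.exp (Complex.I * ((K *ᵥ s ⬝ᵥ ξ : ℝ) : ℂ)) *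
        Complex.exp (Complex.I * ((s ⬝ᵥ c : ℝ) : ℂ))) *
      Complex.exp (Complex.I * ((s ⬝ᵥ a : ℝ) : ℂ)) := fun a => by
    have h : s ⬝ᵥ ξ ᵥ* K = K *ᵥ s ⬝ᵥ ξ := by
      rw [dotProduct_comm, ← dotProduct_mulVec, dotProduct_comm]
    rw [← Complex.exp_add, ← Complex.exp_add, dotProduct_add, dotProduct_add, h]
    push_cast
    congr 1
    ring
  simp only [Function.comp_def, hpt]
  rw [integral_const_mul, integral_cexp_gaussianNoise hL, mul_assoc, ← Complex.exp_add]
  congr 2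
  ring

/-- Families of measures with the characteristic function of a mixture add up to the mixture. -/
theorem hasSum_real_of_charFun {Λ : Type} [MeasurableSpace Λ] {ν : Measure Λ} [IsFiniteMeasure ν]
    (P : Kernel Λ (Fin k → ℝ)) [IsMarkovKernel P] {I : Type} [Countable I]
    (m : I → Measure (Fin k → ℝ)) (hm : ∑' i, m i Set.univ ≠ ⊤)
    (h : ∀ s : Fin k → ℝ,
      HasSum (fun i => ∫ a, Complex.exp (Complex.I * ((s ⬝ᵥ a : ℝ) : ℂ)) ∂(m i))
        (∫ l, ∫ a, Complex.exp (Complex.I * ((s ⬝ᵥ a : ℝ) : ℂ)) ∂(P l) ∂ν))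
    {S : Set (Fin k → ℝ)} (hS : MeasurableSet S) :
    HasSum (fun i => (m i).real S) (∫ l, (P l).real S ∂ν) := by
  have hfin : IsFiniteMeasure (Measure.sum m) :=
    ⟨by rw [Measure.sum_apply _ MeasurableSet.univ]; exact hm.lt_top⟩
  have hbdd : ∀ (M : Measure (Fin k → ℝ)) [IsFiniteMeasure M] (s : Fin k → ℝ),
      Integrable (fun a => Complex.exp (Complex.I * ((s ⬝ᵥ a : ℝ) : ℂ))) M := fun M _ s => by
    refine Integrable.of_bound (continuous_cexp_dotProduct s).aestronglyMeasurable 1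
      (Filter.Eventually.of_forall fun a => ?_)
    rw [mul_comm, Complex.norm_exp_ofReal_mul_I]
  -- Finite measures with the same characteristic function coincide.
  have heq : Measure.sum m = ν.bind P := by
    refine Measure.ext_of_charFunDual ?_
    funext ℓ
    set s : Fin k → ℝ := fun i => ℓ (Pi.single i 1) with hs
    have hℓ : ∀ a, Complex.exp ((ℓ a : ℂ) * Complex.I) =
        Complex.exp (Complex.I * ((s ⬝ᵥ a : ℝ) : ℂ)) := fun a => by
      have h1 : ℓ a = s ⬝ᵥ a := by
        conv_lhs => rw [← Finset.univ_sum_single a, map_sum]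
        refine Finset.sum_congr rfl fun i _ => ?_
        have h2 : (Pi.single i (a i) : Fin k → ℝ) = a i • Pi.single i (1 : ℝ) := by
          rw [← Pi.single_smul, smul_eq_mul, mul_one]
        rw [h2, map_smul, smul_eq_mul, mul_comm]
      rw [h1, mul_comm]
    simp only [charFunDual_apply, hℓ]
    rw [integral_sum_measure (hbdd _ s), (h s).tsum_eq]
    have h3 := Kernel.integral_comp (κ := Kernel.const Unit ν) (η := P) (a := ())
      (f := fun a => Complex.exp (Complex.I * ((s ⬝ᵥ a : ℝ) : ℂ)))
    rw [Kernel.comp_apply, Kernel.const_apply] at h3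
    exact (h3 (hbdd _ s)).symm
  have h1 : ∑' i, m i S = ∫⁻ l, P l S ∂ν := by
    rw [← Measure.sum_apply _ hS, heq, Measure.bind_apply hS P.measurable.aemeasurable]
  have h2 : ∑' i, m i S ≠ ⊤ :=
    ((ENNReal.tsum_le_tsum fun i => measure_mono (Set.subset_univ S)).trans_lt hm.lt_top).ne
  have h3 := ENNReal.hasSum_toReal h2
  have h4 : ∑' i, (m i S).toReal = ∫ l, (P l).real S ∂ν := by
    rw [← ENNReal.tsum_toReal_eq fun i => ENNReal.ne_top_of_tsum_ne_top h2 i, h1,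
      ← integral_toReal (P.measurable_coe hS).aemeasurable
        (Filter.Eventually.of_forall fun l => measure_lt_top _ _)]
    rfl
  rw [h4] at h3
  exact h3

end response

/-! ### Local hidden states of Gaussian states -/

section hiddenStates

open Matrix ProbabilityTheory

variable {α β ι : Type} [Fintype α] [Fintype β] [Fintype ι] [DecidableEq α] [DecidableEq β]
  [DecidableEq ι] (e : α ⊕ β ≃ ι) {γ : Matrix (ι × Fin 2) (ι × Fin 2) ℝ}

theorem isProbabilityMeasure_withDensity_gaussianWigner {γ : Matrix (ι × Fin 2) (ι × Fin 2) ℝ}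
    (hγ : γ.PosDef) (d : ι × Fin 2 → ℝ) :
    IsProbabilityMeasure (volume.withDensity fun ξ => ENNReal.ofReal (gaussianWigner d γ ξ)) := by
  refine ⟨?_⟩
  rw [withDensity_apply _ MeasurableSet.univ, Measure.restrict_univ,
    ← ofReal_integral_eq_lintegral_ofReal (integrable_gaussianWigner hγ d)
      (Filter.Eventually.of_forall fun ξ => (gaussianWigner_pos hγ d ξ).le),
    integral_gaussianWigner hγ d, ENNReal.ofReal_one]

theorem integral_withDensity_gaussianWigner {γ : Matrix (ι × Fin 2) (ι × Fin 2) ℝ}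
    (hγ : γ.PosDef) (d : ι × Fin 2 → ℝ) (g : (ι × Fin 2 → ℝ) → ℂ) :
    ∫ ξ, g ξ ∂(volume.withDensity fun ξ => ENNReal.ofReal (gaussianWigner d γ ξ)) =
      ∫ ξ, (gaussianWigner d γ ξ : ℂ) * g ξ := by
  rw [integral_withDensity_eq_integral_toReal_smul
    (continuous_gaussianWigner d γ).measurable.ennreal_ofReal
    (Filter.Eventually.of_forall fun _ => ENNReal.ofReal_lt_top)]
  refine integral_congr_ae (Filter.Eventually.of_forall fun ξ => ?_)
  simp only
  rw [ENNReal.toReal_ofReal (gaussianWigner_pos hγ d ξ).le, Complex.real_smul]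

/-- The distributions of the outcomes of a Gaussian measurement of the first party, summed over the
partial scalar products of a decomposition of the state. -/
theorem hasSum_real_law {I : Type} [Countable I] (r : I → L2 α) (hr : Summable fun i => ‖r i‖ ^ 2)
    {μ : Measure (α × Fin 2 → ℝ)} [IsProbabilityMeasure μ] {D : (α × Fin 2 → ℝ) → ℂ}
    (hD : Measurable D) (hD0 : ∀ ξ, 0 ≤ D ξ) (hDi : Integrable D μ)
    (hW : ∀ η, HasSum (fun i => weylExpectation η (r i))
      (∫ ξ, D ξ * Complex.exp (Complex.I * ((η ⬝ᵥ ξ : ℝ) : ℂ)) ∂μ))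
    {k : ℕ} (E : POVM (Fin k → ℝ) (L2 α)) {K : Matrix (α × Fin 2) (Fin k) ℝ}
    {L : Matrix (Fin k) (Fin k) ℝ} {c : Fin k → ℝ} (hL : L.PosSemidef)
    (hE : ∀ (f : L2 α) (s : Fin k → ℝ),
      ∫ a, Complex.exp (Complex.I * ((s ⬝ᵥ a : ℝ) : ℂ)) ∂(E.law f) =
        weylExpectation (K.mulVec s) f *
          Complex.exp (Complex.I * ((s ⬝ᵥ c : ℝ) : ℂ) - ((s ⬝ᵥ L.mulVec s : ℝ) : ℂ) / 4))
    {S : Set (Fin k → ℝ)} (hS : MeasurableSet S) :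
    HasSum (fun i => (E.law (r i)).real S)
      (∫ ξ, (D ξ).re * (responseKernel K L c ξ).real S ∂μ) := by
  have hre : ∀ ξ, 0 ≤ (D ξ).re := fun ξ => (Complex.nonneg_iff.1 (hD0 ξ)).1
  have him : ∀ ξ, ((D ξ).re : ℂ) = D ξ := fun ξ => by
    refine Complex.ext (by simp) ?_
    simpa using (Complex.nonneg_iff.1 (hD0 ξ)).2
  have hDm : Measurable fun ξ => (D ξ).re := Complex.measurable_re.comp hD
  -- The weight `D` is moved into the measure: the responses are then mixed by a finite measure, as
  -- uniqueness of characteristic functions requires.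
  set ν := μ.withDensity fun ξ => ENNReal.ofReal (D ξ).re with hν
  have : IsFiniteMeasure ν := isFiniteMeasure_withDensity_ofReal hDi.re.2
  have hνint : ∀ {F : Type} [NormedAddCommGroup F] [NormedSpace ℝ F]
      (g : (α × Fin 2 → ℝ) → F), ∫ ξ, g ξ ∂ν = ∫ ξ, (D ξ).re • g ξ ∂μ := fun g => by
    rw [hν, integral_withDensity_eq_integral_toReal_smul hDm.ennreal_ofReal
      (Filter.Eventually.of_forall fun _ => ENNReal.ofReal_lt_top)]
    simp only [ENNReal.toReal_ofReal (hre _)]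
  have hlaw : ∀ i, E.law (r i) Set.univ = ENNReal.ofReal (‖r i‖ ^ 2) := fun i => by
    rw [E.law_apply _ _ MeasurableSet.univ, E.effect_univ, one_apply_eq_self,
      inner_self_eq_norm_sq_to_K]
    congr 1
    norm_cast
  have hfin : ∑' i, E.law (r i) Set.univ ≠ ⊤ := by
    simp_rw [hlaw]
    exact hr.tsum_ofReal_ne_top
  have key := hasSum_real_of_charFun (ν := ν) (responseKernel K L c) (fun i => E.law (r i)) hfin
    (fun s => ?_) hS
  · rw [hνint] at key
    exact key
  · rw [hνint]
    simp_rw [hE, integral_cexp_responseKernel K hL]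
    have h := (hW (K *ᵥ s)).mul_right
      (Complex.exp (Complex.I * ((s ⬝ᵥ c : ℝ) : ℂ) - ((s ⬝ᵥ L.mulVec s : ℝ) : ℂ) / 4))
    rw [← integral_mul_const] at h
    have hsmul : ∀ (ξ : α × Fin 2 → ℝ) (t : ℂ), (D ξ).re • t = D ξ * t := fun ξ t => by
      rw [Complex.real_smul, him]
    simp_rw [hsmul, ← mul_assoc]
    exact h

/-- Gaussian states whose conditional covariance satisfies the uncertainty relation have a local
hidden state model: the hidden variable is the phase-space point of the first party, distributed
according to the marginal Wigner function. -/
theorem hasLHSModel_of_condCov_posSemidef {τ : L2 α → L2 β → L2 ι} (hτ : IsTensor e τ)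
    {ρ : L2 ι →L[ℂ] L2 ι} (hγ : γ.PosDef) {d : ι × Fin 2 → ℝ}
    (hρ : IsKernelOperator (wignerKernel (gaussianWigner d γ)) ρ)
    (hQ : (plusI γ (Omega ι)).PosSemidef)
    (hU : (plusI (condCov (modeEquiv e) γ) (Omega β)).PosSemidef) : HasLHSModel τ ρ := by
  set dA : α × Fin 2 → ℝ := fun q => d (modeEquiv e (.inl q)) with hdA
  set dB : β × Fin 2 → ℝ := fun q => d (modeEquiv e (.inr q)) with hdB
  have hd : join (modeEquiv e) dA dB = d := join_comp _ _
  have hA := posDef_margCov (modeEquiv e) hγ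
  have hS := posDef_condCov (modeEquiv e) hγ
  choose σ hσ using fun ξ : α × Fin 2 → ℝ =>
    exists_isKernelOperator_gaussianWigner hS (condMean e γ dA dB ξ)
  obtain ⟨ε, hε, C, hdom⟩ := exists_isDominatedKernel_condKernel e hγ dA dB
  have hσφ : ∀ φ ξ, ⟪φ, σ ξ φ⟫_ℂ = condExpectation e γ dA dB φ ξ := fun φ ξ =>
    (hdom ξ).inner_eq (hσ ξ) φ φ
  have hdens : ∀ ξ, IsDensityOperator (σ ξ) := fun ξ =>
    isDensityOperator_of_isKernelOperator hS hU (hσ ξ)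
  have hmeas : ∀ φ, Measurable fun ξ => ⟪φ, σ ξ φ⟫_ℂ := fun φ => by
    simp_rw [hσφ]
    exact (stronglyMeasurable_condExpectation e hγ dA dB φ).measurable
  set μ : Measure (α × Fin 2 → ℝ) := volume.withDensity fun ξ =>
    ENNReal.ofReal (gaussianWigner dA (margCov (modeEquiv e) γ) ξ) with hμ
  have hprob : IsProbabilityMeasure μ := isProbabilityMeasure_withDensity_gaussianWigner hA dA
  refine ⟨α × Fin 2 → ℝ, inferInstance, μ, σ, hprob, hdens, hmeas, ?_⟩
  rintro k E ⟨K, L, c, hL, hE⟩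
  refine ⟨responseKernel K L c, inferInstance, fun S hSm φ κ b => ?_⟩
  obtain ⟨a, b', ha, hb, ha0, hb0, hK⟩ := exists_norm_wignerKernel_join_le e hγ dA dB
  obtain ⟨I, _, ψ, hψ, hψc, hψ1, hψs⟩ := exists_rankOne_gaussianWigner hγ hQ d
  rw [hd] at hK
  have hKm := (continuous_wignerKernel_uncurry hγ d).stronglyMeasurable
  have hψm : ∀ s, StronglyMeasurable (ψ s) := fun s => (hψc s).stronglyMeasurable
  have hle := norm_le_of_hasSum hψs ha0 hb0 hK
  have hr : ∀ s, MemLp (partialVector e φ (ψ s)) 2 := fun s =>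
    memLp_partialVector (hψm s) ha ha0 hb (hle s)
  have hrsum := summable_norm_sq_partialVector hψm hψs hKm ha hb ha0 hb0 hK hr
  obtain ⟨ε', -, hdomρ⟩ := exists_isDominatedKernel_gaussianWigner hγ
  have hrank : ∀ f g : L2 α, HasSum (fun s => ⟪f, (hr s).toLp _⟫_ℂ * ⟪(hr s).toLp _, g⟫_ℂ)
      ⟪τ f φ, ρ (τ g φ)⟫_ℂ := fun f g => by
    refine ((hdomρ d).hasSum_rankOne hρ hψ hψ1.summable hψs (τ f φ) (τ g φ)).congr_fun fun s => ?_
    rw [inner_tensor_eq hτ (hψ s) (hr s), ← inner_conj_symm _ (τ g φ),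
      inner_tensor_eq hτ (hψ s) (hr s), inner_conj_symm]
  -- With `r_s` the partial scalar product of `ψ_s` and `φ`, the trace of `ρ (E(S) ⊗ |φ⟩⟨φ|)`
  -- becomes `∑ ⟪r_s, E(S) r_s⟫`, a sum of outcome probabilities of `E`.
  have hbasis := hasSum_basis_of_hasSum_rankOne b hrsum (E.effect S) hrank
  obtain ⟨M, hM⟩ := exists_integral_norm_condExpectation_le e hγ dA dB φ
  have hDi : Integrable (fun ξ => ⟪φ, σ ξ φ⟫_ℂ) μ := by
    refine Integrable.of_bound (hmeas φ).aestronglyMeasurable M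
      (Filter.Eventually.of_forall fun ξ => ?_)
    rw [hσφ]
    exact (norm_integral_le_integral_norm _).trans (hM ξ)
  have hD0 : ∀ ξ, 0 ≤ ⟪φ, σ ξ φ⟫_ℂ := fun ξ => (hdens ξ).1.inner_nonneg_right φ
  have hlaw := hasSum_real_law (fun s => (hr s).toLp _) hrsum (hmeas φ) hD0 hDi (fun η => ?_) E hL
    hE hSm
  · have hE0 : ∀ f : L2 α, 0 ≤ ⟪f, E.effect S f⟫_ℂ := fun f =>
      (E.isPositive_effect S hSm).inner_nonneg_right f
    have hEre : ∀ f : L2 α, ((E.law f).real S : ℂ) = ⟪f, E.effect S f⟫_ℂ := fun f => by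
      have h := Complex.nonneg_iff.1 (hE0 f)
      rw [Measure.real, E.law_apply _ _ hSm, ENNReal.toReal_ofReal h.1]
      exact Complex.ext (by simp) (by simpa using h.2)
    have hlaw' := (Complex.hasSum_ofReal.2 hlaw).tsum_eq
    simp only [hEre] at hlaw'
    rw [hlaw', ← integral_complex_ofReal] at hbasis
    convert hbasis using 1
    refine integral_congr_ae (Filter.Eventually.of_forall fun ξ => ?_)
    have h := Complex.nonneg_iff.1 (hD0 ξ)
    have h' : (((⟪φ, σ ξ φ⟫_ℂ).re : ℝ) : ℂ) = ⟪φ, σ ξ φ⟫_ℂ :=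
      Complex.ext (by simp) (by simpa using h.2)
    simp only
    rw [Complex.ofReal_mul, h', mul_comm]
  -- The remaining hypothesis on Weyl expectations: any `η` is the phase-space point of its
  -- positions and momenta, and the density of `μ` is the marginal density in the Fourier transform.
  · have h := hasSum_weylExpectation hψm hψs hKm ha hb ha0 hb0 hK hr (fun i => η (i, 0))
      fun i => η (i, 1)
    rw [← hd, integral_partialKernel_eq e hγ, phasePoint_self] at h
    rw [hμ, integral_withDensity_gaussianWigner hA]
    convert h using 1
    refine integral_congr_ae (Filter.Eventually.of_forall fun ξ => ?_)
    simp only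
    rw [hσφ]
    ring

end hiddenStates

/-! ### The main theorem -/

section main

open Matrix

variable {α β : Type} [Fintype α] [Fintype β] [DecidableEq α] [DecidableEq β]

theorem partialOmega_submatrix : (partialOmega α β).submatrix
    (modeEquiv (Equiv.refl (α ⊕ β))) (modeEquiv (Equiv.refl (α ⊕ β))) =
      fromBlocks (-Omega α) 0 0 (Omega β) := by
  ext q q'
  rcases q with ⟨i, j⟩ | ⟨i, j⟩ <;> rcases q' with ⟨i', j'⟩ | ⟨i', j'⟩ <;> rfl

theorem neg_partialOmega_submatrix : (-partialOmega α β).submatrix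
    (modeEquiv (Equiv.sumComm β α)) (modeEquiv (Equiv.sumComm β α)) =
      fromBlocks (-Omega β) 0 0 (Omega α) := by
  ext q q'
  rcases q with ⟨i, j⟩ | ⟨i, j⟩ <;> rcases q' with ⟨i', j'⟩ | ⟨i', j'⟩ <;>
    simp [partialOmega, modeEquiv]

theorem partialOmega_transpose : (partialOmega α β)ᵀ = -partialOmega α β := by
  rw [partialOmega, transpose_submatrix, fromBlocks_transpose, transpose_neg, Omega_transpose,
    Omega_transpose, transpose_zero, transpose_zero]
  ext q q'
  rcases q with ⟨i | i, j⟩ <;> rcases q' with ⟨i' | i', j'⟩ <;> simp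

variable {ρ : L2 (α ⊕ β) →L[ℂ] L2 (α ⊕ β)} {d : (α ⊕ β) × Fin 2 → ℝ}
  {γ : Matrix ((α ⊕ β) × Fin 2) ((α ⊕ β) × Fin 2) ℝ}

theorem IsGaussianState.plusI_Omega_posSemidef (hρ : IsGaussianState ρ d γ) :
    (plusI γ (Omega (α ⊕ β))).PosSemidef :=
  plusI_Omega_posSemidef_of_isPositive hρ.2.1 hρ.2.2 hρ.1.1

theorem not_isSteerableAB_of_posSemidef (hρ : IsGaussianState ρ d γ)
    (h : (plusI γ (partialOmega α β)).PosSemidef) : ¬ IsSteerableAB ρ :=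
  not_not_intro (hasLHSModel_of_condCov_posSemidef (Equiv.refl _) isTensor_tensor hρ.2.1 hρ.2.2
    hρ.plusI_Omega_posSemidef (condCov_plusI_Omega_posSemidef _ hρ.2.1 partialOmega_submatrix
      hρ.plusI_Omega_posSemidef h))

/-- Transposing the inequality gives `γ + i(Ω_A ⊕ -Ω_B) ≥ 0`, which is the same criterion with the
parties exchanged. -/
theorem not_isSteerableBA_of_posSemidef (hρ : IsGaussianState ρ d γ)
    (h : (plusI γ (partialOmega α β)).PosSemidef) : ¬ IsSteerableBA ρ := by
  have h' : (plusI γ (-partialOmega α β)).PosSemidef := by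
    rw [← plusI_transpose (isSymm_of_posDef hρ.2.1) partialOmega_transpose]
    exact h.transpose
  exact not_not_intro (hasLHSModel_of_condCov_posSemidef (Equiv.sumComm β α) isTensor_tensor_swap
    hρ.2.1 hρ.2.2 hρ.plusI_Omega_posSemidef (condCov_plusI_Omega_posSemidef _ hρ.2.1
      neg_partialOmega_submatrix hρ.plusI_Omega_posSemidef h'))

end main

end

end GaussianSteering

theorem theorem4 (M N : ℕ)
    (ρ : GaussianSteering.L2 (Fin M ⊕ Fin N) →L[ℂ] GaussianSteering.L2 (Fin M ⊕ Fin N))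
    (d : (Fin M ⊕ Fin N) × Fin 2 → ℝ)
    (γ : Matrix ((Fin M ⊕ Fin N) × Fin 2) ((Fin M ⊕ Fin N) × Fin 2) ℝ)
    (hρ : GaussianSteering.IsGaussianState ρ d γ)
    (hsteer : GaussianSteering.IsSteerableAB ρ ∨ GaussianSteering.IsSteerableBA ρ) :
    ¬ (GaussianSteering.plusI γ
        (GaussianSteering.partialOmega (Fin M) (Fin N))).PosSemidef ∧
      GaussianSteering.IsNPT ρ := by
  have h : ¬ (GaussianSteering.plusI γ
      (GaussianSteering.partialOmega (Fin M) (Fin N))).PosSemidef := fun h =>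
    hsteer.elim (GaussianSteering.not_isSteerableAB_of_posSemidef hρ h)
      (GaussianSteering.not_isSteerableBA_of_posSemidef hρ h)
  exact ⟨h, GaussianSteering.isNPT_of_not_posSemidef hρ h⟩
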